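/- Let $H=(H_{\mathbb Q},W,F)$ be a mixed Hodge structure over $\mathbb Q$ (finite-dimensional, with no integral structure) such that every $\mathrm{gr}^W_wH$ is $\mathbb R$-polarizable, that is, carries a $\mathbb C$-bilinear form on its complexification that is the extension of an $\mathbb R$-bilinear form on $(\mathrm{gr}^W_wH)_{\mathbb R}$ and polarizes the Hodge structure. There is a unique pair $(h,\delta)$, consisting of a homomorphism $h:S_{\mathbb C/\mathbb R}\to\mathrm{Aut}(H_{\mathbb R})$ of algebraic groups over $\mathbb R$, where $S_{\mathbb C/\mathbb R}$ is the Weil restriction of $\mathbb G_m$ from $\mathbb C$ to $\mathbb R$, and of $\delta\in\mathrm{End}(H_{\mathbb R})$, with the following properties. Let $V^{p,q}\subset H_{\mathbb C}$ be the subspace on which $z\in\mathbb C^\times=S_{\mathbb C/\mathbb R}(\mathbb R)$ acts through $h$ as $z^p\bar z^q$. Then $$W_{k,\mathbb C}=\bigoplus_{p+q\le k}V^{p,q},\qquad \delta(V^{p,q})\subset\bigoplus_{p'<p,\;q'<q}V^{p',q'},\qquad F^p=\exp(i\delta)\bigoplus_{p'\ge p,\;q\in\mathbb Z}V^{p',q}$$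 for all $k,p,q\in\mathbb Z$. Moreover, the following two groups coincide. (a) The Tannaka group of the Tannakian category $\langle H\rangle$ generated by $H$, that is, the group functor $R\mapsto\mathrm{Aut}^{\otimes}(\omega_R)$ on commutative $\mathbb Q$-algebras, where $\langle H\rangle$ is the smallest full subcategory of the category of mixed Hodge structures over $\mathbb Q$ that contains $H$ and the unit object $\mathbb Q(0)$ and is closed under direct sums, tensor products, duals, subobjects and quotient objects, and $\omega_R(X)=R\otimes_{\mathbb Q}X_{\mathbb Q}$. (b) The smallest (closed algebraic) $\mathbb Q$-subgroup $G$ of $\mathrm{Aut}(H_{\mathbb Q})$ such that $G(\mathbb R)$ contains $h(z)$ for all $z\in\mathbb C^\times$ and such that $\mathrm{Lie}(G)_{\mathbb R}$ contains $\delta$. More precisely, a smallest such $G$ exists, and for every commutative $\mathbb Q$-algebra $R$ the homomorphism $\mathrm{Aut}^{\otimes}(\omega_R)\to\mathrm{Aut}_R(R\otimes_{\mathbb Q}H_{\mathbb Q})$, $g\mapsto g_H$, is injective with image $G(R)$. -/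

import Mathlib

open scoped TensorProduct DualNumber

noncomputable section

namespace MumfordTate

/-! ### Extension of scalars over `ℚ` -/

section Scalars

variable {V : Type} [AddCommGroup V] [Module ℚ V]

/-- Base change of an `R`-linear endomorphism of `R ⊗ V` along a homomorphism `R → S` of
`ℚ`-algebras: the `S`-linear endomorphism of `S ⊗ V` with the same values on `V`. -/
def extendEnd {R S : Type} [CommRing R] [Algebra ℚ R] [CommRing S] [Algebra ℚ S]
    (f : R →ₐ[ℚ] S) (T : Module.End R (R ⊗[ℚ] V)) : Module.End S (S ⊗[ℚ] V) :=
  LinearMap.liftBaseChange S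
    ((TensorProduct.map f.toLinearMap LinearMap.id) ∘ₗ (T.restrictScalars ℚ) ∘ₗ
      (TensorProduct.mk ℚ R V 1))

/-- The inclusion of `ℝ` into `ℂ`. -/
abbrev realToComplex : ℝ →ₐ[ℚ] ℂ := Complex.ofRealAm.restrictScalars ℚ

/-- The inclusion of `ℝ` into the dual numbers `ℝ[ε]`. -/
abbrev realToDual : ℝ →ₐ[ℚ] ℝ[ε] := TrivSqZeroExt.inlAlgHom ℚ ℝ ℝ

variable (V) in
/-- Complex conjugation `z ⊗ v ↦ z̄ ⊗ v` on `ℂ ⊗ V`, as a semilinear map. -/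
def conjMap : (ℂ ⊗[ℚ] V) →ₛₗ[starRingEnd ℂ] (ℂ ⊗[ℚ] V) where
  toFun := TensorProduct.map (Complex.conjAe.toLinearMap.restrictScalars ℚ) LinearMap.id
  map_add' := map_add _
  map_smul' c x := by
    induction x with
    | zero => simp
    | tmul z v => simp [TensorProduct.smul_tmul']
    | add x y hx hy => simp only [smul_add, map_add, hx, hy]

/-- The complex conjugate of a complex subspace of `ℂ ⊗ V`. -/
def conjSub (A : Submodule ℂ (ℂ ⊗[ℚ] V)) : Submodule ℂ (ℂ ⊗[ℚ] V) :=
  A.comap (conjMap V)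

/-- A decreasing filtration `F` on `ℂ ⊗ V` is the Hodge filtration of a pure Hodge structure
of weight `w`. -/
def IsPure (F : ℤ → Submodule ℂ (ℂ ⊗[ℚ] V)) (w : ℤ) : Prop :=
  ∀ p : ℤ, IsCompl (F p) (conjSub (F (w + 1 - p)))

/-- A pure Hodge structure of weight `w`, given by its Hodge filtration `F`, is
`ℝ`-polarizable. An `ℝ`-bilinear form on `ℝ ⊗ V` is the same as a `ℂ`-bilinear form `B` on
`ℂ ⊗ V` which is compatible with complex conjugation. The Hodge component of type `(p, w - p)`
is `F p ⊓ conjSub (F (w - p))`. -/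
def IsRPolarizable (F : ℤ → Submodule ℂ (ℂ ⊗[ℚ] V)) (w : ℤ) : Prop :=
  ∃ B : LinearMap.BilinForm ℂ (ℂ ⊗[ℚ] V),
    (∀ x y, B (conjMap V x) (conjMap V y) = starRingEnd ℂ (B x y)) ∧
    (∀ x y, B y x = (-1 : ℂ) ^ w * B x y) ∧
    (∀ p : ℤ, ∀ x ∈ F p, ∀ y ∈ F (w + 1 - p), B x y = 0) ∧
    (∀ p : ℤ, ∀ x ∈ F p ⊓ conjSub (F (w - p)), x ≠ 0 →
      ∃ r : ℝ, 0 < r ∧ Complex.I ^ (p - (w - p)) * B x (conjMap V x) = r)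

end Scalars

/-! ### Mixed Hodge structures -/

/-- A finite-dimensional `ℚ`-vector space `V` with a family `W` of subspaces of `V` and a family
`F` of subspaces of `ℂ ⊗ V`. Mixed Hodge structures are those that satisfy `IsMHS` below. -/
structure HodgeTriple where
  V : Type
  [addCommGroup : AddCommGroup V]
  [module : Module ℚ V]
  [finite : FiniteDimensional ℚ V]
  W : ℤ → Submodule ℚ V
  F : ℤ → Submodule ℂ (ℂ ⊗[ℚ] V)

attribute [instance] HodgeTriple.addCommGroup HodgeTriple.module HodgeTriple.finite

namespace HodgeTriple

/-- The `ℚ`-vector space `gr^W_w = W_w / W_{w-1}`. -/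
abbrev Gr (X : HodgeTriple) (w : ℤ) : Type := (X.W w) ⧸ (X.W (w - 1)).submoduleOf (X.W w)

/-- The filtration induced by `F` on `ℂ ⊗ gr^W_w`: the image of `F^p ∩ (ℂ ⊗ W_w)`. -/
def grF (X : HodgeTriple) (w p : ℤ) : Submodule ℂ (ℂ ⊗[ℚ] X.Gr w) :=
  ((X.F p).comap ((X.W w).subtype.baseChange ℂ)).map
    (((X.W (w - 1)).submoduleOf (X.W w)).mkQ.baseChange ℂ)

/-- `(V, W, F)` is a mixed Hodge structure over `ℚ`. -/
structure IsMHS (X : HodgeTriple) : Prop where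
  monotone_W : Monotone X.W
  antitone_F : Antitone X.F
  W_bot : ∃ k, X.W k = ⊥
  W_top : ∃ k, X.W k = ⊤
  F_top : ∃ p, X.F p = ⊤
  F_bot : ∃ p, X.F p = ⊥
  pure_gr : ∀ w, IsPure (X.grF w) w

/-- Morphisms: `ℚ`-linear maps compatible with `W` and, after extension of scalars, with `F`. -/
def IsMorphism (X Y : HodgeTriple) (f : X.V →ₗ[ℚ] Y.V) : Prop :=
  (∀ k, (X.W k).map f ≤ Y.W k) ∧ (∀ p, (X.F p).map (f.baseChange ℂ) ≤ Y.F p)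

/-- The unit object `ℚ(0)`: the space `ℚ`, of weight `0` and Hodge type `(0, 0)`. -/
def unit : HodgeTriple where
  V := ℚ
  W k := if 0 ≤ k then ⊤ else ⊥
  F p := if p ≤ 0 then ⊤ else ⊥

/-- The direct sum. -/
def prod (X Y : HodgeTriple) : HodgeTriple where
  V := X.V × Y.V
  W k := (X.W k).prod (Y.W k)
  F p := (X.F p).comap ((LinearMap.fst ℚ X.V Y.V).baseChange ℂ) ⊓
    (Y.F p).comap ((LinearMap.snd ℚ X.V Y.V).baseChange ℂ)

/-- The tensor product: `W_k = ∑ W_i ⊗ W_{k-i}` and `F^p = ∑ F^r ⊗ F^{p-r}`. -/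
def tensor (X Y : HodgeTriple) : HodgeTriple where
  V := X.V ⊗[ℚ] Y.V
  W k := ⨆ i : ℤ, Submodule.map₂ (TensorProduct.mk ℚ X.V Y.V) (X.W i) (Y.W (k - i))
  F p := (⨆ r : ℤ, Submodule.map₂ (TensorProduct.mk ℂ (ℂ ⊗[ℚ] X.V) (ℂ ⊗[ℚ] Y.V))
      (X.F r) (Y.F (p - r))).map
    (TensorProduct.AlgebraTensorModule.distribBaseChange ℚ ℂ X.V Y.V).symm.toLinearMap

/-- The isomorphism `R ⊗ (V ⊗ V') ≃ (R ⊗ V) ⊗_R (R ⊗ V')`. -/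
def tensorIso (X Y : HodgeTriple) (R : Type) [CommRing R] [Algebra ℚ R] :
    (R ⊗[ℚ] (X.tensor Y).V) ≃ₗ[R] (R ⊗[ℚ] X.V) ⊗[R] (R ⊗[ℚ] Y.V) :=
  TensorProduct.AlgebraTensorModule.distribBaseChange ℚ R X.V Y.V

/-- The pairing between `ℂ ⊗ V^∨` and `ℂ ⊗ V`. -/
def pairing (V : Type) [AddCommGroup V] [Module ℚ V] :
    (ℂ ⊗[ℚ] Module.Dual ℚ V) →ₗ[ℂ] (ℂ ⊗[ℚ] V) →ₗ[ℂ] ℂ :=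
  LinearMap.liftBaseChange ℂ (Module.Dual.baseChange ℂ)

/-- The dual: `W_k` is the annihilator of `W_{-k-1}` and `F^p` is the annihilator
of `F^{1-p}`. -/
def dual (X : HodgeTriple) : HodgeTriple where
  V := Module.Dual ℚ X.V
  W k := (X.W (-k - 1)).dualAnnihilator
  F p := ((X.F (1 - p)).dualAnnihilator).comap (pairing X.V)

/-- The objects of the Tannakian category generated by `H`: the smallest full subcategory of the
category of mixed Hodge structures over `ℚ` which contains `H` and the unit object and is closed
under direct sums, tensor products, duals, subobjects and quotient objects (and so under
isomorphisms). -/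
inductive Generated (H : HodgeTriple) : HodgeTriple → Prop
  | self : Generated H H
  | unit : Generated H unit
  | prod {X Y : HodgeTriple} : Generated H X → Generated H Y → Generated H (X.prod Y)
  | tensor {X Y : HodgeTriple} : Generated H X → Generated H Y → Generated H (X.tensor Y)
  | dual {X : HodgeTriple} : Generated H X → Generated H X.dual
  | sub {X Y : HodgeTriple} (f : Y.V →ₗ[ℚ] X.V) : Generated H X → Y.IsMHS →
      IsMorphism Y X f → Function.Injective f → Generated H Y
  | quot {X Y : HodgeTriple} (f : X.V →ₗ[ℚ] Y.V) : Generated H X → Y.IsMHS →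
      IsMorphism X Y f → Function.Surjective f → Generated H Y

/-- The `R`-points of the Tannaka group of the Tannakian category generated by `H`: tensor
automorphisms of the fibre functor `X ↦ R ⊗ X.V`, that is, families of automorphisms of the
`R`-modules `R ⊗ X.V` which are natural in `X` and compatible with tensor products and with the
unit object. -/
def tannakaGroup (H : HodgeTriple) (R : Type) [CommRing R] [Algebra ℚ R] :
    Subgroup (∀ X : {X : HodgeTriple // Generated H X},
      (R ⊗[ℚ] X.1.V) ≃ₗ[R] (R ⊗[ℚ] X.1.V)) where
  carrier := {g |
    (∀ (X Y : {X : HodgeTriple // Generated H X}) (f : X.1.V →ₗ[ℚ] Y.1.V),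
      IsMorphism X.1 Y.1 f →
        ∀ x, f.baseChange R (g X x) = g Y (f.baseChange R x)) ∧
    (∀ (X Y : {X : HodgeTriple // Generated H X}) (x : R ⊗[ℚ] (X.1.tensor Y.1).V),
      tensorIso X.1 Y.1 R (g ⟨X.1.tensor Y.1, X.2.tensor Y.2⟩ x) =
        TensorProduct.map (g X).toLinearMap (g Y).toLinearMap (tensorIso X.1 Y.1 R x)) ∧
    (∀ x : R ⊗[ℚ] HodgeTriple.unit.V, g ⟨HodgeTriple.unit, Generated.unit⟩ x = x)}
  one_mem' := by
    refine ⟨fun _ _ _ _ _ => rfl, fun X Y x => ?_, fun _ => rfl⟩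
    exact (LinearMap.congr_fun TensorProduct.map_id _).symm
  mul_mem' := by
    rintro a b ⟨ha1, ha2, ha3⟩ ⟨hb1, hb2, hb3⟩
    refine ⟨fun X Y f hf x => ?_, fun X Y x => ?_, fun x => ?_⟩
    · exact (ha1 X Y f hf _).trans (congrArg (a Y) (hb1 X Y f hf x))
    · refine (ha2 X Y _).trans ((congrArg _ (hb2 X Y x)).trans ?_)
      rw [← LinearMap.comp_apply, ← TensorProduct.map_comp]
      rfl
    · exact (congrArg _ (hb3 x)).trans (ha3 x)
  inv_mem' := by
    rintro a ⟨ha1, ha2, ha3⟩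
    refine ⟨fun X Y f hf x => ?_, fun X Y x => ?_, fun x => ?_⟩
    · change f.baseChange R ((a X).symm x) = (a Y).symm (f.baseChange R x)
      rw [LinearEquiv.eq_symm_apply, ← ha1 X Y f hf, LinearEquiv.apply_symm_apply]
    · have h := ha2 X Y ((a ⟨X.1.tensor Y.1, X.2.tensor Y.2⟩).symm x)
      rw [LinearEquiv.apply_symm_apply] at h
      change tensorIso X.1 Y.1 R ((a ⟨X.1.tensor Y.1, X.2.tensor Y.2⟩).symm x) =
        TensorProduct.map (a X).symm.toLinearMap (a Y).symm.toLinearMap (tensorIso X.1 Y.1 R x)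
      rw [h, ← LinearMap.comp_apply, ← TensorProduct.map_comp]
      simp
    · change (a ⟨HodgeTriple.unit, Generated.unit⟩).symm x = x
      rw [LinearEquiv.symm_apply_eq, ha3]

/-- The homomorphism from the Tannaka group to the group of automorphisms of `H`, on
`R`-points. -/
def tannakaEval (H : HodgeTriple) (R : Type) [CommRing R] [Algebra ℚ R] :
    H.tannakaGroup R →* ((R ⊗[ℚ] H.V) ≃ₗ[R] (R ⊗[ℚ] H.V)) :=
  (Pi.evalMonoidHom _ ⟨H, Generated.self⟩).comp (H.tannakaGroup R).subtype

end HodgeTriple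

/-! ### The canonical splitting -/

section Splitting

variable {V : Type} [AddCommGroup V] [Module ℚ V]

/-- The Hodge component of type `(p, q)` of an action `h` of `ℂˣ` on `ℝ ⊗ V`: the subspace of
`ℂ ⊗ V` on which every `z` acts as `z^p z̄^q`. -/
def hodgeComp (h : ℂˣ →* ((ℝ ⊗[ℚ] V) ≃ₗ[ℝ] (ℝ ⊗[ℚ] V))) (p q : ℤ) :
    Submodule ℂ (ℂ ⊗[ℚ] V) :=
  ⨅ z : ℂˣ, LinearMap.ker (extendEnd realToComplex (h z).toLinearMap -
    ((z : ℂ) ^ p * (starRingEnd ℂ (z : ℂ)) ^ q) • (1 : Module.End ℂ (ℂ ⊗[ℚ] V)))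

/-- The homomorphism `h : ℂˣ → GL(ℝ ⊗ V)` is the map on real points of a homomorphism of
algebraic groups over `ℝ`, the source being the Weil restriction of the multiplicative group:
it is given by a Hodge decomposition of `ℂ ⊗ V`. -/
def IsAlgebraicAction (h : ℂˣ →* ((ℝ ⊗[ℚ] V) ≃ₗ[ℝ] (ℝ ⊗[ℚ] V))) : Prop :=
  DirectSum.IsInternal (fun pq : ℤ × ℤ => hodgeComp h pq.1 pq.2)

end Splitting

/-- `(h, δ)` is the pair which belongs to `(V, W, F)`: the weight filtration is the one defined by
the weights of `h`, the components of type `(a, b)` of `δ` vanish unless `a < 0` and `b < 0`, and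
`F^p = exp(iδ) ⨁_{a ≥ p, b} V^{a,b}`, where `V^{a,b}` are the Hodge components of `h`. -/
structure HodgeTriple.IsCanonicalPair (X : HodgeTriple)
    (h : ℂˣ →* ((ℝ ⊗[ℚ] X.V) ≃ₗ[ℝ] (ℝ ⊗[ℚ] X.V))) (δ : Module.End ℝ (ℝ ⊗[ℚ] X.V)) : Prop where
  algebraic : IsAlgebraicAction h
  weight : ∀ k : ℤ, (X.W k).baseChange ℂ = ⨆ (a : ℤ) (b : ℤ) (_ : a + b ≤ k), hodgeComp h a b
  lower : ∀ p q : ℤ, (hodgeComp h p q).map (extendEnd realToComplex δ) ≤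
    ⨆ (a : ℤ) (b : ℤ) (_ : a < p) (_ : b < q), hodgeComp h a b
  hodge : ∀ p : ℤ, X.F p =
    (⨆ (a : ℤ) (b : ℤ) (_ : p ≤ a), hodgeComp h a b).map
      (IsNilpotent.exp (Complex.I • extendEnd realToComplex δ))

/-! ### Algebraic subgroups of a general linear group -/

/-- A `ℚ`-subgroup of `Aut(V)`, that is, a closed subgroup scheme over `ℚ` of the general linear
group of `V`, as a functor of points: a subgroup of `GL(R ⊗ V)` for every commutative `ℚ`-algebra
`R`, cut out, uniformly in `R`, by polynomial equations over `ℚ` between matrix coefficients. The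
variable `(v, φ)` stands for the matrix coefficient `φ(g v)`. -/
structure QSubgroup (V : Type) [AddCommGroup V] [Module ℚ V] where
  pts : ∀ (R : Type) [CommRing R] [Algebra ℚ R], Subgroup ((R ⊗[ℚ] V) ≃ₗ[R] (R ⊗[ℚ] V))
  closed : ∃ P : Set (MvPolynomial (V × Module.Dual ℚ V) ℚ),
    ∀ (R : Type) [CommRing R] [Algebra ℚ R] (g : (R ⊗[ℚ] V) ≃ₗ[R] (R ⊗[ℚ] V)),
      g ∈ pts R ↔ ∀ f ∈ P,
        MvPolynomial.aeval (fun x : V × Module.Dual ℚ V => Module.Dual.baseChange R x.2 (g (1 ⊗ₜ x.1))) f = 0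

namespace QSubgroup

variable {V : Type} [AddCommGroup V] [Module ℚ V]

/-- Inclusion of `ℚ`-subgroups. -/
instance : LE (QSubgroup V) where
  le K L := ∀ (R : Type) [CommRing R] [Algebra ℚ R], K.pts R ≤ L.pts R

/-- Membership in the real Lie algebra `Lie(K)_ℝ`: `δ` belongs to it if and only if `1 + εδ` is an
`ℝ[ε]`-point of `K`. -/
def MemLieReal (K : QSubgroup V) (δ : Module.End ℝ (ℝ ⊗[ℚ] V)) : Prop :=
  ∃ u ∈ K.pts ℝ[ε], u.toLinearMap = 1 + (DualNumber.eps : ℝ[ε]) • extendEnd realToDual δ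

/-- The real points of `K` contain the image of `h`, and `Lie(K)_ℝ` contains `δ`. -/
def ContainsPair (K : QSubgroup V) (h : ℂˣ →* ((ℝ ⊗[ℚ] V) ≃ₗ[ℝ] (ℝ ⊗[ℚ] V)))
    (δ : Module.End ℝ (ℝ ⊗[ℚ] V)) : Prop :=
  h.range ≤ K.pts ℝ ∧ K.MemLieReal δ

end QSubgroup

end MumfordTate

end

/-! Existence of the pair. Deligne's splitting A of (W, F) and its complex conjugate J are
bigradings of `ℂ ⊗ V`, and each is triangular with respect to the other. Hence J = exp(N) A for some
N with components only in bidegrees with both entries negative (`exists_exp_map_eq`). Conjugation σ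
exchanges A and J up to the swap of indices, which forces σNσ = -N. So D = (i/2)N is real, the
bigrading exp(N/2)A is stable under conjugation up to the swap, and exp(iD) takes it back to A, from
which F is read off (`exists_real_splitting`). The characters z^p z̄^q on this bigrading give h, and
D gives δ, after descent from ℂ to ℝ.

Functoriality and uniqueness. Let f be a morphism, N = iδ and N' = iδ'. The maps g = exp(-N') f
exp(N) and g' = exp(N') f exp(-N) are conjugate to each other, and exp(2N') g = g' exp(2N). The
filtrations bound the bidegrees of g and of g' from different sides, and the relation leaves only
degree 0; then g = g', and g intertwines exp(2N) and exp(2N'), hence N and N', so that f = g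
(`IsMorphism.compat_complex`). The identity morphism gives uniqueness.

From the group to the Tannaka group. Conversely, a triple with a canonical pair is a mixed Hodge
structure (`IsCanonicalPair.isMHS`), and canonical pairs of sums, tensor products and duals are
given by the usual formulas. Let G be the intersection of all ℚ-groups that contain (h, δ). A
rational subspace of a representation of G that is stable under h and δ is stable under G, because
its stabilizer is a ℚ-group containing the pair (`IsGeneratedBy.stable`). By functoriality this
applies to subobjects, kernels and graphs of morphisms. So G acts on every object of the generated
category, compatibly with morphisms and tensor products (`exists_tannaka`).

From the Tannaka group to the group. A polynomial f in the matrix coefficients of t on H equals one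
coefficient ℓ(t x) of t on some generated X (`exists_matrix_coefficient`). If f vanishes on G, then
ℓ kills the G-orbit of x. The common kernel Y of all such linear forms contains x and is G-stable
(`RegRep.act_mem_orbit`), hence stable under h and δ, hence a mixed Hodge substructure. So t
preserves Y, and ℓ(t x) = 0. Thus t on H satisfies every equation of G (`tannaka_mem`). Finally t is
determined by its value on H, by induction over the construction of the objects; for duals the
evaluation pairing with values in the unit object is used (`tannaka_eq_one_of_eval`). -/

open scoped TensorProduct DualNumber

noncomputable section

namespace MumfordTate

/-! ### Gradings -/

section Gradings

variable {k ι E E' E'' : Type*} [Field k] [AddCommGroup E] [Module k E] [AddCommGroup E']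
  [Module k E'] [AddCommGroup E''] [Module k E'']

/-- The sum of the members of the family `A` with index in `S`. -/
def gspan (A : ι → Submodule k E) (S : Set ι) : Submodule k E := ⨆ i ∈ S, A i

theorem le_gspan (A : ι → Submodule k E) {S : Set ι} {i : ι} (hi : i ∈ S) : A i ≤ gspan A S :=
  le_biSup A hi

theorem gspan_le {A : ι → Submodule k E} {S : Set ι} {B : Submodule k E} :
    gspan A S ≤ B ↔ ∀ i ∈ S, A i ≤ B := iSup₂_le_iff

theorem gspan_mono (A : ι → Submodule k E) {S T : Set ι} (h : S ⊆ T) : gspan A S ≤ gspan A T :=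
  gspan_le.2 fun _ hi => le_gspan A (h hi)

theorem gspan_univ (A : ι → Submodule k E) : gspan A Set.univ = ⨆ i, A i := by
  simp [gspan]

theorem gspan_singleton (A : ι → Submodule k E) (i : ι) : gspan A {i} = A i := by
  simp [gspan]

theorem gspan_union (A : ι → Submodule k E) (S T : Set ι) :
    gspan A (S ∪ T) = gspan A S ⊔ gspan A T := iSup_union

theorem gspan_empty (A : ι → Submodule k E) : gspan A ∅ = ⊥ := by
  simp [gspan]

theorem map_gspan (A : ι → Submodule k E) (S : Set ι) (f : E →ₗ[k] E') :
    (gspan A S).map f = gspan (fun i => (A i).map f) S := by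
  simp [gspan, Submodule.map_iSup]

theorem gspan_prod (A : ℤ → ℤ → Submodule k E) (P : ℤ → ℤ → Prop) :
    (⨆ (a : ℤ) (b : ℤ) (_ : P a b), A a b) = gspan (fun i : ℤ × ℤ => A i.1 i.2) {i | P i.1 i.2} := by
  simp [gspan, iSup_prod]

theorem gspan_prod' (A : ℤ → ℤ → Submodule k E) (P : ℤ → Prop) :
    (⨆ (a : ℤ) (b : ℤ) (_ : P a), A a b) = gspan (fun i : ℤ × ℤ => A i.1 i.2) {i | P i.1} :=
  gspan_prod A fun a _ => P a

theorem gspan_prod_and (A : ℤ → ℤ → Submodule k E) (P Q : ℤ → Prop) :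
    (⨆ (a : ℤ) (b : ℤ) (_ : P a) (_ : Q b), A a b) =
      gspan (fun i : ℤ × ℤ => A i.1 i.2) {i | P i.1 ∧ Q i.2} := by
  simp [gspan, iSup_prod, iSup_and]

variable [DecidableEq ι]

/-- The projection to a member of a direct sum decomposition. -/
def gproj {A : ι → Submodule k E} (hA : DirectSum.IsInternal A) (i : ι) : E →ₗ[k] E :=
  (A i).subtype ∘ₗ DirectSum.component k ι (fun i => A i) i ∘ₗ
    (LinearEquiv.ofBijective (DirectSum.coeLinearMap A) hA).symm.toLinearMap

variable {A : ι → Submodule k E} (hA : DirectSum.IsInternal A)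
include hA

theorem gproj_mem (i : ι) (x : E) : gproj hA i x ∈ A i := by
  simp [gproj]

theorem gproj_of_mem {i : ι} {x : E} (hx : x ∈ A i) : gproj hA i x = x := by
  exact congrArg Subtype.val (hA.ofBijective_coeLinearMap_of_mem hx)

theorem gproj_of_mem_ne {i j : ι} (hij : i ≠ j) {x : E} (hx : x ∈ A i) : gproj hA j x = 0 := by
  exact congrArg Subtype.val (hA.ofBijective_coeLinearMap_of_mem_ne hij hx)

theorem exists_eq_sum_gproj (x : E) : ∃ s : Finset ι, (∀ i ∉ s, gproj hA i x = 0) ∧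
    x = ∑ i ∈ s, gproj hA i x := by
  have hx : x ∈ ⨆ i, A i := by rw [hA.submodule_iSup_eq_top]; trivial
  induction hx using Submodule.iSup_induction' with
  | mem i x hx =>
    refine ⟨{i}, fun j hj => gproj_of_mem_ne hA (by simpa [eq_comm] using hj) hx, ?_⟩
    simp [gproj_of_mem hA hx]
  | zero => exact ⟨∅, by simp, by simp⟩
  | add x y _ _ hx hy =>
    obtain ⟨s, hs, hs'⟩ := hx
    obtain ⟨t, ht, ht'⟩ := hy
    refine ⟨s ∪ t, fun i hi => ?_, ?_⟩
    · simp only [Finset.mem_union, not_or] at hi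
      simp [hs i hi.1, ht i hi.2]
    · have h1 : ∑ i ∈ s ∪ t, gproj hA i x = ∑ i ∈ s, gproj hA i x :=
        (Finset.sum_subset Finset.subset_union_left fun i _ hi => hs i hi).symm
      have h2 : ∑ i ∈ s ∪ t, gproj hA i y = ∑ i ∈ t, gproj hA i y :=
        (Finset.sum_subset Finset.subset_union_right fun i _ hi => ht i hi).symm
      simp only [map_add, Finset.sum_add_distrib, h1, h2, ← hs', ← ht']

/-- Directness turns membership into vanishing of components, so that intersections of spans become
spans over intersections of index sets. -/
theorem mem_gspan_iff {S : Set ι} {x : E} : x ∈ gspan A S ↔ ∀ i ∉ S, gproj hA i x = 0 := by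
  constructor
  · intro hx i hi
    have : gspan A S ≤ LinearMap.ker (gproj hA i) :=
      gspan_le.2 fun j hj y hy => gproj_of_mem_ne hA (fun h : j = i => hi (h ▸ hj)) hy
    exact this hx
  · intro h
    obtain ⟨s, -, hs⟩ := exists_eq_sum_gproj hA x
    rw [hs]
    refine Submodule.sum_mem _ fun i _ => ?_
    by_cases hi : i ∈ S
    · exact le_gspan A hi (gproj_mem hA i x)
    · rw [h i hi]; exact Submodule.zero_mem _

theorem gspan_inf (S T : Set ι) : gspan A S ⊓ gspan A T = gspan A (S ∩ T) := by
  ext x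
  simp only [Submodule.mem_inf, mem_gspan_iff hA]
  constructor
  · rintro ⟨h1, h2⟩ i hi
    by_cases h : i ∈ S
    · exact h2 i fun h' => hi ⟨h, h'⟩
    · exact h1 i h
  · exact fun h => ⟨fun i hi => h i fun h' => hi h'.1, fun i hi => h i fun h' => hi h'.2⟩

theorem eq_of_forall_mem {f g : E →ₗ[k] E'} (h : ∀ i, ∀ x ∈ A i, f x = g x) : f = g := by
  refine LinearMap.ext fun x => ?_
  have : ⨆ i, A i ≤ LinearMap.ker (f - g) := iSup_le fun i x hx => by simp [h i x hx]
  have := this (hA.submodule_iSup_eq_top ▸ Submodule.mem_top (x := x))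
  simpa [sub_eq_zero] using this

theorem finite_ne_bot [FiniteDimensional k E] : {i | A i ≠ ⊥}.Finite :=
  WellFoundedGT.finite_ne_bot_of_iSupIndep hA.submodule_iSupIndep

/-- A linear map with prescribed restrictions to the members of a decomposition. -/
theorem exists_linearMap_of_isInternal (f : ι → (E →ₗ[k] E')) :
    ∃ g : E →ₗ[k] E', ∀ i, ∀ x ∈ A i, g x = f i x := by
  refine ⟨DirectSum.toModule k ι E' (fun i => f i ∘ₗ (A i).subtype) ∘ₗ
    (LinearEquiv.ofBijective (DirectSum.coeLinearMap A) hA).symm.toLinearMap, fun i x hx => ?_⟩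
  have : (LinearEquiv.ofBijective (DirectSum.coeLinearMap A) hA).symm x =
      DirectSum.lof k ι (fun i => A i) i ⟨x, hx⟩ := by
    rw [LinearEquiv.symm_apply_eq]
    exact (DirectSum.coeLinearMap_lof A i ⟨x, hx⟩).symm
  rw [LinearMap.comp_apply, LinearEquiv.coe_coe, this, DirectSum.toModule_lof]
  rfl

/-- A graded map commutes with the projections, and injectivity lets it detect vanishing components.
Used for subspaces with the induced grading. -/
theorem mem_gspan_map_iff {A' : ι → Submodule k E'} (hA' : DirectSum.IsInternal A')
    {f : E →ₗ[k] E'} (hf : ∀ i, (A i).map f ≤ A' i) (hinj : Function.Injective f) {S : Set ι}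
    {x : E} : f x ∈ gspan A' S ↔ x ∈ gspan A S := by
  have key : ∀ i, gproj hA' i ∘ₗ f = f ∘ₗ gproj hA i := fun i => by
    refine eq_of_forall_mem hA fun j y hy => ?_
    have hy' : f y ∈ A' j := hf j (Submodule.mem_map_of_mem hy)
    by_cases hij : j = i
    · subst hij; simp [gproj_of_mem hA hy, gproj_of_mem hA' hy']
    · simp [gproj_of_mem_ne hA hij hy, gproj_of_mem_ne hA' hij hy']
  rw [mem_gspan_iff hA, mem_gspan_iff hA']
  refine forall₂_congr fun i _ => ?_
  rw [← LinearMap.comp_apply, key, LinearMap.comp_apply, map_eq_zero_iff f hinj]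

end Gradings

/-! ### Linear maps with prescribed bidegrees -/

section Degrees

variable {k E E' E'' : Type*} [Field k] [AddCommGroup E] [Module k E] [AddCommGroup E']
  [Module k E'] [AddCommGroup E''] [Module k E'']
  {A : ℤ × ℤ → Submodule k E} {A' : ℤ × ℤ → Submodule k E'} {A'' : ℤ × ℤ → Submodule k E''}

/-- The linear map `f` between bigraded spaces has components in degrees in `D` only. -/
def HasDeg (A : ℤ × ℤ → Submodule k E) (A' : ℤ × ℤ → Submodule k E') (D : Set (ℤ × ℤ))
    (f : E →ₗ[k] E') : Prop :=
  ∀ i, ∀ x ∈ A i, f x ∈ gspan A' {j | j - i ∈ D}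

theorem HasDeg.mono {D D' : Set (ℤ × ℤ)} {f : E →ₗ[k] E'} (h : HasDeg A A' D f) (hD : D ⊆ D') :
    HasDeg A A' D' f := fun i x hx =>
  gspan_mono A' (fun j (hj : j - i ∈ D) => show j - i ∈ D' from hD hj) (h i x hx)

theorem HasDeg.apply_mem {D S T : Set (ℤ × ℤ)} {f : E →ₗ[k] E'} (h : HasDeg A A' D f)
    (hST : ∀ i ∈ S, ∀ d ∈ D, i + d ∈ T) {x : E} (hx : x ∈ gspan A S) : f x ∈ gspan A' T := by
  have : gspan A S ≤ (gspan A' T).comap f := gspan_le.2 fun i hi y hy =>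
    gspan_mono A' (fun j (hj : j - i ∈ D) => by simpa using hST i hi _ hj) (h i y hy)
  exact this hx

theorem HasDeg.comp {D D' D'' : Set (ℤ × ℤ)} {f : E →ₗ[k] E'} {g : E' →ₗ[k] E''}
    (hg : HasDeg A' A'' D' g) (hf : HasDeg A A' D f)
    (hD : ∀ d ∈ D, ∀ d' ∈ D', d + d' ∈ D'') : HasDeg A A'' D'' (g ∘ₗ f) := fun i x hx =>
  hg.apply_mem (fun j (hj : j - i ∈ D) d' hd' => by
    have := hD _ hj d' hd'
    simpa [sub_add_eq_add_sub] using this) (hf i x hx)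

theorem HasDeg.add {D : Set (ℤ × ℤ)} {f g : E →ₗ[k] E'} (hf : HasDeg A A' D f)
    (hg : HasDeg A A' D g) : HasDeg A A' D (f + g) := fun i x hx =>
  Submodule.add_mem _ (hf i x hx) (hg i x hx)

theorem HasDeg.sub {D : Set (ℤ × ℤ)} {f g : E →ₗ[k] E'} (hf : HasDeg A A' D f)
    (hg : HasDeg A A' D g) : HasDeg A A' D (f - g) := fun i x hx =>
  Submodule.sub_mem _ (hf i x hx) (hg i x hx)

theorem HasDeg.smul {D : Set (ℤ × ℤ)} {f : E →ₗ[k] E'} (c : k) (hf : HasDeg A A' D f) :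
    HasDeg A A' D (c • f) := fun i x hx =>
  Submodule.smul_mem _ c (hf i x hx)

theorem HasDeg.neg {D : Set (ℤ × ℤ)} {f : E →ₗ[k] E'} (hf : HasDeg A A' D f) :
    HasDeg A A' D (-f) := fun i x hx =>
  Submodule.neg_mem _ (hf i x hx)

theorem HasDeg.sum {α : Type*} {D : Set (ℤ × ℤ)} {f : α → (E →ₗ[k] E')} {s : Finset α}
    (hf : ∀ a ∈ s, HasDeg A A' D (f a)) : HasDeg A A' D (∑ a ∈ s, f a) := fun i x hx => by
  rw [LinearMap.sum_apply]
  exact Submodule.sum_mem _ fun a ha => hf a ha i x hx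

/-- Used to combine bounds coming from different filtrations; spans over D and D' intersect
correctly because the target is a direct sum. -/
theorem HasDeg.inter {D D' : Set (ℤ × ℤ)} {f : E →ₗ[k] E'} (hA' : DirectSum.IsInternal A')
    (h : HasDeg A A' D f) (h' : HasDeg A A' D' f) : HasDeg A A' (D ∩ D') f := fun i x hx => by
  have : f x ∈ gspan A' {j | j - i ∈ D} ⊓ gspan A' {j | j - i ∈ D'} := ⟨h i x hx, h' i x hx⟩
  rwa [gspan_inf hA'] at this

theorem hasDeg_id {D : Set (ℤ × ℤ)} (h : (0 : ℤ × ℤ) ∈ D) : HasDeg A A D LinearMap.id :=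
  fun i _ hx => le_gspan A (by simpa using h) hx

theorem hasDeg_one {D : Set (ℤ × ℤ)} (h : (0 : ℤ × ℤ) ∈ D) : HasDeg A A D (1 : Module.End k E) :=
  hasDeg_id h

theorem HasDeg.apply_mem_of_zero {f : E →ₗ[k] E'} (h : HasDeg A A' {0} f) {i : ℤ × ℤ} {x : E}
    (hx : x ∈ A i) : f x ∈ A' i := by
  have := h i x hx
  rw [← gspan_singleton A']
  exact gspan_mono A' (fun j hj => by simpa [sub_eq_zero] using hj) this

theorem HasDeg.eq_zero (hA : DirectSum.IsInternal A) {f : E →ₗ[k] E'} (h : HasDeg A A' ∅ f) :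
    f = 0 := eq_of_forall_mem hA fun i x hx => by
  have := h i x hx
  simpa [gspan_empty] using this

/-- Degrees with both entries negative. -/
def negDeg : Set (ℤ × ℤ) := {d | d.1 < 0 ∧ d.2 < 0}

/-- Degree zero and the degrees with both entries negative. -/
def unipDeg : Set (ℤ × ℤ) := {d | d = 0 ∨ (d.1 < 0 ∧ d.2 < 0)}

theorem negDeg_subset_unipDeg : negDeg ⊆ unipDeg := fun _ hd => Or.inr hd

theorem HasDeg.pow {D : Set (ℤ × ℤ)} (hD : ∀ d ∈ D, ∀ d' ∈ D, d + d' ∈ D)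
    {N : Module.End k E} (hN : HasDeg A A D N) (m : ℕ) : HasDeg A A D (N ^ (m + 1)) := by
  induction m with
  | zero => simpa using hN
  | succ m ih =>
    rw [pow_succ']
    exact hN.comp ih hD

theorem HasDeg.aeval {D : Set (ℤ × ℤ)} (hD : ∀ d ∈ D, ∀ d' ∈ D, d + d' ∈ D)
    {N : Module.End k E} (hN : HasDeg A A D N) {p : Polynomial k}
    (hp : p.coeff 0 = 0) : HasDeg A A D (Polynomial.aeval N p) := by
  rw [Polynomial.aeval_eq_sum_range]
  refine HasDeg.sum fun m _ => ?_
  cases m with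
  | zero => rw [hp, zero_smul]; exact fun i x _ => Submodule.zero_mem _
  | succ m => exact (hN.pow hD m).smul _

theorem HasDeg.isNilpotent [FiniteDimensional k E] (hA : DirectSum.IsInternal A)
    {N : Module.End k E} (hN : HasDeg A A {d | d.1 < 0} N) : IsNilpotent N := by
  have hpow : ∀ m : ℕ, HasDeg A A {d | d.1 ≤ -m} (N ^ m) := by
    intro m
    induction m with
    | zero => exact hasDeg_one (by simp)
    | succ m ih =>
      rw [pow_succ']
      exact hN.comp ih fun d hd d' hd' => by
        have : d'.1 < 0 := hd'
        have : d.1 ≤ -m := hd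
        simp only [Set.mem_ofPred_eq, Prod.fst_add]; push_cast; omega
  obtain ⟨B, hB⟩ : ∃ B : ℕ, ∀ i, A i ≠ ⊥ → |i.1| ≤ B := by
    obtain ⟨B, hB⟩ := ((finite_ne_bot hA).image fun i : ℤ × ℤ => |i.1|).bddAbove
    exact ⟨B.toNat, fun i hi => (hB ⟨i, hi, rfl⟩).trans (Int.self_le_toNat B)⟩
  -- The first indices of nonzero pieces lie in [-B, B], so lowering them by 2B + 1 leaves the
  -- support of the grading.
  refine ⟨2 * B + 1, eq_of_forall_mem hA fun i x hx => ?_⟩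
  by_cases hi : A i = ⊥
  · rw [hi, Submodule.mem_bot] at hx; simp [hx]
  have h1 := hpow (2 * B + 1) i x hx
  have h2 : gspan A {j | j - i ∈ {d : ℤ × ℤ | d.1 ≤ -((2 * B + 1 : ℕ) : ℤ)}} ≤ ⊥ := by
    refine gspan_le.2 fun j hj => ?_
    by_contra hne
    have hj0 : A j ≠ ⊥ := fun h => hne h.le
    have := hB i hi
    have := hB j hj0
    have hj' : j.1 - i.1 ≤ -((2 * B + 1 : ℕ) : ℤ) := hj
    rw [abs_le] at *
    push_cast at hj'
    omega
  simpa using h2 h1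

theorem negDeg_add : ∀ d ∈ negDeg, ∀ d' ∈ negDeg, d + d' ∈ negDeg :=
  fun _ hd _ hd' => ⟨add_neg hd.1 hd'.1, add_neg hd.2 hd'.2⟩

theorem HasDeg.exp [CharZero k] [Module ℚ (Module.End k E)]
    {N : Module.End k E} (hN : HasDeg A A negDeg N) :
    HasDeg A A unipDeg (IsNilpotent.exp N) := by
  rw [IsNilpotent.exp]
  refine HasDeg.sum fun m _ => ?_
  -- `IsNilpotent.exp` has rational coefficients; they are replaced by scalars of k, for which the
  -- degree lemmas are stated.
  have : ((m.factorial : ℚ)⁻¹ • N ^ m : Module.End k E) = (m.factorial : k)⁻¹ • N ^ m := by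
    have h0 : (m.factorial : k) ≠ 0 := Nat.cast_ne_zero.2 m.factorial_ne_zero
    rw [eq_inv_smul_iff₀ h0, Nat.cast_smul_eq_nsmul, ← Nat.cast_smul_eq_nsmul ℚ, smul_smul,
      mul_inv_cancel₀ (Nat.cast_ne_zero.2 m.factorial_ne_zero), one_smul]
  rw [this]
  cases m with
  | zero => exact (hasDeg_one (Or.inl rfl)).smul _
  | succ m => exact ((hN.pow negDeg_add m).mono negDeg_subset_unipDeg).smul _

end Degrees

/-! ### Exponentials of nilpotent endomorphisms -/

section Exponential

open Polynomial

variable {E E' : Type*} [AddCommGroup E] [Module ℂ E] [AddCommGroup E'] [Module ℂ E']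

theorem aeval_comp_eq {N : Module.End ℂ E} {N' : Module.End ℂ E'} {g : E →ₗ[ℂ] E'}
    (h : N' ∘ₗ g = g ∘ₗ N) (p : ℂ[X]) : aeval N' p ∘ₗ g = g ∘ₗ aeval N p := by
  induction p using Polynomial.induction_on' with
  | add p q hp hq => simp only [map_add, LinearMap.add_comp, LinearMap.comp_add, hp, hq]
  | monomial n a =>
    have : ∀ m : ℕ, (N' ^ m) ∘ₗ g = g ∘ₗ (N ^ m) := fun m => by
      induction m with
      | zero => rfl
      | succ m ih =>
        rw [pow_succ', pow_succ', Module.End.mul_eq_comp, Module.End.mul_eq_comp,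
          LinearMap.comp_assoc, ih, ← LinearMap.comp_assoc, h, LinearMap.comp_assoc]
    simp only [aeval_monomial, ← Algebra.smul_def, LinearMap.smul_comp, LinearMap.comp_smul, this]

/-- Descending induction on the order m of vanishing at 0, with d bounding n - m. For m ≥ n both
sides vanish. Otherwise u^m is X^m plus terms of higher order: g intertwines u^m by hypothesis and
the higher terms by induction, hence X^m, hence every multiple of X^m. No logarithm is required. -/
theorem aeval_dvd_comp_eq {N : Module.End ℂ E} {N' : Module.End ℂ E'} {g : E →ₗ[ℂ] E'} {n : ℕ}
    (hN : N ^ n = 0) (hN' : N' ^ n = 0) {u r : ℂ[X]} (hr : u = X + X ^ 2 * r)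
    (hU : aeval N' u ∘ₗ g = g ∘ₗ aeval N u) (d : ℕ) : ∀ m : ℕ, n ≤ m + d → ∀ p : ℂ[X],
      X ^ m ∣ p → 1 ≤ m → aeval N' p ∘ₗ g = g ∘ₗ aeval N p := by
  induction d with
  | zero =>
    rintro m hm p ⟨q, rfl⟩ -
    rw [add_zero] at hm
    rw [map_mul, map_mul, map_pow, map_pow, aeval_X, aeval_X, pow_eq_zero_of_le hm hN,
      pow_eq_zero_of_le hm hN', zero_mul, zero_mul, LinearMap.zero_comp, LinearMap.comp_zero]
  | succ d ih =>
    rintro m hm p ⟨q, rfl⟩ hm1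
    obtain ⟨s, hs⟩ : X * r ∣ (1 + X * r) ^ m - 1 := by
      have := sub_dvd_pow_sub_pow (1 + X * r) 1 m
      rwa [one_pow, add_sub_cancel_left] at this
    have hum : u ^ m = X ^ m + X ^ (m + 1) * (r * s) := by
      have : X + X ^ 2 * r = X * (1 + X * r) := by ring
      rw [hr, this, mul_pow, sub_eq_iff_eq_add.1 hs]
      ring
    obtain ⟨t, ht⟩ : X ∣ q - C (q.coeff 0) := by
      rw [X_dvd_iff]; simp
    have hXm : aeval N' (X ^ m : ℂ[X]) ∘ₗ g = g ∘ₗ aeval N (X ^ m : ℂ[X]) := by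
      have h1 := ih (m + 1) (by omega) (X ^ (m + 1) * (r * s)) (dvd_mul_right _ _) (by omega)
      have h2 := aeval_comp_eq hU (X ^ m : ℂ[X])
      rw [map_pow, map_pow, aeval_X, aeval_X, ← map_pow, ← map_pow, hum, map_add, map_add,
        LinearMap.add_comp, LinearMap.comp_add, h1] at h2
      exact add_right_cancel h2
    have hq : X ^ m * q = q.coeff 0 • X ^ m + X ^ (m + 1) * t := by
      rw [sub_eq_iff_eq_add.1 ht, smul_eq_C_mul]
      simp only [coeff_add, coeff_C_zero, coeff_X_mul_zero, zero_add]
      ring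
    rw [hq, map_add, map_add, map_smul, map_smul, LinearMap.add_comp, LinearMap.comp_add,
      LinearMap.smul_comp, LinearMap.comp_smul, hXm,
      ih (m + 1) (by omega) (X ^ (m + 1) * t) (dvd_mul_right _ _) (by omega)]

variable [Module ℚ (Module.End ℂ E)] [Module ℚ (Module.End ℂ E')]

theorem rat_smul_end (c : ℚ) (N : Module.End ℂ E) : c • N = (c : ℂ) • N :=
  (Rat.cast_smul_eq_qsmul ℂ c N).symm

/-- The truncated exponential series. -/
def expPoly (n : ℕ) : ℂ[X] := ∑ m ∈ Finset.range n, C ((m.factorial : ℂ)⁻¹) * X ^ m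

theorem exp_eq_aeval {N : Module.End ℂ E} {n : ℕ} (hN : N ^ n = 0) :
    IsNilpotent.exp N = aeval N (expPoly n) := by
  rw [IsNilpotent.exp_eq_sum hN, expPoly, map_sum]
  refine Finset.sum_congr rfl fun m _ => ?_
  rw [rat_smul_end, map_mul, aeval_C, map_pow, aeval_X, Algebra.smul_def]
  simp

theorem expPoly_sub_one (n : ℕ) : ∃ r : ℂ[X], expPoly (n + 2) - 1 = X + X ^ 2 * r := by
  refine ⟨∑ m ∈ Finset.range n, C (((m + 2).factorial : ℂ)⁻¹) * X ^ m, ?_⟩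
  rw [expPoly, Finset.sum_range_succ', Finset.sum_range_succ', Finset.mul_sum]
  have h : ∀ m : ℕ, C (((m + 1 + 1).factorial : ℂ)⁻¹) * X ^ (m + 1 + 1) =
      X ^ 2 * (C (((m + 2).factorial : ℂ)⁻¹) * X ^ m) := fun m => by ring
  rw [Finset.sum_congr rfl fun m _ => h m]
  simp only [zero_add, Nat.factorial_one, Nat.factorial_zero, Nat.cast_one, inv_one, map_one,
    one_mul, pow_one, pow_zero]
  ring

theorem exp_comp_eq {N : Module.End ℂ E} {N' : Module.End ℂ E'} {g : E →ₗ[ℂ] E'}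
    (hN : IsNilpotent N) (hN' : IsNilpotent N') (h : N' ∘ₗ g = g ∘ₗ N) :
    IsNilpotent.exp N' ∘ₗ g = g ∘ₗ IsNilpotent.exp N := by
  obtain ⟨n, hn⟩ := hN
  obtain ⟨n', hn'⟩ := hN'
  rw [exp_eq_aeval (pow_eq_zero_of_le (le_max_left n n') hn),
    exp_eq_aeval (pow_eq_zero_of_le (le_max_right n n') hn')]
  exact aeval_comp_eq h _

/-- A linear map which intertwines the exponentials of two nilpotent endomorphisms intertwines
these endomorphisms. -/
theorem comp_eq_of_exp_comp_eq {N : Module.End ℂ E} {N' : Module.End ℂ E'} {g : E →ₗ[ℂ] E'}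
    (hN : IsNilpotent N) (hN' : IsNilpotent N')
    (h : IsNilpotent.exp N' ∘ₗ g = g ∘ₗ IsNilpotent.exp N) : N' ∘ₗ g = g ∘ₗ N := by
  obtain ⟨n₁, hn₁⟩ := hN
  obtain ⟨n₂, hn₂⟩ := hN'
  have hn₁ : N ^ (max n₁ n₂) = 0 := pow_eq_zero_of_le (le_max_left n₁ n₂) hn₁
  have hn₂ : N' ^ (max n₁ n₂) = 0 := pow_eq_zero_of_le (le_max_right n₁ n₂) hn₂
  generalize max n₁ n₂ = n at *
  obtain ⟨r, hr⟩ := expPoly_sub_one n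
  rw [exp_eq_aeval (pow_eq_zero_of_le (Nat.le_add_right n 2) hn₁),
    exp_eq_aeval (pow_eq_zero_of_le (Nat.le_add_right n 2) hn₂)] at h
  have hU : aeval N' (expPoly (n + 2) - 1) ∘ₗ g = g ∘ₗ aeval N (expPoly (n + 2) - 1) := by
    simp only [map_sub, LinearMap.sub_comp, LinearMap.comp_sub, h, map_one]
    rfl
  -- Removing the constant term of the exponential gives u = X + X²r; the polynomial wanted is X
  -- itself, of order 1.
  simpa using aeval_dvd_comp_eq hn₁ hn₂ hr hU n 1 (by omega) X (by simp) le_rfl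

/-- Nilpotent endomorphisms have a logarithm which is a polynomial without constant term. -/
theorem exists_exp_eq_one_add {U : Module.End ℂ E} (hU : IsNilpotent U) :
    ∃ p : ℂ[X], p.coeff 0 = 0 ∧ IsNilpotent.exp (aeval U p) = 1 + U := by
  obtain ⟨n, hn⟩ := hU
  have hnil : ∀ p : ℂ[X], p.coeff 0 = 0 → aeval U p ^ n = 0 := by
    intro p hp
    obtain ⟨q, rfl⟩ := X_dvd_iff.2 hp
    rw [← map_pow, mul_pow, map_mul, map_pow, aeval_X, hn, zero_mul]
  -- Successive approximation of the logarithm: p(U) is correct up to a factor with error of order m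
  -- + 1 in U. The initial p = 0 has error factor (1 + U)⁻¹; at m = n the error is zero.
  have key : ∀ m : ℕ, ∃ p : ℂ[X], p.coeff 0 = 0 ∧ ∃ r : ℂ[X],
      IsNilpotent.exp (aeval U p) = (1 + U) * (1 + aeval U (X ^ (m + 1) * r)) := by
    intro m
    induction m with
    | zero =>
      obtain ⟨v, hv⟩ : ∃ v : ℂ[X], (1 + U) * aeval U v = 1 := by
        refine ⟨∑ i ∈ Finset.range n, (-X) ^ i, ?_⟩
        have : (1 + X) * (∑ i ∈ Finset.range n, (-X : ℂ[X]) ^ i) = 1 - (-X) ^ n := by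
          have := mul_neg_geom_sum (-X : ℂ[X]) n
          rwa [sub_neg_eq_add] at this
        have := congrArg (aeval U) this
        rw [map_mul, map_sub, map_pow, map_neg, aeval_X, neg_pow, hn, mul_zero, sub_zero] at this
        simpa using this
      refine ⟨0, by simp, -v, ?_⟩
      have : aeval U (X ^ (0 + 1) * -v) = -(U * aeval U v) := by simp
      rw [map_zero, IsNilpotent.exp_zero, this]
      have h2 : U * aeval U v = 1 - aeval U v := by
        rw [← hv, add_mul, one_mul, add_sub_cancel_left]
      rw [h2, show (1 : Module.End ℂ E) + -(1 - aeval U v) = aeval U v by abel, hv]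
    | succ m ih =>
      obtain ⟨p, hp, r, hr⟩ := ih
      set q : ℂ[X] := X ^ (m + 1) * r with hq
      have hq0 : q.coeff 0 = 0 := by simp [hq, mul_coeff_zero]
      refine ⟨p - q, by simp [hp, hq0], ?_⟩
      have hexp : IsNilpotent.exp (aeval U (p - q)) =
          IsNilpotent.exp (aeval U p) * IsNilpotent.exp (aeval U (-q)) := by
        rw [sub_eq_add_neg, map_add]
        refine IsNilpotent.exp_add_of_commute ?_ ⟨n, hnil p hp⟩ ⟨n, hnil (-q) (by simp [hq0])⟩
        exact (Commute.all p (-q)).map (aeval U)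
      obtain ⟨s, hs⟩ := expPoly_sub_one n
      have h2 : IsNilpotent.exp (aeval U (-q)) = aeval U (1 - q + q ^ 2 * (s.comp (-q))) := by
        rw [exp_eq_aeval (pow_eq_zero_of_le (Nat.le_add_right n 2) (hnil (-q) (by simp [hq0]))),
          ← aeval_comp, sub_eq_iff_eq_add.1 hs]
        simp only [add_comp, X_comp, mul_comp, pow_comp, one_comp]
        congr 1
        ring
      -- Here (1 + q)(1 - q + q²s) = 1 + q²(-1 + (1 + q)s) with s evaluated at -q, and q² = X^(2m+2)
      -- r² contains the required factor X^(m+2).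
      refine ⟨X ^ m * r ^ 2 * (-1 + (1 + q) * s.comp (-q)), ?_⟩
      rw [hexp, hr, h2, mul_assoc]
      congr 1
      rw [← map_one (aeval (R := ℂ) U), ← map_add, ← map_add, ← map_mul]
      congr 1
      rw [hq]
      ring
  obtain ⟨p, hp, r, hr⟩ := key n
  refine ⟨p, hp, ?_⟩
  rw [hr, map_mul, map_pow, aeval_X, pow_eq_zero_of_le (Nat.le_succ n) hn, zero_mul, add_zero,
    mul_one]

end Exponential

/-! ### Deligne's splitting -/

section Deligne

variable {E : Type*} [AddCommGroup E] [Module ℂ E]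

/-- An increasing filtration `W` and two decreasing filtrations `F`, `F'` such that `F` and `F'`
induce `n`-opposed filtrations on the `n`-th graded piece of `W`, for all `n`. -/
structure Opposed (W F F' : ℤ → Submodule ℂ E) : Prop where
  mono : Monotone W
  anti : Antitone F
  anti' : Antitone F'
  W_bot : ∃ n, W n = ⊥
  W_top : ∃ n, W n = ⊤
  F_bot : ∃ p, F p = ⊥
  F_top : ∃ p, F p = ⊤
  F'_bot : ∃ p, F' p = ⊥
  F'_top : ∃ p, F' p = ⊤
  sum : ∀ n p, W n ≤ (F p ⊓ W n) ⊔ (F' (n + 1 - p) ⊓ W n) ⊔ W (n - 1)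
  inter : ∀ n p, (F p ⊓ W n) ⊓ ((F' (n + 1 - p) ⊓ W n) ⊔ W (n - 1)) ≤ W (n - 1)

/-- The auxiliary space in the definition of Deligne's splitting. -/
def deligneAux (W F' : ℤ → Submodule ℂ E) (p q : ℤ) : Submodule ℂ E :=
  (F' q ⊓ W (p + q)) ⊔ ⨆ (m : ℤ) (_ : m < p + q), F' (m + 1 - p) ⊓ W m

/-- Deligne's splitting. -/
def deligne (W F F' : ℤ → Submodule ℂ E) (p q : ℤ) : Submodule ℂ E :=
  F p ⊓ W (p + q) ⊓ deligneAux W F' p q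

variable {W F F' : ℤ → Submodule ℂ E}

namespace Opposed

theorem symm (H : Opposed W F F') : Opposed W F' F where
  mono := H.mono
  anti := H.anti'
  anti' := H.anti
  W_bot := H.W_bot
  W_top := H.W_top
  F_bot := H.F'_bot
  F_top := H.F'_top
  F'_bot := H.F_bot
  F'_top := H.F_top
  sum n p := by
    have := H.sum n (n + 1 - p)
    rwa [sub_sub_cancel, sup_comm (F _ ⊓ _)] at this
  inter n p := by
    rintro x ⟨hx, hx'⟩
    obtain ⟨f, hf, w, hw, rfl⟩ := Submodule.mem_sup.1 hx'
    refine Submodule.add_mem _ (H.inter n (n + 1 - p) ⟨hf, ?_⟩) hw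
    rw [sub_sub_cancel]
    have : f = (f + w) + -w := by abel
    rw [this]
    exact Submodule.add_mem_sup hx (Submodule.neg_mem _ hw)

variable (H : Opposed W F F')
include H

/-- The summands with index at least m lie in F'^(m+1-p), and those with smaller index lie in
W_(m-1). The shift in the auxiliary space is chosen so that its image in the m-th graded piece lies
in the step opposed to F^p, for each m < p + q. -/
theorem deligneAux_le_F {p q m : ℤ} (hm : m < p + q) :
    deligneAux W F' p q ≤ F' (m + 1 - p) ⊔ W (m - 1) := by
  refine sup_le ?_ (iSup₂_le fun m' hm' => ?_)
  · exact (inf_le_left.trans (H.anti' (by omega))).trans le_sup_left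
  · rcases le_or_gt m m' with h | h
    · exact (inf_le_left.trans (H.anti' (by omega))).trans le_sup_left
    · exact (inf_le_right.trans (H.mono (by omega))).trans le_sup_right

theorem deligneAux_inf_le {p q m : ℤ} (hm : m < p + q) {x : E} (hx : x ∈ deligneAux W F' p q)
    (hxm : x ∈ W m) : x ∈ (F' (m + 1 - p) ⊓ W m) ⊔ W (m - 1) := by
  obtain ⟨a, ha, w, hw, rfl⟩ := Submodule.mem_sup.1 (H.deligneAux_le_F hm hx)
  refine Submodule.add_mem_sup ⟨ha, ?_⟩ hw
  have : a = (a + w) - w := by abel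
  rw [this]
  exact Submodule.sub_mem _ hxm (H.mono (by omega) hw)

theorem deligneAux_le (p q : ℤ) :
    deligneAux W F' p q ≤ (F' q ⊓ W (p + q)) ⊔ W (p + q - 1) :=
  sup_le_sup_left (iSup₂_le fun _ hm => inf_le_right.trans (H.mono (by omega))) _

/-- Descent on the weight: in each graded piece below p + q the class of x lies both in F^p and in
the step of F' opposed to it, so it vanishes, until W becomes zero. -/
theorem eq_zero_of_mem_deligne {p q : ℤ} {x : E} (hx : x ∈ deligne W F F' p q)
    (hxW : x ∈ W (p + q - 1)) : x = 0 := by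
  have key : ∀ j : ℕ, x ∈ W (p + q - 1 - j) := by
    intro j
    induction j with
    | zero => simpa using hxW
    | succ j ih =>
      have := H.inter (p + q - 1 - j) p
        ⟨⟨hx.1.1, ih⟩, H.deligneAux_inf_le (by omega) hx.2 ih⟩
      convert this using 2
      push_cast
      ring
  obtain ⟨n, hn⟩ := H.W_bot
  have := H.mono (show p + q - 1 - (p + q - 1 - n).toNat ≤ n by omega)
    (key (p + q - 1 - n).toNat)
  rwa [hn, Submodule.mem_bot] at this

/-- A class of type (p, q) is lifted by correcting x weight by weight. The error in W_m splits into
a part in F^p, which is subtracted, a part in F'^(m+1-p), which the auxiliary space absorbs, and a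
part of lower weight. -/
theorem exists_deligne {p q : ℤ} {x : E} (hx : x ∈ F p ⊓ W (p + q))
    (hx' : x ∈ (F' q ⊓ W (p + q)) ⊔ W (p + q - 1)) :
    ∃ y ∈ deligne W F F' p q, x - y ∈ W (p + q - 1) := by
  have key : ∀ j : ℕ, ∃ y ∈ F p ⊓ W (p + q), x - y ∈ W (p + q - 1) ∧
      y ∈ deligneAux W F' p q ⊔ W (p + q - 1 - j) := by
    intro j
    induction j with
    | zero => exact ⟨x, hx, by simp, by
        simpa [deligneAux] using SetLike.le_def.1 (sup_le_sup_right le_sup_left _) hx'⟩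
    | succ j ih =>
      obtain ⟨y, hy, hxy, hyU⟩ := ih
      obtain ⟨u, hu, w, hw, rfl⟩ := Submodule.mem_sup.1 hyU
      obtain ⟨v, hv, w₃, hw₃, rfl⟩ := Submodule.mem_sup.1 (H.sum _ p hw)
      obtain ⟨w₁, hw₁, w₂, hw₂, rfl⟩ := Submodule.mem_sup.1 hv
      refine ⟨u + (w₁ + w₂ + w₃) - w₁, ⟨Submodule.sub_mem _ hy.1 hw₁.1,
        Submodule.sub_mem _ hy.2 (H.mono (by omega) hw₁.2)⟩, ?_, ?_⟩
      · rw [show x - (u + (w₁ + w₂ + w₃) - w₁) = x - (u + (w₁ + w₂ + w₃)) + w₁ by abel]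
        exact Submodule.add_mem _ hxy (H.mono (by omega) hw₁.2)
      · have : u + (w₁ + w₂ + w₃) - w₁ = (u + w₂) + w₃ := by abel
        rw [this]
        refine Submodule.add_mem_sup (Submodule.add_mem _ hu ?_) ?_
        · have hlt : p + q - 1 - (j : ℤ) < p + q := by omega
          exact (le_iSup₂_of_le (f := fun (m : ℤ) (_ : m < p + q) => F' (m + 1 - p) ⊓ W m)
            _ hlt le_rfl).trans le_sup_right hw₂
        · convert hw₃ using 2
          push_cast
          ring
  obtain ⟨n, hn⟩ := H.W_bot
  obtain ⟨y, hy, hxy, hyU⟩ := key (p + q - 1 - n).toNat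
  refine ⟨y, ⟨hy, ?_⟩, hxy⟩
  have h0 : W (p + q - 1 - (p + q - 1 - n).toNat) = ⊥ := by
    rw [eq_bot_iff, ← hn]
    exact H.mono (by omega)
  rwa [h0, sup_bot_eq] at hyU

/-- Descending induction on p from the index where F vanishes. Opposedness at p + 1 splits off a
part in F^(p+1); what remains is of type (p, n - p) modulo lower weight and is lifted by
`exists_deligne`. -/
theorem F_inf_W_le (n p : ℤ) : F p ⊓ W n ≤
    (⨆ (a : ℤ) (_ : p ≤ a), deligne W F F' a (n - a)) ⊔ W (n - 1) := by
  obtain ⟨p₀, hp₀⟩ := H.F_bot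
  have key : ∀ j : ℕ, ∀ p, p₀ ≤ p + j → F p ⊓ W n ≤
      (⨆ (a : ℤ) (_ : p ≤ a), deligne W F F' a (n - a)) ⊔ W (n - 1) := by
    intro j
    induction j with
    | zero =>
      intro p hp
      have : F p = ⊥ := by rw [eq_bot_iff, ← hp₀]; exact H.anti (by omega)
      simp [this]
    | succ j ih =>
      intro p hp x hx
      obtain ⟨v, hv, w, hw, rfl⟩ := Submodule.mem_sup.1 (H.sum n (p + 1) hx.2)
      obtain ⟨a, ha, b, hb, rfl⟩ := Submodule.mem_sup.1 hv
      have hmem : b + w ∈ F p ⊓ W (p + (n - p)) := by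
        have : b + w = (a + b + w) - a := by abel
        rw [this, add_sub_cancel]
        exact Submodule.sub_mem _ hx ⟨H.anti (by omega) ha.1, ha.2⟩
      obtain ⟨y, hy, hby⟩ := H.exists_deligne hmem (by
        rw [add_sub_cancel]
        rw [show n + 1 - (p + 1) = n - p by ring] at hb
        exact Submodule.add_mem_sup hb hw)
      rw [add_sub_cancel] at hby
      have : a + b + w = a + (y + (b + w - y)) := by abel
      rw [this]
      refine Submodule.add_mem _ ?_ (Submodule.add_mem_sup ?_ hby)
      · exact SetLike.le_def.1 (sup_le_sup_right (iSup₂_le fun a ha =>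
          le_iSup₂_of_le (f := fun (a : ℤ) (_ : p ≤ a) => deligne W F F' a (n - a))
            a (by omega) le_rfl) _) (ih (p + 1) (by push_cast at hp; omega) ha)
      · exact le_iSup₂_of_le (f := fun (a : ℤ) (_ : p ≤ a) => deligne W F F' a (n - a))
          p le_rfl le_rfl hy
  exact key (p₀ - p).toNat p (by omega)

omit H in
/-- Deligne's splitting as a family of subspaces indexed by bidegrees. -/
abbrev bideg (W F F' : ℤ → Submodule ℂ E) (i : ℤ × ℤ) : Submodule ℂ E := deligne W F F' i.1 i.2

theorem F_inf_W_eq (n p : ℤ) :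
    F p ⊓ W n = gspan (bideg W F F') {i | p ≤ i.1 ∧ i.1 + i.2 ≤ n} := by
  apply le_antisymm
  · obtain ⟨n₀, hn₀⟩ := H.W_bot
    have key : ∀ j : ℕ, ∀ n, n ≤ n₀ + j →
        F p ⊓ W n ≤ gspan (bideg W F F') {i | p ≤ i.1 ∧ i.1 + i.2 ≤ n} := by
      intro j
      induction j with
      | zero =>
        intro n hn
        have : W n = ⊥ := by rw [eq_bot_iff, ← hn₀]; exact H.mono (by omega)
        simp [this]
      | succ j ih =>
        intro n hn x hx
        obtain ⟨y, hy, w, hw, rfl⟩ := Submodule.mem_sup.1 (H.F_inf_W_le n p hx)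
        have hyF : (⨆ (a : ℤ) (_ : p ≤ a), deligne W F F' a (n - a)) ≤ F p :=
          iSup₂_le fun a ha => inf_le_left.trans (inf_le_left.trans (H.anti ha))
        have hwF : w ∈ F p := by
          have : w = (y + w) - y := by abel
          rw [this]
          exact Submodule.sub_mem _ hx.1 (hyF hy)
        refine Submodule.add_mem _ ?_ (gspan_mono _ ?_
          (ih (n - 1) (by push_cast at hn; omega) ⟨hwF, hw⟩))
        · refine (iSup₂_le fun a ha => ?_ : (⨆ (a : ℤ) (_ : p ≤ a), deligne W F F' a (n - a)) ≤
            gspan (bideg W F F') {i | p ≤ i.1 ∧ i.1 + i.2 ≤ n}) hy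
          exact le_gspan (bideg W F F') (i := (a, n - a)) ⟨ha, by simp⟩
        · rintro i ⟨h1, h2⟩
          exact ⟨h1, by omega⟩
    exact key (n - n₀).toNat n (by omega)
  · exact gspan_le.2 fun i hi => inf_le_left.trans (inf_le_inf (H.anti hi.1) (H.mono hi.2))

theorem F_eq (p : ℤ) : F p = gspan (bideg W F F') {i | p ≤ i.1} := by
  apply le_antisymm
  · obtain ⟨n, hn⟩ := H.W_top
    calc F p = F p ⊓ W n := by simp [hn]
      _ ≤ _ := by rw [H.F_inf_W_eq]; exact gspan_mono _ fun i hi => hi.1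
  · exact gspan_le.2 fun i hi => inf_le_left.trans (inf_le_left.trans (H.anti hi))

theorem W_eq (n : ℤ) : W n = gspan (bideg W F F') {i | i.1 + i.2 ≤ n} := by
  apply le_antisymm
  · obtain ⟨p, hp⟩ := H.F_top
    calc W n = F p ⊓ W n := by simp [hp]
      _ ≤ _ := by rw [H.F_inf_W_eq]; exact gspan_mono _ fun i hi => hi.2
  · exact gspan_le.2 fun i hi => inf_le_left.trans (inf_le_right.trans (H.mono hi))

theorem isInternal : DirectSum.IsInternal (bideg W F F') := by
  rw [DirectSum.isInternal_submodule_iff_iSupIndep_and_iSup_eq_top]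
  constructor
  · rw [iSupIndep_iff_finsetSum_eq_zero_imp_eq_zero]
    intro s v hv hsum
    classical
    by_contra! hne
    set t := s.filter fun i => v i ≠ 0 with ht
    have htne : t.Nonempty := by
      obtain ⟨i, hi, hvi⟩ := hne
      exact ⟨i, by simp [ht, hi, hvi]⟩
    -- Among the nonzero terms take one of greatest weight n and, within that weight, of least first
    -- index p. All other terms lie in F^(p+1) ∩ W_n + W_(n-1), while this one lies in F'^q ∩ W_n +
    -- W_(n-1); opposedness pushes it into W_(n-1), where it must vanish.
    obtain ⟨i, hit, hmax⟩ := t.exists_max_image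
      (fun i => toLex (i.1 + i.2, -i.1)) htne
    have hi : i ∈ s ∧ v i ≠ 0 := by simpa [ht] using hit
    set n := i.1 + i.2 with hn
    have hsum' : v i + ∑ j ∈ s.erase i, v j = 0 := by rw [Finset.add_sum_erase _ _ hi.1, hsum]
    have hrest : ∑ j ∈ s.erase i, v j ∈ (F (i.1 + 1) ⊓ W n) ⊔ W (n - 1) := by
      refine Submodule.sum_mem _ fun j hj => ?_
      rw [Finset.mem_erase] at hj
      by_cases hvj : v j = 0
      · rw [hvj]; exact Submodule.zero_mem _
      have hle := hmax j (by simp [ht, hj.2, hvj])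
      rw [Prod.Lex.toLex_le_toLex] at hle
      rcases hle with hlt | ⟨heq, hle⟩
      · exact Submodule.mem_sup_right (H.mono (by simp only at hlt; omega) (hv j hj.2).1.2)
      · simp only at heq hle
        have hji : i.1 + 1 ≤ j.1 := by
          by_contra hcon
          exact hj.1 (Prod.ext (by omega) (by omega))
        exact Submodule.mem_sup_left ⟨H.anti hji (hv j hj.2).1.1, H.mono heq.le (hv j hj.2).1.2⟩
    obtain ⟨f, hf, w, hw, hfw⟩ := Submodule.mem_sup.1 hrest
    obtain ⟨f', hf', w', hw', hfw'⟩ := Submodule.mem_sup.1 (H.deligneAux_le _ _ (hv i hi.1).2)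
    have hfW : f ∈ W (n - 1) := by
      refine H.inter n (i.1 + 1) ⟨hf, ?_⟩
      have : f = -f' + (-w' - w) := by
        rw [← hfw, ← hfw'] at hsum'
        rw [eq_comm, ← sub_eq_zero, ← neg_eq_zero, ← hsum']
        abel
      rw [this, show n + 1 - (i.1 + 1) = i.2 by omega]
      exact Submodule.add_mem_sup (Submodule.neg_mem _ hf')
        (Submodule.sub_mem _ (Submodule.neg_mem _ hw') hw)
    refine hi.2 (H.eq_zero_of_mem_deligne (hv i hi.1) ?_)
    rw [eq_neg_of_add_eq_zero_left hsum', ← hfw]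
    exact Submodule.neg_mem _ (Submodule.add_mem _ hfW hw)
  · obtain ⟨n, hn⟩ := H.W_top
    rw [eq_top_iff, ← hn, H.W_eq n, ← gspan_univ]
    exact gspan_mono _ (Set.subset_univ _)

/-- Only the components of top weight are controlled by F'. Those with second index less than q lie
in F^(n+1-q), so opposedness moves their sum into lower weight and directness kills it. -/
theorem F'_inf_W_le (n q : ℤ) : F' q ⊓ W n ≤
    gspan (bideg W F F') {i | i.1 + i.2 ≤ n ∧ (i.1 + i.2 = n → q ≤ i.2)} := by
  intro x hx
  have hxn := hx.2
  rw [H.W_eq n, show {i : ℤ × ℤ | i.1 + i.2 ≤ n} =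
    {i | i.1 + i.2 ≤ n ∧ (i.1 + i.2 = n → q ≤ i.2)} ∪ {i | i.1 + i.2 = n ∧ i.2 < q} by
      ext i; simp only [Set.mem_ofPred_eq, Set.mem_union]; omega, gspan_union] at hxn
  obtain ⟨y, hy, z, hz, rfl⟩ := Submodule.mem_sup.1 hxn
  have hyW : y ∈ (F' q ⊓ W n) ⊔ W (n - 1) := by
    refine (gspan_le.2 fun i hi => ?_ : gspan (bideg W F F')
      {i | i.1 + i.2 ≤ n ∧ (i.1 + i.2 = n → q ≤ i.2)} ≤ (F' q ⊓ W n) ⊔ W (n - 1)) hy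
    rcases hi.1.lt_or_eq with h | h
    · exact inf_le_left.trans (inf_le_right.trans ((H.mono (by omega)).trans le_sup_right))
    · refine inf_le_right.trans ((H.deligneAux_le _ _).trans (sup_le_sup ?_ (by rw [h])))
      exact inf_le_inf (H.anti' (hi.2 h)) (by rw [h])
  have hzF : z ∈ F (n + 1 - q) ⊓ W n := by
    refine (gspan_le.2 fun i hi => ?_ : gspan (bideg W F F')
      {i | i.1 + i.2 = n ∧ i.2 < q} ≤ F (n + 1 - q) ⊓ W n) hz
    obtain ⟨h1, h2⟩ := hi
    exact inf_le_left.trans (inf_le_inf (H.anti (by omega)) (H.mono h1.le))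
  have hzW : z ∈ W (n - 1) := by
    refine H.inter n (n + 1 - q) ⟨hzF, ?_⟩
    rw [sub_sub_cancel, show z = (y + z) - y by abel]
    exact Submodule.sub_mem _ (Submodule.mem_sup_left hx) hyW
  rw [H.W_eq (n - 1)] at hzW
  have hz0 : z ∈ gspan (bideg W F F') {i | i.1 + i.2 = n ∧ i.2 < q} ⊓
    gspan (bideg W F F') {i | i.1 + i.2 ≤ n - 1} := ⟨hz, hzW⟩
  rw [gspan_inf H.isInternal, show {i : ℤ × ℤ | i.1 + i.2 = n ∧ i.2 < q} ∩
    {i | i.1 + i.2 ≤ n - 1} = ∅ from Set.eq_empty_of_forall_notMem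
      fun i ⟨⟨h1, _⟩, (h2 : i.1 + i.2 ≤ n - 1)⟩ => by omega,
    gspan_empty, Submodule.mem_bot] at hz0
  rwa [hz0, add_zero]

/-- The membership in F' leaves second index at least i.2 in the top weight, and the auxiliary space
leaves first index at least i.1 or second index less than i.2. In the top weight only i survives
both; in lower weight either alternative gives a smaller second index. -/
theorem symm_deligne_le (i : ℤ × ℤ) : deligne W F' F i.2 i.1 ≤
    gspan (bideg W F F') {j | j = i ∨ (j.2 < i.2 ∧ j.1 + j.2 < i.1 + i.2)} := by
  intro x hx
  have h1 := H.F'_inf_W_le _ _ hx.1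
  have h2 : x ∈ gspan (bideg W F F') {j | i.1 ≤ j.1 ∧ j.1 + j.2 ≤ i.1 + i.2 ∨ j.2 < i.2} := by
    refine (sup_le ?_ (iSup₂_le fun m hm => ?_) : deligneAux W F i.2 i.1 ≤ _) hx.2
    · rw [H.F_inf_W_eq]
      refine gspan_mono _ ?_
      rintro j ⟨hj, hj'⟩
      exact Or.inl ⟨hj, by omega⟩
    · rw [H.F_inf_W_eq]
      refine gspan_mono _ ?_
      rintro j ⟨hj, hj'⟩
      exact Or.inr (by omega)
  have h3 := Submodule.mem_inf.2 ⟨h1, h2⟩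
  rw [gspan_inf H.isInternal] at h3
  refine gspan_mono _ (fun j hj => ?_) h3
  simp only [Set.mem_inter_iff, Set.mem_ofPred_eq, Prod.ext_iff] at hj ⊢
  omega

end Opposed

end Deligne

/-! ### Comparison of the two splittings -/

section Comparison

variable {E : Type*} [AddCommGroup E] [Module ℂ E]

theorem sub_gproj_mem {k ι E : Type*} [Field k] [AddCommGroup E] [Module k E] [DecidableEq ι]
    {A : ι → Submodule k E} (hA : DirectSum.IsInternal A) {i : ι} {P : ι → Prop}
    {x : E} (hx : x ∈ gspan A {j | j = i ∨ P j}) : x - gproj hA i x ∈ gspan A {j | P j} := by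
  rw [mem_gspan_iff hA] at hx ⊢
  intro j hj
  rw [map_sub]
  by_cases hji : j = i
  · subst hji
    rw [gproj_of_mem hA (gproj_mem hA j x), sub_self]
  · rw [gproj_of_mem_ne hA (Ne.symm hji) (gproj_mem hA i x), sub_zero]
    exact hx j fun h => h.elim hji hj

theorem isInternal_swap {A : ℤ × ℤ → Submodule ℂ E} (hA : DirectSum.IsInternal A) :
    DirectSum.IsInternal fun i : ℤ × ℤ => A i.swap := by
  rw [DirectSum.isInternal_submodule_iff_iSupIndep_and_iSup_eq_top] at hA ⊢
  refine ⟨hA.1.comp Prod.swap_injective, ?_⟩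
  rw [← hA.2]
  exact (Equiv.prodComm ℤ ℤ).iSup_comp (g := A)

theorem gspan_swap (A : ℤ × ℤ → Submodule ℂ E) (S : Set (ℤ × ℤ)) :
    gspan (fun i : ℤ × ℤ => A i.swap) S = gspan A (Prod.swap ⁻¹' S) := by
  apply le_antisymm
  · exact gspan_le.2 fun i hi => le_gspan A (i := i.swap) (by simpa using hi)
  · exact gspan_le.2 fun i hi => by
      have := le_gspan (fun i : ℤ × ℤ => A i.swap) (S := S) (i := i.swap) (by simpa using hi)
      simpa using this

/-- Two bigradings, each of which is triangular with respect to the other, are transformed into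
each other by the exponential of an endomorphism with components in negative bidegrees. -/
theorem exists_exp_map_eq [FiniteDimensional ℂ E] [Module ℚ (Module.End ℂ E)]
    {A J : ℤ × ℤ → Submodule ℂ E}
    (hA : DirectSum.IsInternal A) (hJ : DirectSum.IsInternal J)
    (hJA : ∀ i : ℤ × ℤ, J i ≤ gspan A {j | j = i ∨ (j.2 < i.2 ∧ j.1 + j.2 < i.1 + i.2)})
    (hAJ : ∀ i : ℤ × ℤ, A i ≤ gspan J {j | j = i ∨ (j.1 < i.1 ∧ j.1 + j.2 < i.1 + i.2)}) :
    ∃ N : Module.End ℂ E, HasDeg A A negDeg N ∧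
      (∀ i, (A i).map (IsNilpotent.exp N) = J i) ∧
      ∀ i, ∀ x ∈ A i, IsNilpotent.exp N x - x ∈ gspan A {j | j.1 + j.2 < i.1 + i.2} := by
  -- The projections along one bigrading, restricted to the pieces of the other, give graded maps ψ
  -- from A to J and φ from J to A.
  obtain ⟨ψ, hψ⟩ := exists_linearMap_of_isInternal hA (fun i => gproj hJ i)
  obtain ⟨φ, hφ⟩ := exists_linearMap_of_isInternal hJ (fun i => gproj hA i)
  have hψmem : ∀ i, ∀ x ∈ A i, ψ x ∈ J i := fun i x hx => hψ i x hx ▸ gproj_mem hJ i x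
  have hφmem : ∀ i, ∀ x ∈ J i, φ x ∈ A i := fun i x hx => hφ i x hx ▸ gproj_mem hA i x
  have s1 : ∀ i, ∀ x ∈ A i,
      x - ψ x ∈ gspan J {j | j.1 < i.1 ∧ j.1 + j.2 < i.1 + i.2} := fun i x hx => by
    rw [hψ i x hx]; exact sub_gproj_mem hJ (hAJ i hx)
  have s2 : ∀ i, ∀ x ∈ J i,
      x - φ x ∈ gspan A {j | j.2 < i.2 ∧ j.1 + j.2 < i.1 + i.2} := fun i x hx => by
    rw [hφ i x hx]; exact sub_gproj_mem hA (hJA i hx)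
  have hW : ∀ n : ℤ, gspan J {j | j.1 + j.2 < n} ≤ gspan A {j | j.1 + j.2 < n} := fun n =>
    gspan_le.2 fun i (hi : i.1 + i.2 < n) => (hJA i).trans (gspan_mono A (by
      rintro j (rfl | ⟨_, hj⟩)
      · exact hi
      · exact hj.trans hi))
  -- The difference x - ψx has strictly lower weight, so it does not contribute to the A-component
  -- of index i.
  have hφψ : φ * ψ = 1 := eq_of_forall_mem hA fun i x hx => by
    rw [Module.End.mul_apply, hφ i _ (hψmem i x hx)]
    have h1 := hW (i.1 + i.2) (gspan_mono J (fun _ hj => hj.2) (s1 i x hx))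
    have h2 := (mem_gspan_iff hA).1 h1 i (fun h : i.1 + i.2 < i.1 + i.2 => lt_irrefl _ h)
    rw [map_sub, gproj_of_mem hA hx, sub_eq_zero] at h2
    exact h2.symm
  have hψφ : ψ * φ = 1 := mul_eq_one_comm.1 hφψ
  have hφψ' : ∀ x, φ (ψ x) = x := fun x => LinearMap.congr_fun hφψ x
  have hψφ' : ∀ x, ψ (φ x) = x := fun x => LinearMap.congr_fun hψφ x
  -- Each triangularity controls one index: ψ - 1 lowers the second, and φ - 1 the first. The
  -- geometric series for ψ = φ⁻¹ then shows that ψ - 1 lowers the first index as well.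
  have hu : HasDeg A A {d | d.2 < 0} (ψ - 1) := fun i x hx => by
    have := s2 i _ (hψmem i x hx)
    rw [hφψ'] at this
    refine gspan_mono A (fun j hj => ?_) this
    have := hj.1
    simp only [Set.mem_ofPred_eq, Prod.snd_sub]
    omega
  have hv : HasDeg A A {d | d.1 < 0} (φ - 1) := fun i x hx => by
    have h1 : gspan J {j | j.1 < i.1 ∧ j.1 + j.2 < i.1 + i.2} ≤
        (gspan A {j | j.1 < i.1 ∧ j.1 + j.2 < i.1 + i.2}).comap φ :=
      gspan_le.2 fun j hj y hy => le_gspan A hj (hφmem j y hy)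
    have := h1 (s1 i x hx)
    rw [Submodule.mem_comap, map_sub, hφψ'] at this
    refine gspan_mono A (fun j hj => ?_) this
    have := hj.1
    simp only [Set.mem_ofPred_eq, Prod.fst_sub]
    omega
  have hu' : HasDeg A A {d | d.1 < 0} (ψ - 1) := by
    obtain ⟨n, hn⟩ := hv.isNilpotent hA
    have hgeom : φ * ∑ i ∈ Finset.range n, (-(φ - 1)) ^ i = 1 := by
      have := mul_neg_geom_sum (-(φ - 1)) n
      rwa [sub_neg_eq_add, add_sub_cancel, neg_pow, hn, mul_zero, sub_zero] at this
    have hψ' : ψ = ∑ i ∈ Finset.range n, (-(φ - 1)) ^ i := by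
      exact left_inv_eq_right_inv hψφ hgeom
    have : ψ - 1 = Polynomial.aeval (φ - 1)
        (-Polynomial.X * ∑ i ∈ Finset.range n, (-Polynomial.X) ^ i : Polynomial ℂ) := by
      rw [map_mul, map_neg, map_sum, Polynomial.aeval_X]
      simp only [map_pow, map_neg, Polynomial.aeval_X]
      rw [← hψ', neg_mul, sub_mul, one_mul, hφψ, neg_sub]
    rw [this]
    exact hv.aeval (fun d (hd : d.1 < 0) d' (hd' : d'.1 < 0) => add_neg hd hd')
      (by simp [Polynomial.mul_coeff_zero])
  have hneg : HasDeg A A negDeg (ψ - 1) :=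
    (hu'.inter hA hu).mono fun d hd => ⟨hd.1, hd.2⟩
  -- N is the logarithm of ψ. It is a polynomial in ψ - 1 without constant term, so it keeps the
  -- negative bidegrees.
  obtain ⟨p, hp, hexp⟩ := exists_exp_eq_one_add (hu'.isNilpotent hA)
  rw [add_sub_cancel] at hexp
  refine ⟨_, hneg.aeval negDeg_add hp, fun i => ?_, fun i x hx => ?_⟩ <;> rw [hexp]
  swap
  · have := s2 i _ (hψmem i x hx)
    rw [hφψ'] at this
    exact gspan_mono A (fun j hj => hj.2) this
  apply le_antisymm
  · rintro _ ⟨x, hx, rfl⟩; exact hψmem i x hx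
  · exact fun y hy => ⟨φ y, hφmem i y hy, hψφ' y⟩

theorem isNilpotent_complex_smul {N : Module.End ℂ E} (hN : IsNilpotent N) (c : ℂ) :
    IsNilpotent (c • N) := by
  obtain ⟨n, hn⟩ := hN
  exact ⟨n, by rw [smul_pow, hn, smul_zero]⟩

theorem isInternal_map {A : ℤ × ℤ → Submodule ℂ E} (hA : DirectSum.IsInternal A) {f : E →ₗ[ℂ] E}
    (hf : Function.Bijective f) : DirectSum.IsInternal fun i => (A i).map f := by
  rw [DirectSum.isInternal_submodule_iff_iSupIndep_and_iSup_eq_top] at hA ⊢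
  refine ⟨LinearMap.iSupIndep_map f hf.1 hA.1, ?_⟩
  rw [← Submodule.map_iSup, hA.2, Submodule.map_top, LinearMap.range_eq_top.2 hf.2]

variable [Module ℚ (Module.End ℂ E)]

theorem conj_exp {E' : Type*} [AddCommGroup E'] [Module ℂ E'] [Module ℚ (Module.End ℂ E')]
    (σ : E →ₛₗ[starRingEnd ℂ] E') {N : Module.End ℂ E} {N' : Module.End ℂ E'}
    (hN : IsNilpotent N) (hN' : IsNilpotent N') (h : ∀ x, σ (N x) = N' (σ x)) (x : E) :
    σ (IsNilpotent.exp N x) = IsNilpotent.exp N' (σ x) := by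
  obtain ⟨n₁, hn₁⟩ := hN
  obtain ⟨n₂, hn₂⟩ := hN'
  rw [IsNilpotent.exp_eq_sum (pow_eq_zero_of_le (le_max_left n₁ n₂) hn₁),
    IsNilpotent.exp_eq_sum (pow_eq_zero_of_le (le_max_right n₁ n₂) hn₂),
    LinearMap.sum_apply, LinearMap.sum_apply, map_sum]
  have hpow : ∀ m : ℕ, σ ((N ^ m) x) = (N' ^ m) (σ x) := fun m => by
    induction m with
    | zero => rfl
    | succ m ih => rw [pow_succ', pow_succ', Module.End.mul_apply, Module.End.mul_apply, h, ih]
  refine Finset.sum_congr rfl fun m _ => ?_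
  rw [rat_smul_end, rat_smul_end, LinearMap.smul_apply, LinearMap.smul_apply, map_smulₛₗ, hpow]
  simp

theorem exp_neg_exp {N : Module.End ℂ E} (hN : IsNilpotent N) (x : E) :
    IsNilpotent.exp (-N) (IsNilpotent.exp N x) = x :=
  LinearMap.congr_fun (IsNilpotent.exp_neg_mul_exp_self hN) x

theorem exp_exp_neg {N : Module.End ℂ E} (hN : IsNilpotent N) (x : E) :
    IsNilpotent.exp N (IsNilpotent.exp (-N) x) = x :=
  LinearMap.congr_fun (IsNilpotent.exp_mul_exp_neg_self hN) x

theorem exp_bijective {N : Module.End ℂ E} (hN : IsNilpotent N) :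
    Function.Bijective (IsNilpotent.exp N : Module.End ℂ E) :=
  ⟨Function.LeftInverse.injective (exp_neg_exp hN),
    fun x => ⟨_, exp_exp_neg hN x⟩⟩

/-- Both exp(N) and its inverse exp(-N) preserve the span, since P is closed under adding the
degrees of either. -/
theorem gspan_map_unip {A : ℤ × ℤ → Submodule ℂ E} {P : Set (ℤ × ℤ)}
    (hP : ∀ i ∈ P, ∀ d ∈ unipDeg, i + d ∈ P) {N : Module.End ℂ E} (hN : HasDeg A A negDeg N)
    (hnil : IsNilpotent N) : (gspan A P).map (IsNilpotent.exp N) = gspan A P := by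
  apply le_antisymm
  · rintro _ ⟨x, hx, rfl⟩
    exact hN.exp.apply_mem hP hx
  · intro x hx
    exact ⟨_, hN.neg.exp.apply_mem hP hx, exp_exp_neg hnil x⟩

end Comparison

/-! ### The real splitting -/

section RealSplitting

variable {E : Type*} [AddCommGroup E] [Module ℂ E] [Module ℚ (Module.End ℂ E)]
  [FiniteDimensional ℂ E] {W F : ℤ → Submodule ℂ E}

theorem exists_real_splitting (σ : E →ₛₗ[starRingEnd ℂ] E) (hσ : ∀ x, σ (σ x) = x)
    (hW : ∀ n, (W n).comap σ = W n) (H : Opposed W F fun p => (F p).comap σ) :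
    ∃ (V : ℤ × ℤ → Submodule ℂ E) (D : Module.End ℂ E), DirectSum.IsInternal V ∧
      (∀ x, σ (D x) = D (σ x)) ∧ (∀ i, ∀ x ∈ V i, σ x ∈ V i.swap) ∧
      (∀ n, W n = gspan V {i | i.1 + i.2 ≤ n}) ∧ HasDeg V V negDeg D ∧
      ∀ p, F p = (gspan V {i | p ≤ i.1}).map (IsNilpotent.exp (Complex.I • D)) := by
  set F' : ℤ → Submodule ℂ E := fun p => (F p).comap σ with hF'
  set A := Opposed.bideg W F F' with hAdef
  set J : ℤ × ℤ → Submodule ℂ E := fun i => deligne W F' F i.2 i.1 with hJdef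
  have hA : DirectSum.IsInternal A := H.isInternal
  have hJ : DirectSum.IsInternal J := isInternal_swap H.symm.isInternal
  have hAJ : ∀ i : ℤ × ℤ, A i ≤ gspan J {j | j = i ∨ (j.1 < i.1 ∧ j.1 + j.2 < i.1 + i.2)} := by
    intro i
    have h1 := H.symm.symm_deligne_le i.swap
    have h2 := gspan_swap (Opposed.bideg W F' F)
      {j | j = i ∨ (j.1 < i.1 ∧ j.1 + j.2 < i.1 + i.2)}
    refine (h1.trans ?_).trans h2.ge
    refine gspan_mono _ fun j hj => ?_
    simp only [Set.mem_ofPred_eq, Set.mem_preimage, Prod.fst_swap, Prod.snd_swap,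
      Prod.ext_iff] at hj ⊢
    omega
  obtain ⟨N, hN, hNJ, hNW⟩ := exists_exp_map_eq hA hJ H.symm_deligne_le hAJ
  have hnil : IsNilpotent N := (hN.mono fun _ hd => hd.1).isNilpotent hA
  have hσF : ∀ p, ∀ x ∈ F p, σ x ∈ F' p := fun p x hx => by
    simpa [hF', hσ] using hx
  have hσF' : ∀ p, ∀ x ∈ F' p, σ x ∈ F p := fun p x hx => hx
  have hσW : ∀ n, ∀ x ∈ W n, σ x ∈ W n := fun n x hx => by
    rw [← hW n] at hx; exact hx
  have aux : ∀ (F₁ F₂ : ℤ → Submodule ℂ E), (∀ p, ∀ x ∈ F₁ p, σ x ∈ F₂ p) → ∀ p q,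
      deligneAux W F₁ p q ≤ (deligneAux W F₂ p q).comap σ := by
    intro F₁ F₂ h12 p q
    refine sup_le (fun x hx => ?_) (iSup₂_le fun m hm x hx => ?_)
    · exact Submodule.mem_sup_left ⟨h12 _ x hx.1, hσW _ x hx.2⟩
    · refine Submodule.mem_sup_right ?_
      exact le_iSup₂_of_le (f := fun (m : ℤ) (_ : m < p + q) => F₂ (m + 1 - p) ⊓ W m)
        m hm le_rfl ⟨h12 _ x hx.1, hσW _ x hx.2⟩
  have hσA : ∀ i, ∀ x ∈ A i, σ x ∈ J i.swap := fun i x hx =>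
    ⟨⟨hσF _ x hx.1.1, hσW _ x hx.1.2⟩, aux F' F hσF' _ _ hx.2⟩
  have hσJ : ∀ i, ∀ x ∈ J i, σ x ∈ A i.swap := fun i x hx =>
    ⟨⟨hσF' _ x hx.1.1, hσW _ x hx.1.2⟩, aux F F' hσF _ _ hx.2⟩
  -- Two conjugate-linear maps compose to a linear one.
  let N' : Module.End ℂ E := σ.comp (N.comp σ)
  have hN'app : ∀ x, N' x = σ (N (σ x)) := fun x => rfl
  have hN'nil : IsNilpotent N' := by
    obtain ⟨n, hn⟩ := hnil
    have : ∀ (m : ℕ) (x : E), (N' ^ m) x = σ ((N ^ m) (σ x)) := fun m => by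
      induction m with
      | zero => intro x; simp [hσ]
      | succ m ih => intro x; rw [pow_succ', pow_succ', Module.End.mul_apply, ih, hN'app, hσ,
          Module.End.mul_apply]
    exact ⟨n, LinearMap.ext fun x => by rw [this, hn]; simp⟩
  have hexpN' : ∀ x, σ (IsNilpotent.exp N x) = IsNilpotent.exp N' (σ x) :=
    conj_exp σ hnil hN'nil fun x => by rw [hN'app, hσ]
  have hWexp : ∀ i, ∀ x ∈ A i, IsNilpotent.exp N x - x ∈ W (i.1 + i.2 - 1) := by
    intro i x hx
    rw [H.W_eq]
    exact gspan_mono A (fun j (hj : j.1 + j.2 < i.1 + i.2) => Int.le_sub_one_of_lt hj) (hNW i x hx)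
  -- For x in A_i, exp(N) takes x to J_i, and σ exp(N) σ takes the result back to A_i. The total
  -- change lies in lower weight, so it is zero.
  have hN'N : IsNilpotent.exp N' * IsNilpotent.exp N = 1 := eq_of_forall_mem hA fun i x hx => by
    have hyJ : IsNilpotent.exp N x ∈ J i := by rw [← hNJ]; exact ⟨x, hx, rfl⟩
    have hyW := hWexp i x hx
    rw [Module.End.mul_apply, Module.End.one_apply]
    generalize IsNilpotent.exp N x = y at hyJ hyW ⊢
    have hz : σ (IsNilpotent.exp N (σ y)) = IsNilpotent.exp N' y := by rw [hexpN', hσ]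
    have hσy := hσJ i y hyJ
    have hz1 : IsNilpotent.exp N (σ y) ∈ J i.swap := by rw [← hNJ]; exact ⟨_, hσy, rfl⟩
    have hz2 := hσW _ _ (hWexp _ _ hσy)
    rw [map_sub, hσ, hz, Prod.fst_swap, Prod.snd_swap, add_comm i.2] at hz2
    have hz3 := hσJ _ _ hz1
    rw [hz, Prod.swap_swap] at hz3
    refine sub_eq_zero.1 (H.eq_zero_of_mem_deligne (p := i.1) (q := i.2)
      (Submodule.sub_mem _ hz3 hx) ?_)
    rw [← sub_add_sub_cancel _ y x]
    exact Submodule.add_mem _ hz2 hyW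
  have hpsi : IsNilpotent.exp N' ∘ₗ LinearMap.id = LinearMap.id ∘ₗ IsNilpotent.exp (-N) := by
    rw [LinearMap.comp_id, LinearMap.id_comp]
    exact left_inv_eq_right_inv hN'N (IsNilpotent.exp_mul_exp_neg_self hnil)
  -- An exponential determines its nilpotent exponent, so σNσ = -N.
  have hNN' : N' = -N := by
    have := comp_eq_of_exp_comp_eq hnil.neg hN'nil hpsi
    simpa using this
  have hσN : ∀ x, σ (N x) = -N (σ x) := fun x => by
    have := LinearMap.congr_fun hNN' (σ x)
    rwa [hN'app, hσ] at this
  -- Conjugating i/2 compensates the sign in σNσ = -N, so D is real; and iD = -N/2.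
  set D : Module.End ℂ E := (Complex.I / 2) • N with hD
  have hDnil : IsNilpotent (Complex.I • D) := isNilpotent_complex_smul (isNilpotent_complex_smul hnil _) _
  have hID : Complex.I • D = -((1 / 2 : ℂ) • N) := by
    rw [hD, smul_smul, ← neg_smul]
    congr 1
    ring_nf
    rw [Complex.I_sq]; ring
  have hhalf : IsNilpotent ((1 / 2 : ℂ) • N) := isNilpotent_complex_smul hnil _
  -- Halfway between A and J: exp(-N/2) J = exp(N/2) A, so conjugation preserves V up to the swap.
  set V : ℤ × ℤ → Submodule ℂ E :=
    fun i => (A i).map (IsNilpotent.exp ((1 / 2 : ℂ) • N)) with hV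
  have hspan : ∀ P, gspan V P = (gspan A P).map (IsNilpotent.exp ((1 / 2 : ℂ) • N)) := fun P =>
    (map_gspan A P _).symm
  refine ⟨V, D, isInternal_map hA (exp_bijective hhalf), ?_, ?_, ?_, ?_, ?_⟩
  · intro x
    rw [hD, LinearMap.smul_apply, LinearMap.smul_apply, map_smulₛₗ, hσN]
    simp [map_ofNat, neg_div]
  · rintro i _ ⟨x, hx, rfl⟩
    rw [conj_exp σ hhalf (hhalf.neg) (fun y => by
      rw [LinearMap.smul_apply, map_smulₛₗ, hσN]; simp [map_ofNat])]
    have h1 := hσA i x hx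
    rw [← hNJ] at h1
    obtain ⟨y, hy, hyx⟩ := h1
    rw [← hyx]
    refine ⟨y, hy, ?_⟩
    have : N = (1 / 2 : ℂ) • N + (1 / 2 : ℂ) • N := by rw [← add_smul]; norm_num
    conv_rhs => rw [this, IsNilpotent.exp_add_of_commute (Commute.refl _) hhalf hhalf]
    rw [Module.End.mul_apply, ← this, exp_neg_exp hhalf]
  · intro n
    rw [hspan, H.W_eq, gspan_map_unip ?_ (hN.smul _) hhalf]
    rintro i (hi : i.1 + i.2 ≤ n) d (rfl | ⟨h1, h2⟩)
    · simpa using hi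
    · simp only [Set.mem_ofPred_eq, Prod.fst_add, Prod.snd_add]; omega
  · rintro i _ ⟨x, hx, rfl⟩
    have hcomm : D (IsNilpotent.exp ((1 / 2 : ℂ) • N) x) =
        IsNilpotent.exp ((1 / 2 : ℂ) • N) (D x) := by
      refine (LinearMap.congr_fun (exp_comp_eq hhalf hhalf (g := D) ?_) x).symm
      rw [hD]
      simp only [LinearMap.smul_comp, LinearMap.comp_smul, smul_smul, mul_comm]
    rw [hcomm, hspan]
    exact ⟨_, (hN.smul _) i x hx, rfl⟩
  · intro p
    rw [hspan, hID, ← Submodule.map_comp, H.F_eq]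
    have : IsNilpotent.exp (-((1 / 2 : ℂ) • N)) ∘ₗ IsNilpotent.exp ((1 / 2 : ℂ) • N) = LinearMap.id :=
      LinearMap.ext (exp_neg_exp hhalf)
    rw [this, Submodule.map_id]

end RealSplitting

/-! ### Extension of scalars and complex conjugation -/

section ScalarExtension

variable {V V' : Type} [AddCommGroup V] [Module ℚ V] [AddCommGroup V'] [Module ℚ V']
  {R S : Type} [CommRing R] [Algebra ℚ R] [CommRing S] [Algebra ℚ S]

/-- The map `R ⊗ V → S ⊗ V` induced by a homomorphism `R → S`. -/
def scalarMap (f : R →ₐ[ℚ] S) (V : Type) [AddCommGroup V] [Module ℚ V] :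
    (R ⊗[ℚ] V) →ₗ[ℚ] (S ⊗[ℚ] V) :=
  TensorProduct.map f.toLinearMap LinearMap.id

@[simp]
theorem scalarMap_tmul (f : R →ₐ[ℚ] S) (r : R) (v : V) :
    scalarMap f V (r ⊗ₜ v) = f r ⊗ₜ v := rfl

theorem scalarMap_smul (f : R →ₐ[ℚ] S) (r : R) (x : R ⊗[ℚ] V) :
    scalarMap f V (r • x) = f r • scalarMap f V x := by
  induction x with
  | zero => simp
  | tmul s v => simp [TensorProduct.smul_tmul']
  | add x y hx hy => simp only [smul_add, map_add, hx, hy]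

theorem extendEnd_tmul (f : R →ₐ[ℚ] S) (T : Module.End R (R ⊗[ℚ] V)) (s : S) (v : V) :
    extendEnd f T (s ⊗ₜ v) = s • scalarMap f V (T (1 ⊗ₜ v)) := by
  simp [extendEnd, scalarMap]

theorem tensor_ext {M : Type*} [AddCommGroup M] [Module R M] {T T' : (R ⊗[ℚ] V) →ₗ[R] M}
    (h : ∀ v, T (1 ⊗ₜ v) = T' (1 ⊗ₜ v)) : T = T' := by
  refine LinearMap.ext fun x => ?_
  induction x with
  | zero => simp
  | tmul r v =>
    have : r ⊗ₜ[ℚ] v = r • ((1 : R) ⊗ₜ[ℚ] v) := by simp [TensorProduct.smul_tmul']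
    rw [this, map_smul, map_smul, h]
  | add x y hx hy => simp only [map_add, hx, hy]

theorem extendEnd_scalarMap (f : R →ₐ[ℚ] S) (T : Module.End R (R ⊗[ℚ] V)) (x : R ⊗[ℚ] V) :
    extendEnd f T (scalarMap f V x) = scalarMap f V (T x) := by
  induction x with
  | zero => simp
  | tmul r v =>
    have : r ⊗ₜ[ℚ] v = r • ((1 : R) ⊗ₜ[ℚ] v) := by simp [TensorProduct.smul_tmul']
    rw [scalarMap_tmul, extendEnd_tmul, this, map_smul, scalarMap_smul]
  | add x y hx hy => simp only [map_add, hx, hy]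

theorem extendEnd_eq (f : R →ₐ[ℚ] S) {T : Module.End R (R ⊗[ℚ] V)} {T' : Module.End S (S ⊗[ℚ] V)}
    (h : ∀ x, T' (scalarMap f V x) = scalarMap f V (T x)) : extendEnd f T = T' :=
  tensor_ext fun v => by
    have := h (1 ⊗ₜ v)
    rw [scalarMap_tmul, map_one] at this
    rw [this, extendEnd_tmul, one_smul]

theorem extendEnd_one (f : R →ₐ[ℚ] S) : extendEnd f (1 : Module.End R (R ⊗[ℚ] V)) = 1 :=
  extendEnd_eq f fun _ => rfl

theorem extendEnd_mul (f : R →ₐ[ℚ] S) (T T' : Module.End R (R ⊗[ℚ] V)) :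
    extendEnd f (T * T') = extendEnd f T * extendEnd f T' :=
  extendEnd_eq f fun x => by simp only [Module.End.mul_apply, extendEnd_scalarMap]

theorem extendEnd_add (f : R →ₐ[ℚ] S) (T T' : Module.End R (R ⊗[ℚ] V)) :
    extendEnd f (T + T') = extendEnd f T + extendEnd f T' :=
  extendEnd_eq f fun x => by simp only [LinearMap.add_apply, extendEnd_scalarMap, map_add]

theorem extendEnd_neg (f : R →ₐ[ℚ] S) (T : Module.End R (R ⊗[ℚ] V)) :
    extendEnd f (-T) = -extendEnd f T :=
  extendEnd_eq f fun x => by simp only [LinearMap.neg_apply, extendEnd_scalarMap, map_neg]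

theorem baseChange_scalarMap (f : R →ₐ[ℚ] S) (g : V →ₗ[ℚ] V') (x : R ⊗[ℚ] V) :
    g.baseChange S (scalarMap f V x) = scalarMap f V' (g.baseChange R x) := by
  induction x with
  | zero => simp
  | tmul r v => simp
  | add x y hx hy => simp only [map_add, hx, hy]

theorem scalarMap_injective {f : R →ₐ[ℚ] S} (hf : Function.Injective f) :
    Function.Injective (scalarMap f V) :=
  Module.Flat.rTensor_preserves_injective_linearMap f.toLinearMap hf

/-- Intertwining after extension of scalars. -/
theorem extendEnd_baseChange {f : R →ₐ[ℚ] S} {g : V →ₗ[ℚ] V'}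
    {T : Module.End R (R ⊗[ℚ] V)} {T' : Module.End R (R ⊗[ℚ] V')}
    (h : ∀ x, g.baseChange R (T x) = T' (g.baseChange R x)) (x : S ⊗[ℚ] V) :
    g.baseChange S (extendEnd f T x) = extendEnd f T' (g.baseChange S x) := by
  have : g.baseChange S ∘ₗ extendEnd f T = extendEnd f T' ∘ₗ g.baseChange S :=
    tensor_ext fun v => by
      have e : (1 : S) ⊗ₜ[ℚ] v = scalarMap f V (1 ⊗ₜ v) := by simp
      rw [LinearMap.comp_apply, LinearMap.comp_apply, e, baseChange_scalarMap,
        extendEnd_scalarMap, extendEnd_scalarMap, baseChange_scalarMap, h]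
  exact LinearMap.congr_fun this x

/-- Descent of equivariance: it is checked over ℂ, where the Hodge components live, and then holds
over ℝ. -/
theorem baseChange_comm_of_extendEnd {f : R →ₐ[ℚ] S} (hf : Function.Injective f)
    {g : V →ₗ[ℚ] V'} {T : Module.End R (R ⊗[ℚ] V)} {T' : Module.End R (R ⊗[ℚ] V')}
    (h : ∀ x, g.baseChange S (extendEnd f T x) = extendEnd f T' (g.baseChange S x))
    (x : R ⊗[ℚ] V) : g.baseChange R (T x) = T' (g.baseChange R x) := by
  apply scalarMap_injective hf
  have := h (scalarMap f V x)
  rwa [extendEnd_scalarMap, baseChange_scalarMap, baseChange_scalarMap, extendEnd_scalarMap] at this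

theorem realToComplex_injective : Function.Injective realToComplex := Complex.ofReal_injective

theorem conjMap_tmul (z : ℂ) (v : V) : conjMap V (z ⊗ₜ v) = starRingEnd ℂ z ⊗ₜ v := rfl

theorem conjMap_conjMap (x : ℂ ⊗[ℚ] V) : conjMap V (conjMap V x) = x := by
  induction x with
  | zero => simp
  | tmul z v => simp [conjMap_tmul]
  | add x y hx hy => simp only [map_add, hx, hy]

theorem conjMap_scalarMap (x : ℝ ⊗[ℚ] V) :
    conjMap V (scalarMap realToComplex V x) = scalarMap realToComplex V x := by
  induction x with
  | zero => simp
  | tmul z v => simp [conjMap_tmul]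
  | add x y hx hy => simp only [map_add, hx, hy]

theorem conjMap_baseChange (g : V →ₗ[ℚ] V') (x : ℂ ⊗[ℚ] V) :
    conjMap V' (g.baseChange ℂ x) = g.baseChange ℂ (conjMap V x) := by
  induction x with
  | zero => simp
  | tmul z v => simp [conjMap_tmul]
  | add x y hx hy => simp only [map_add, hx, hy]

theorem conjMap_extendEnd (T : Module.End ℝ (ℝ ⊗[ℚ] V)) (x : ℂ ⊗[ℚ] V) :
    conjMap V (extendEnd realToComplex T x) = extendEnd realToComplex T (conjMap V x) := by
  induction x with
  | zero => simp
  | tmul z v =>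
    rw [conjMap_tmul, extendEnd_tmul, extendEnd_tmul, map_smulₛₗ, conjMap_scalarMap]
  | add x y hx hy => simp only [map_add, hx, hy]

theorem conjSub_baseChange (A : Submodule ℚ V) : conjSub (A.baseChange ℂ) = A.baseChange ℂ := by
  have h : ∀ x ∈ A.baseChange ℂ, conjMap V x ∈ A.baseChange ℂ := by
    intro x hx
    rw [Submodule.baseChange_eq_span] at hx
    induction hx using Submodule.span_induction with
    | mem x hx =>
      obtain ⟨v, hv, rfl⟩ := hx
      simpa [conjMap_tmul] using Submodule.tmul_mem_baseChange_of_mem (1 : ℂ) hv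
    | zero => simp
    | add x y _ _ hx hy => rw [map_add]; exact Submodule.add_mem _ hx hy
    | smul c x _ hx => rw [map_smulₛₗ]; exact Submodule.smul_mem _ _ hx
  ext x
  refine ⟨fun hx => ?_, h x⟩
  rw [← conjMap_conjMap x]
  exact h _ hx

/-- The real part `ℂ ⊗ V → ℝ ⊗ V`. -/
def reMap (V : Type) [AddCommGroup V] [Module ℚ V] : (ℂ ⊗[ℚ] V) →ₗ[ℚ] (ℝ ⊗[ℚ] V) :=
  TensorProduct.map (Complex.reLm.restrictScalars ℚ) LinearMap.id

theorem reMap_tmul (z : ℂ) (v : V) : reMap V (z ⊗ₜ v) = z.re ⊗ₜ v := rfl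

theorem reMap_smul (r : ℝ) (x : ℂ ⊗[ℚ] V) : reMap V ((r : ℂ) • x) = r • reMap V x := by
  induction x with
  | zero => simp
  | tmul z v => simp [TensorProduct.smul_tmul', reMap_tmul]
  | add x y hx hy => simp only [smul_add, map_add, hx, hy]

theorem scalarMap_reMap_of_conj {x : ℂ ⊗[ℚ] V} (hx : conjMap V x = x) :
    scalarMap realToComplex V (reMap V x) = x := by
  have key : ∀ x : ℂ ⊗[ℚ] V,
      (2 : ℂ) • scalarMap realToComplex V (reMap V x) = x + conjMap V x := by
    intro x
    induction x with
    | zero => simp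
    | tmul z v =>
      rw [conjMap_tmul, reMap_tmul, scalarMap_tmul, ← TensorProduct.add_tmul, Complex.add_conj,
        TensorProduct.smul_tmul']
      simp
    | add x y hx hy => simp only [smul_add, map_add, hx, hy]; abel
  have := key x
  rw [hx, ← two_smul ℂ x] at this
  exact smul_right_injective _ two_ne_zero this

/-- An endomorphism commuting with conjugation preserves its fixed vectors, the image of `ℝ ⊗ V`;
`reMap` inverts the inclusion there. -/
theorem exists_extendEnd_eq {T : Module.End ℂ (ℂ ⊗[ℚ] V)}
    (hT : ∀ x, conjMap V (T x) = T (conjMap V x)) :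
    ∃ T₀ : Module.End ℝ (ℝ ⊗[ℚ] V), extendEnd realToComplex T₀ = T := by
  have h : ∀ x, scalarMap realToComplex V (reMap V (T (scalarMap realToComplex V x))) =
      T (scalarMap realToComplex V x) := fun x =>
    scalarMap_reMap_of_conj (by rw [hT, conjMap_scalarMap])
  let T₀ : Module.End ℝ (ℝ ⊗[ℚ] V) :=
    { toFun := fun x => reMap V (T (scalarMap realToComplex V x))
      map_add' := fun x y => by simp only [map_add]
      map_smul' := fun r x => by
        rw [scalarMap_smul, map_smul]
        exact reMap_smul r _ }
  exact ⟨T₀, extendEnd_eq _ fun x => (h x).symm⟩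

theorem extendEnd_injective {f : R →ₐ[ℚ] S} (hf : Function.Injective f) :
    Function.Injective (extendEnd f (V := V)) := fun T T' h => by
  refine LinearMap.ext fun x => scalarMap_injective hf ?_
  rw [← extendEnd_scalarMap, h, extendEnd_scalarMap]

end ScalarExtension

/-! ### Characters -/

section Characters

/-- The character `z ↦ z ^ p * z̄ ^ q`. -/
def hodgeChar (i : ℤ × ℤ) (z : ℂˣ) : ℂ := (z : ℂ) ^ i.1 * (starRingEnd ℂ (z : ℂ)) ^ i.2

theorem hodgeChar_add (i j : ℤ × ℤ) (z : ℂˣ) :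
    hodgeChar (i + j) z = hodgeChar i z * hodgeChar j z := by
  have h1 : (z : ℂ) ≠ 0 := z.ne_zero
  have h2 : starRingEnd ℂ (z : ℂ) ≠ 0 := by simp
  simp only [hodgeChar, Prod.fst_add, Prod.snd_add, zpow_add₀ h1, zpow_add₀ h2]
  ring

theorem hodgeChar_zero (z : ℂˣ) : hodgeChar 0 z = 1 := by simp [hodgeChar]

theorem hodgeChar_mul (i : ℤ × ℤ) (z w : ℂˣ) :
    hodgeChar i (z * w) = hodgeChar i z * hodgeChar i w := by
  simp only [hodgeChar, Units.val_mul, map_mul, mul_zpow]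
  ring

theorem hodgeChar_one (i : ℤ × ℤ) : hodgeChar i 1 = 1 := by simp [hodgeChar]

theorem hodgeChar_swap (i : ℤ × ℤ) (z : ℂˣ) :
    starRingEnd ℂ (hodgeChar i z) = hodgeChar i.swap z := by
  simp [hodgeChar, mul_comm]

/-- At z = 2 the character has value 2^(p+q), so p + q = 0. If p ≠ q, then z = exp(πi/(p-q)) gives
-1. -/
theorem hodgeChar_eq_one {i : ℤ × ℤ} (h : ∀ z, hodgeChar i z = 1) : i = 0 := by
  have h1 : i.1 + i.2 = 0 := by
    have h2 := h (Units.mk0 2 two_ne_zero)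
    have h3 : (2 : ℂ) ^ (i.1 + i.2) = 1 := by
      rw [zpow_add₀ two_ne_zero]
      simpa [hodgeChar, map_ofNat] using h2
    have h4 : (2 : ℝ) ^ (i.1 + i.2) = 1 :=
      Complex.ofReal_injective (by push_cast; exact h3)
    exact (zpow_eq_one_iff_right₀ zero_le_two (by norm_num)).1 h4
  have h2 : i.1 - i.2 = 0 := by
    by_contra hk
    have hk' : ((i.1 - i.2 : ℤ) : ℂ) ≠ 0 := by exact_mod_cast hk
    have h3 := h (Units.mk0 _ (Complex.exp_ne_zero (Real.pi / (i.1 - i.2 : ℤ) * Complex.I)))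
    have h4 : starRingEnd ℂ (Complex.exp (Real.pi / (i.1 - i.2 : ℤ) * Complex.I)) =
        Complex.exp (-(Real.pi / (i.1 - i.2 : ℤ) * Complex.I)) := by
      rw [← Complex.exp_conj]
      simp
    simp only [hodgeChar, Units.val_mk0, h4] at h3
    rw [← Complex.exp_int_mul, ← Complex.exp_int_mul, ← Complex.exp_add] at h3
    have h5 : (i.1 : ℂ) * (Real.pi / (i.1 - i.2 : ℤ) * Complex.I) +
        i.2 * -(Real.pi / (i.1 - i.2 : ℤ) * Complex.I) = Real.pi * Complex.I := by
      have : (i.1 : ℂ) * (Real.pi / (i.1 - i.2 : ℤ) * Complex.I) +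
        i.2 * -(Real.pi / (i.1 - i.2 : ℤ) * Complex.I) =
          ((i.1 - i.2 : ℤ) : ℂ) * (Real.pi / (i.1 - i.2 : ℤ) * Complex.I) := by
        push_cast; ring
      rw [this]
      field_simp
    rw [h5, Complex.exp_pi_mul_I] at h3
    norm_num at h3
  ext <;> simp <;> omega

theorem hodgeChar_injective : Function.Injective hodgeChar := fun i j h => by
  have := hodgeChar_eq_one (i := i - j) fun z => by
    have h1 := hodgeChar_add (i - j) j z
    have h2 := hodgeChar_add j (-j) z
    rw [sub_add_cancel, h] at h1
    rw [add_neg_cancel, hodgeChar_zero] at h2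
    have hne : hodgeChar j z ≠ 0 := fun h0 => by simp [h0] at h2
    exact mul_right_cancel₀ hne (by rw [← h1, one_mul])
  exact sub_eq_zero.1 this

variable {E : Type*} [AddCommGroup E] [Module ℂ E]

/-- The subspace on which `f` acts through the character `hodgeChar i`. -/
def charSpace (f : ℂˣ → Module.End ℂ E) (i : ℤ × ℤ) : Submodule ℂ E :=
  ⨅ z : ℂˣ, LinearMap.ker (f z - hodgeChar i z • (1 : Module.End ℂ E))

theorem mem_charSpace {f : ℂˣ → Module.End ℂ E} {i : ℤ × ℤ} {x : E} :
    x ∈ charSpace f i ↔ ∀ z, f z x = hodgeChar i z • x := by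
  simp [charSpace, sub_eq_zero]

/-- The characters are distinct, so the joint eigenspaces lie in different joint generalized
eigenspaces of a commuting family, which are independent. -/
theorem iSupIndep_charSpace {f : ℂˣ → Module.End ℂ E} (hf : ∀ z w, Commute (f z) (f w)) :
    iSupIndep (charSpace f) := by
  have h := Module.End.independent_iInf_maxGenEigenspace_of_forall_mapsTo f
    (fun z w μ => Module.End.mapsTo_maxGenEigenspace_of_comm (hf w z) μ)
  refine (h.comp hodgeChar_injective).mono fun i x hx => ?_
  rw [mem_charSpace] at hx
  refine (Submodule.mem_iInf _).2 fun z => ?_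
  exact Module.End.mem_maxGenEigenspace _ _ _ |>.2 ⟨1, by simp [hx z]⟩

theorem isInternal_charSpace {f : ℂˣ → Module.End ℂ E} (hf : ∀ z w, Commute (f z) (f w))
    (h : ⨆ i, charSpace f i = ⊤) : DirectSum.IsInternal (charSpace f) :=
  (DirectSum.isInternal_submodule_iff_iSupIndep_and_iSup_eq_top _).2 ⟨iSupIndep_charSpace hf, h⟩

/-- An independent family has no smaller family with the same full sum. A bigrading with the right
action is therefore recognized without checking its directness. -/
theorem charSpace_eq {f : ℂˣ → Module.End ℂ E} (hf : ∀ z w, Commute (f z) (f w))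
    {A : ℤ × ℤ → Submodule ℂ E} (hA : ⨆ i, A i = ⊤)
    (h : ∀ i, ∀ x ∈ A i, ∀ z, f z x = hodgeChar i z • x) :
    charSpace f = A ∧ DirectSum.IsInternal A := by
  have hind := iSupIndep_charSpace hf
  have heq : A = charSpace f := (hind.le_iff_eq_of_iSup_eq_top hA).1 fun i x hx => mem_charSpace.2 (h i x hx)
  refine ⟨heq.symm, ?_⟩
  rw [heq] at hA ⊢
  exact isInternal_charSpace hf hA

/-- The components of an element of a stable subspace belong to this subspace. -/
theorem gproj_mem_of_stable {f : ℂˣ → Module.End ℂ E} (hf : ∀ z w, Commute (f z) (f w))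
    {A : ℤ × ℤ → Submodule ℂ E} (hA : DirectSum.IsInternal A)
    (h : ∀ i, ∀ x ∈ A i, ∀ z, f z x = hodgeChar i z • x) {Y : Submodule ℂ E}
    (hY : ∀ z, ∀ y ∈ Y, f z y ∈ Y) {y : E} (hy : y ∈ Y) (i : ℤ × ℤ) : gproj hA i y ∈ Y := by
  -- The components of y have images in E/Y on which the action is by distinct characters. These
  -- images sum to zero, so each is zero.
  let g : ℂˣ → Module.End ℂ (E ⧸ Y) := fun z => Y.mapQ Y (f z) (hY z)
  have hg : ∀ z w, Commute (g z) (g w) := fun z w => by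
    refine LinearMap.ext fun x => ?_
    obtain ⟨x, rfl⟩ := Y.mkQ_surjective x
    have := LinearMap.congr_fun (hf z w) x
    simp only [Module.End.mul_apply] at this
    simp [g, this]
  have hind := iSupIndep_charSpace hg
  rw [iSupIndep_iff_finsetSum_eq_zero_imp_eq_zero] at hind
  obtain ⟨s, hs, hsum⟩ := exists_eq_sum_gproj hA y
  by_cases hi : i ∈ s
  · rw [← Submodule.Quotient.mk_eq_zero]
    refine hind s (fun i => Y.mkQ (gproj hA i y)) (fun j _ => mem_charSpace.2 fun z => ?_) ?_ i hi
    · have := h j _ (gproj_mem hA j y) z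
      change Y.mkQ (f z (gproj hA j y)) = _
      rw [this, map_smul]
    · rw [← map_sum, ← hsum]
      exact (Submodule.Quotient.mk_eq_zero Y).2 hy
  · rw [hs i hi]; exact Y.zero_mem

end Characters

/-! ### Functoriality of the canonical pair -/

theorem hasDeg_exp_sub_one {E : Type*} [AddCommGroup E] [Module ℂ E] [Module ℚ (Module.End ℂ E)]
    {A : ℤ × ℤ → Submodule ℂ E} {N : Module.End ℂ E} (hN : HasDeg A A negDeg N)
    (hnil : IsNilpotent N) : HasDeg A A negDeg (IsNilpotent.exp N - 1) := by
  obtain ⟨n, hn⟩ := hnil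
  obtain ⟨r, hr⟩ := expPoly_sub_one n
  have : IsNilpotent.exp N - 1 = Polynomial.aeval N (expPoly (n + 2) - 1) := by
    rw [exp_eq_aeval (pow_eq_zero_of_le (Nat.le_add_right n 2) hn), map_sub, map_one]
  rw [this, hr]
  exact hN.aeval negDeg_add (by simp [Polynomial.mul_coeff_zero])

theorem negDeg_isNilpotent {E : Type*} [AddCommGroup E] [Module ℂ E] [FiniteDimensional ℂ E]
    {A : ℤ × ℤ → Submodule ℂ E} {N : Module.End ℂ E} (hA : DirectSum.IsInternal A)
    (hN : HasDeg A A negDeg N) : IsNilpotent N :=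
  (hN.mono fun _ hd => hd.1).isNilpotent hA

section Hom

variable {G R M : Type*} [Group G] [CommRing R] [AddCommGroup M] [Module R M]

/-- A homomorphism from a group to the monoid of endomorphisms takes values in automorphisms. -/
def toAut (ρ : G →* Module.End R M) : G →* (M ≃ₗ[R] M) :=
  (LinearMap.GeneralLinearGroup.generalLinearEquiv R M).toMonoidHom.comp ρ.toHomUnits

end Hom

section Canonical

variable {V : Type} [AddCommGroup V] [Module ℚ V]

/-- The complexification of a real action. -/
def actC (h : ℂˣ →* ((ℝ ⊗[ℚ] V) ≃ₗ[ℝ] (ℝ ⊗[ℚ] V))) (z : ℂˣ) : Module.End ℂ (ℂ ⊗[ℚ] V) :=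
  extendEnd realToComplex (h z).toLinearMap

theorem actC_mul (h : ℂˣ →* ((ℝ ⊗[ℚ] V) ≃ₗ[ℝ] (ℝ ⊗[ℚ] V))) (z w : ℂˣ) :
    actC h (z * w) = actC h z * actC h w := by
  rw [actC, map_mul, actC, actC, ← extendEnd_mul]
  rfl

theorem actC_commute (h : ℂˣ →* ((ℝ ⊗[ℚ] V) ≃ₗ[ℝ] (ℝ ⊗[ℚ] V))) (z w : ℂˣ) :
    Commute (actC h z) (actC h w) := by
  rw [Commute, SemiconjBy, ← actC_mul, ← actC_mul, mul_comm]

/-- The Hodge components as a family indexed by bidegrees. -/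
def hodgeFam (h : ℂˣ →* ((ℝ ⊗[ℚ] V) ≃ₗ[ℝ] (ℝ ⊗[ℚ] V))) (i : ℤ × ℤ) : Submodule ℂ (ℂ ⊗[ℚ] V) :=
  hodgeComp h i.1 i.2

theorem hodgeFam_eq (h : ℂˣ →* ((ℝ ⊗[ℚ] V) ≃ₗ[ℝ] (ℝ ⊗[ℚ] V))) :
    hodgeFam h = charSpace (actC h) := rfl

theorem mem_hodgeFam {h : ℂˣ →* ((ℝ ⊗[ℚ] V) ≃ₗ[ℝ] (ℝ ⊗[ℚ] V))} {i : ℤ × ℤ} {x : ℂ ⊗[ℚ] V} :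
    x ∈ hodgeFam h i ↔ ∀ z, actC h z x = hodgeChar i z • x := mem_charSpace

theorem conj_mem_hodgeFam {h : ℂˣ →* ((ℝ ⊗[ℚ] V) ≃ₗ[ℝ] (ℝ ⊗[ℚ] V))} {i : ℤ × ℤ}
    {x : ℂ ⊗[ℚ] V} (hx : x ∈ hodgeFam h i) : conjMap V x ∈ hodgeFam h i.swap := by
  rw [mem_hodgeFam] at hx ⊢
  intro z
  rw [actC, ← conjMap_extendEnd, ← actC, hx, map_smulₛₗ, hodgeChar_swap]

theorem conj_mem_gspan {h : ℂˣ →* ((ℝ ⊗[ℚ] V) ≃ₗ[ℝ] (ℝ ⊗[ℚ] V))} {S : Set (ℤ × ℤ)}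
    {x : ℂ ⊗[ℚ] V} (hx : x ∈ gspan (hodgeFam h) S) :
    conjMap V x ∈ gspan (hodgeFam h) (Prod.swap ⁻¹' S) := by
  have : gspan (hodgeFam h) S ≤ (gspan (hodgeFam h) (Prod.swap ⁻¹' S)).comap (conjMap V) :=
    gspan_le.2 fun i hi y hy =>
      le_gspan (hodgeFam h) (i := i.swap) (by simpa using hi) (conj_mem_hodgeFam hy)
  exact this hx

theorem setOf_sub_mem_negDeg (i : ℤ × ℤ) : {j | j - i ∈ negDeg} = {j | j.1 < i.1 ∧ j.2 < i.2} := by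
  ext j
  simp [negDeg]

namespace HodgeTriple

variable {X Y : HodgeTriple} {h : ℂˣ →* ((ℝ ⊗[ℚ] X.V) ≃ₗ[ℝ] (ℝ ⊗[ℚ] X.V))}
  {δ : Module.End ℝ (ℝ ⊗[ℚ] X.V)}
  {h' : ℂˣ →* ((ℝ ⊗[ℚ] Y.V) ≃ₗ[ℝ] (ℝ ⊗[ℚ] Y.V))} {δ' : Module.End ℝ (ℝ ⊗[ℚ] Y.V)}

theorem IsCanonicalPair.internal (hX : X.IsCanonicalPair h δ) :
    DirectSum.IsInternal (hodgeFam h) := hX.algebraic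

theorem IsCanonicalPair.W_eq (hX : X.IsCanonicalPair h δ) (k : ℤ) :
    (X.W k).baseChange ℂ = gspan (hodgeFam h) {i | i.1 + i.2 ≤ k} :=
  (hX.weight k).trans (gspan_prod (hodgeComp h) fun a b => a + b ≤ k)

theorem IsCanonicalPair.hasDeg (hX : X.IsCanonicalPair h δ) :
    HasDeg (hodgeFam h) (hodgeFam h) negDeg (extendEnd realToComplex δ) := fun i x hx => by
  have := hX.lower i.1 i.2 ⟨x, hx, rfl⟩
  rw [gspan_prod_and (hodgeComp h) (fun a => a < i.1) (fun b => b < i.2)] at this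
  rwa [setOf_sub_mem_negDeg]

theorem IsCanonicalPair.F_eq (hX : X.IsCanonicalPair h δ) (p : ℤ) :
    X.F p = (gspan (hodgeFam h) {i | p ≤ i.1}).map
      (IsNilpotent.exp (Complex.I • extendEnd realToComplex δ)) := by
  rw [hX.hodge p, gspan_prod' (hodgeComp h) fun a => p ≤ a]
  rfl

theorem IsCanonicalPair.isNilpotent (hX : X.IsCanonicalPair h δ) :
    IsNilpotent (Complex.I • extendEnd realToComplex δ) :=
  negDeg_isNilpotent hX.internal (hX.hasDeg.smul _)

/-- The working criterion: a spanning family with the correct characters is the Hodge family of h,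
so the other conditions may be checked on A. Nilpotence is available in the condition on F because
it follows from the degrees of δ. -/
theorem isCanonicalPair_of {A : ℤ × ℤ → Submodule ℂ (ℂ ⊗[ℚ] X.V)} (hA : ⨆ i, A i = ⊤)
    (hact : ∀ i, ∀ x ∈ A i, ∀ z, actC h z x = hodgeChar i z • x)
    (hW : ∀ k, (X.W k).baseChange ℂ = gspan A {i | i.1 + i.2 ≤ k})
    (hδ : HasDeg A A negDeg (extendEnd realToComplex δ))
    (hF : IsNilpotent (Complex.I • extendEnd realToComplex δ) → ∀ p,
      X.F p = (gspan A {i | p ≤ i.1}).map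
        (IsNilpotent.exp (Complex.I • extendEnd realToComplex δ))) :
    X.IsCanonicalPair h δ ∧ hodgeFam h = A := by
  obtain ⟨h1, h2⟩ := charSpace_eq (actC_commute h) hA hact
  rw [← hodgeFam_eq] at h1
  subst h1
  refine ⟨⟨h2, fun k => ?_, fun p q => ?_, fun p => ?_⟩, rfl⟩
  · exact (hW k).trans (gspan_prod (hodgeComp h) fun a b => a + b ≤ k).symm
  · rw [gspan_prod_and (hodgeComp h) (fun a => a < p) (fun b => b < q)]
    rintro _ ⟨x, hx, rfl⟩
    have := hδ (p, q) x hx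
    rwa [setOf_sub_mem_negDeg] at this
  · rw [gspan_prod' (hodgeComp h) fun a => p ≤ a]
    exact hF (negDeg_isNilpotent h2 (hδ.smul _)) p

end HodgeTriple

theorem map_baseChange_le {R : Type} [CommRing R] [Algebra ℚ R] {V' : Type} [AddCommGroup V']
    [Module ℚ V'] {f : V →ₗ[ℚ] V'} {W : Submodule ℚ V} {W' : Submodule ℚ V'} (h : W.map f ≤ W')
    {x : R ⊗[ℚ] V} (hx : x ∈ W.baseChange R) : f.baseChange R x ∈ W'.baseChange R := by
  have : W.baseChange R ≤ (W'.baseChange R).comap (f.baseChange R) := by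
    rw [Submodule.baseChange_eq_span, Submodule.span_le]
    rintro _ ⟨v, hv, rfl⟩
    simpa using Submodule.tmul_mem_baseChange_of_mem (1 : R) (h ⟨v, hv, rfl⟩)
  exact this hx

namespace HodgeTriple

variable {X Y : HodgeTriple} {h : ℂˣ →* ((ℝ ⊗[ℚ] X.V) ≃ₗ[ℝ] (ℝ ⊗[ℚ] X.V))}
  {δ : Module.End ℝ (ℝ ⊗[ℚ] X.V)}
  {h' : ℂˣ →* ((ℝ ⊗[ℚ] Y.V) ≃ₗ[ℝ] (ℝ ⊗[ℚ] Y.V))} {δ' : Module.End ℝ (ℝ ⊗[ℚ] Y.V)}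

theorem conj_exp_smul {V : Type} [AddCommGroup V] [Module ℚ V]
    {δ : Module.End ℝ (ℝ ⊗[ℚ] V)} (hδ : IsNilpotent (Complex.I • extendEnd realToComplex δ))
    (x : ℂ ⊗[ℚ] V) :
    conjMap V (IsNilpotent.exp (Complex.I • extendEnd realToComplex δ) x) =
      IsNilpotent.exp (-(Complex.I • extendEnd realToComplex δ)) (conjMap V x) :=
  conj_exp (conjMap V) hδ hδ.neg (fun y => by
    rw [LinearMap.neg_apply, LinearMap.smul_apply, LinearMap.smul_apply, map_smulₛₗ,
      conjMap_extendEnd]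
    simp) x

/-- Morphisms are compatible with canonical pairs, over `ℂ`. -/
theorem IsMorphism.compat_complex {f : X.V →ₗ[ℚ] Y.V} (hf : IsMorphism X Y f)
    (hX : X.IsCanonicalPair h δ) (hY : Y.IsCanonicalPair h' δ') :
    HasDeg (hodgeFam h) (hodgeFam h') {0} (f.baseChange ℂ) ∧
      ∀ x, f.baseChange ℂ (extendEnd realToComplex δ x) =
        extendEnd realToComplex δ' (f.baseChange ℂ x) := by
  set A := hodgeFam h
  set A' := hodgeFam h'
  set N := Complex.I • extendEnd realToComplex δ with hNdef
  set N' := Complex.I • extendEnd realToComplex δ' with hN'def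
  set φ := f.baseChange ℂ with hφ
  have hA : DirectSum.IsInternal A := hX.internal
  have hA' : DirectSum.IsInternal A' := hY.internal
  have hN : IsNilpotent N := hX.isNilpotent
  have hN' : IsNilpotent N' := hY.isNilpotent
  have dN : HasDeg A A negDeg N := hX.hasDeg.smul _
  have dN' : HasDeg A' A' negDeg N' := hY.hasDeg.smul _
  -- The map g respects the split filtrations attached to the bigradings, and g' is its complex
  -- conjugate, since conjugation changes the signs of N and N'.
  set g : (ℂ ⊗[ℚ] X.V) →ₗ[ℂ] (ℂ ⊗[ℚ] Y.V) :=
    IsNilpotent.exp (-N') ∘ₗ φ ∘ₗ IsNilpotent.exp N with hg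
  set g' : (ℂ ⊗[ℚ] X.V) →ₗ[ℂ] (ℂ ⊗[ℚ] Y.V) :=
    IsNilpotent.exp N' ∘ₗ φ ∘ₗ IsNilpotent.exp (-N) with hg'
  have hstab : ∀ n : ℤ, ∀ i ∈ {i : ℤ × ℤ | i.1 + i.2 ≤ n}, ∀ d ∈ unipDeg,
      i + d ∈ {i : ℤ × ℤ | i.1 + i.2 ≤ n} := by
    rintro n i (hi : i.1 + i.2 ≤ n) d (rfl | ⟨h1, h2⟩)
    · simpa using hi
    · simp only [Set.mem_ofPred_eq, Prod.fst_add, Prod.snd_add]; omega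
  have dg : HasDeg A A' {d | 0 ≤ d.1 ∧ d.1 + d.2 ≤ 0} g := by
    have d1 : HasDeg A A' {d | 0 ≤ d.1} g := fun i x hx => by
      have h1 : IsNilpotent.exp N x ∈ X.F i.1 := by
        rw [hX.F_eq]; exact ⟨x, le_gspan A (by simp) hx, rfl⟩
      have h2 := hf.2 i.1 ⟨_, h1, rfl⟩
      rw [hY.F_eq] at h2
      obtain ⟨y, hy, hyx⟩ := h2
      have h3 : g x = y := by
        rw [hg, LinearMap.comp_apply, LinearMap.comp_apply, ← hyx, exp_neg_exp hN']
      rw [h3]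
      exact gspan_mono A' (fun j (hj : i.1 ≤ j.1) => by simpa using hj) hy
    have d2 : HasDeg A A' {d | d.1 + d.2 ≤ 0} g := fun i x hx => by
      have h1 : IsNilpotent.exp N x ∈ gspan A {j | j.1 + j.2 ≤ i.1 + i.2} :=
        dN.exp.apply_mem (hstab _) (le_gspan A (by simp) hx)
      rw [← hX.W_eq] at h1
      have h2 := map_baseChange_le (hf.1 _) h1
      rw [hY.W_eq] at h2
      refine gspan_mono A' (fun j hj => ?_) (dN'.neg.exp.apply_mem (hstab _) h2)
      simp only [Set.mem_ofPred_eq, Prod.fst_sub, Prod.snd_sub] at hj ⊢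
      omega
    exact (d1.inter hA' d2).mono fun d hd => ⟨hd.1, hd.2⟩
  have hconj : ∀ x, g' x = conjMap Y.V (g (conjMap X.V x)) := fun x => by
    have h1 := conj_exp_smul hN (conjMap X.V x)
    rw [conjMap_conjMap] at h1
    have h2 : ∀ y, conjMap Y.V (IsNilpotent.exp (-N') y) =
        IsNilpotent.exp N' (conjMap Y.V y) := fun y => by
      have := conj_exp_smul hN' (IsNilpotent.exp (-N') y)
      rw [exp_exp_neg hN'] at this
      rw [this, exp_exp_neg hN']
    rw [hg, hg', LinearMap.comp_apply, LinearMap.comp_apply, LinearMap.comp_apply,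
      LinearMap.comp_apply, h2, hφ, conjMap_baseChange, h1]
  have dg' : HasDeg A A' {d | 0 ≤ d.2 ∧ d.1 + d.2 ≤ 0} g' := fun i x hx => by
    rw [hconj]
    refine gspan_mono A' (fun j hj => ?_) (conj_mem_gspan (dg _ _ (conj_mem_hodgeFam hx)))
    simp only [Set.mem_preimage, Set.mem_ofPred_eq, Prod.fst_sub, Prod.snd_sub, Prod.fst_swap,
      Prod.snd_swap] at hj ⊢
    omega
  have eN : IsNilpotent.exp (N + N) = IsNilpotent.exp N * IsNilpotent.exp N :=
    IsNilpotent.exp_add_of_commute (Commute.refl _) hN hN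
  have eN' : IsNilpotent.exp (N' + N') = IsNilpotent.exp N' * IsNilpotent.exp N' :=
    IsNilpotent.exp_add_of_commute (Commute.refl _) hN' hN'
  have hNN : IsNilpotent (N + N) := by
    rw [← two_smul ℂ N]; exact isNilpotent_complex_smul hN _
  have hNN' : IsNilpotent (N' + N') := by
    rw [← two_smul ℂ N']; exact isNilpotent_complex_smul hN' _
  -- Both sides are exp(N') φ exp(N).
  have rel : IsNilpotent.exp (N' + N') ∘ₗ g = g' ∘ₗ IsNilpotent.exp (N + N) := by
    refine LinearMap.ext fun x => ?_
    simp only [eN, eN', hg, hg', LinearMap.comp_apply, Module.End.mul_apply, exp_neg_exp hN,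
      exp_exp_neg hN']
  have hg0 : g = IsNilpotent.exp (-(N' + N')) ∘ₗ g' ∘ₗ IsNilpotent.exp (N + N) := by
    rw [← rel]
    exact LinearMap.ext fun x => (exp_neg_exp hNN' (g x)).symm
  have dg0 : HasDeg A A' {0} g := by
    -- A degree of g' has nonnegative second entry and nonpositive sum, so it is zero or its first
    -- entry is negative; the exponentials preserve this alternative. But degrees of g have
    -- nonnegative first entry, so only zero remains.
    have h1 : HasDeg A A' {d | d = 0 ∨ d.1 < 0} g := by
      rw [hg0]
      refine ((dN'.add dN').neg.exp).comp (D := {d | d = 0 ∨ d.1 < 0})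
        (dg'.comp (dN.add dN).exp ?_) ?_
      · rintro d (rfl | ⟨h1, h2⟩) d' ⟨h3, h4⟩
        · simp only [Set.mem_ofPred_eq, Prod.ext_iff, zero_add, Prod.fst_zero, Prod.snd_zero]
          omega
        · right; simp only [Prod.fst_add]; omega
      · rintro d (rfl | h1) d' (rfl | ⟨h3, h4⟩)
        · simp
        · right; simpa using h3
        · right; simpa using h1
        · right; simp only [Prod.fst_add]; omega
    refine (h1.inter hA' dg).mono ?_
    rintro d ⟨rfl | h1, h2, h3⟩
    · rfl
    · exact absurd h2 (not_le.2 h1)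
  have dg0' : HasDeg A A' {0} g' := fun i x hx => by
    rw [hconj]
    have := conj_mem_hodgeFam (dg0.apply_mem_of_zero (conj_mem_hodgeFam hx))
    exact le_gspan A' (by simp) this
  have hgg' : g' = g := by
    -- By `rel`, the difference is a combination of terms containing an exponential minus 1, hence
    -- of negative degree; since g and g' have degree zero, it vanishes.
    have h1 : HasDeg A A' negDeg (g' - g) := by
      have : g' - g = (IsNilpotent.exp (N' + N') - 1) ∘ₗ g -
          g' ∘ₗ (IsNilpotent.exp (N + N) - 1) := by
        rw [LinearMap.sub_comp, LinearMap.comp_sub, rel]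
        change g' - g = _ - g - (_ - g')
        abel
      rw [this]
      refine HasDeg.sub ?_ ?_
      · exact (hasDeg_exp_sub_one (dN'.add dN') hNN').comp dg0 fun d hd d' hd' => by
          rw [Set.mem_singleton_iff.1 hd, zero_add]; exact hd'
      · exact dg0'.comp (hasDeg_exp_sub_one (dN.add dN) hNN) fun d hd d' hd' => by
          rw [Set.mem_singleton_iff.1 hd', add_zero]; exact hd
    have h2 : HasDeg A A' ∅ (g' - g) := by
      refine (h1.inter hA' (dg0'.sub dg0)).mono ?_
      rintro d ⟨⟨h3, _⟩, h4⟩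
      rw [Set.mem_singleton_iff.1 h4] at h3
      exact absurd h3 (lt_irrefl _)
    exact sub_eq_zero.1 (h2.eq_zero hA)
  rw [hgg'] at rel
  -- With g' = g the relation intertwines exp(2N) and exp(2N'), hence 2N and 2N', hence N and N'.
  have hcomm : N' ∘ₗ g = g ∘ₗ N := by
    have h1 := comp_eq_of_exp_comp_eq hNN hNN' rel
    rw [← two_smul ℂ N, ← two_smul ℂ N', LinearMap.smul_comp, LinearMap.comp_smul] at h1
    exact smul_right_injective _ (two_ne_zero (α := ℂ)) h1
  have hφg : φ = g := by
    have h1 := exp_comp_eq hN hN' hcomm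
    refine LinearMap.ext fun x => ?_
    have h2 := LinearMap.congr_fun h1 (IsNilpotent.exp (-N) x)
    simp only [LinearMap.comp_apply, exp_exp_neg hN] at h2
    rw [← h2, hg]
    simp only [LinearMap.comp_apply, exp_exp_neg hN, exp_exp_neg hN']
  refine ⟨by rw [hφg]; exact dg0, fun x => ?_⟩
  have h1 := LinearMap.congr_fun hcomm x
  rw [← hφg] at h1
  simp only [LinearMap.comp_apply, hNdef, hN'def, LinearMap.smul_apply, map_smul] at h1
  exact (smul_right_injective _ Complex.I_ne_zero h1).symm

theorem IsMorphism.map_hodgeFam {f : X.V →ₗ[ℚ] Y.V} (hf : IsMorphism X Y f)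
    (hX : X.IsCanonicalPair h δ) (hY : Y.IsCanonicalPair h' δ') {i : ℤ × ℤ} {x : ℂ ⊗[ℚ] X.V}
    (hx : x ∈ hodgeFam h i) : f.baseChange ℂ x ∈ hodgeFam h' i :=
  (hf.compat_complex hX hY).1.apply_mem_of_zero hx

theorem IsMorphism.compat_act {f : X.V →ₗ[ℚ] Y.V} (hf : IsMorphism X Y f)
    (hX : X.IsCanonicalPair h δ) (hY : Y.IsCanonicalPair h' δ') (z : ℂˣ) (x : ℝ ⊗[ℚ] X.V) :
    f.baseChange ℝ (h z x) = h' z (f.baseChange ℝ x) := by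
  refine baseChange_comm_of_extendEnd realToComplex_injective (T := (h z).toLinearMap)
    (T' := (h' z).toLinearMap) (fun x => ?_) x
  have : f.baseChange ℂ ∘ₗ actC h z = actC h' z ∘ₗ f.baseChange ℂ :=
    eq_of_forall_mem hX.internal fun i x hx => by
      rw [LinearMap.comp_apply, LinearMap.comp_apply, mem_hodgeFam.1 hx, map_smul,
        mem_hodgeFam.1 (hf.map_hodgeFam hX hY hx)]
  exact LinearMap.congr_fun this x

theorem IsMorphism.compat_nilp {f : X.V →ₗ[ℚ] Y.V} (hf : IsMorphism X Y f)
    (hX : X.IsCanonicalPair h δ) (hY : Y.IsCanonicalPair h' δ') (x : ℝ ⊗[ℚ] X.V) :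
    f.baseChange ℝ (δ x) = δ' (f.baseChange ℝ x) :=
  baseChange_comm_of_extendEnd realToComplex_injective (hf.compat_complex hX hY).2 x

theorem isMorphism_id (X : HodgeTriple) : IsMorphism X X LinearMap.id :=
  ⟨fun k => by simp, fun p => by simp⟩

/-- The identity is a morphism, so it intertwines any two canonical pairs of the same triple. -/
theorem IsCanonicalPair.unique {h' : ℂˣ →* ((ℝ ⊗[ℚ] X.V) ≃ₗ[ℝ] (ℝ ⊗[ℚ] X.V))}
    {δ' : Module.End ℝ (ℝ ⊗[ℚ] X.V)} (hX : X.IsCanonicalPair h δ)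
    (hX' : X.IsCanonicalPair h' δ') : h' = h ∧ δ' = δ := by
  constructor
  · refine MonoidHom.ext fun z => LinearEquiv.ext fun x => ?_
    simpa using (isMorphism_id X).compat_act hX' hX z x
  · refine LinearMap.ext fun x => ?_
    simpa using (isMorphism_id X).compat_nilp hX' hX x

end HodgeTriple

end Canonical

/-! ### Kernels, images and preimages after flat extension of scalars -/

section Flatness

variable {V V' : Type} [AddCommGroup V] [Module ℚ V] [AddCommGroup V'] [Module ℚ V']
  {R : Type} [CommRing R] [Algebra ℚ R]

theorem baseChange_injective_of_injective {f : V →ₗ[ℚ] V'} (hf : Function.Injective f) :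
    Function.Injective (f.baseChange R) :=
  Module.Flat.lTensor_preserves_injective_linearMap f hf

theorem baseChange_surjective_of_surjective {f : V →ₗ[ℚ] V'} (hf : Function.Surjective f) :
    Function.Surjective (f.baseChange R) :=
  LinearMap.lTensor_surjective R hf

theorem baseChange_eq_zero_iff {f : V →ₗ[ℚ] V'} {x : R ⊗[ℚ] V} :
    f.baseChange R x = 0 ↔ x ∈ (LinearMap.ker f).baseChange R := by
  have hex := Module.Flat.lTensor_exact R (LinearMap.exact_subtype_ker_map f)
  exact hex x

theorem mem_comap_baseChange_iff {f : V →ₗ[ℚ] V'} {W : Submodule ℚ V'} {x : R ⊗[ℚ] V} :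
    f.baseChange R x ∈ W.baseChange R ↔ x ∈ (W.comap f).baseChange R := by
  have h1 : W = LinearMap.ker W.mkQ := W.ker_mkQ.symm
  have h2 : W.comap f = LinearMap.ker (W.mkQ ∘ₗ f) := by rw [LinearMap.ker_comp, ← h1]
  rw [h2, ← baseChange_eq_zero_iff, LinearMap.baseChange_comp, LinearMap.comp_apply,
    baseChange_eq_zero_iff, ← h1]

theorem mem_range_baseChange_iff {f : V →ₗ[ℚ] V'} {y : R ⊗[ℚ] V'} :
    y ∈ (LinearMap.range f).baseChange R ↔ ∃ x, f.baseChange R x = y := by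
  constructor
  · intro hy
    have : (LinearMap.range f).baseChange R ≤ LinearMap.range (f.baseChange R) := by
      rw [Submodule.baseChange_eq_span, Submodule.span_le]
      rintro _ ⟨_, ⟨v, rfl⟩, rfl⟩
      exact ⟨1 ⊗ₜ v, by simp⟩
    exact this hy
  · rintro ⟨x, rfl⟩
    exact map_baseChange_le (W := ⊤) (by rw [Submodule.map_top]) (by simp)

theorem mem_baseChange_iff {W : Submodule ℚ V} {y : R ⊗[ℚ] V} :
    y ∈ W.baseChange R ↔ ∃ x, W.subtype.baseChange R x = y := by
  rw [← mem_range_baseChange_iff, Submodule.range_subtype]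

end Flatness

/-! ### Mixed Hodge structures as opposed filtrations -/

namespace HodgeTriple

variable {X : HodgeTriple}

/-- The filtrations on `ℂ ⊗ V` which are considered for mixed Hodge structures. -/
abbrev IsOpposed (X : HodgeTriple) : Prop :=
  Opposed (fun n => (X.W n).baseChange ℂ) X.F (fun p => conjSub (X.F p))

theorem gr_eq_zero_iff {w : ℤ} {y : ℂ ⊗[ℚ] (X.W w)} :
    ((X.W (w - 1)).submoduleOf (X.W w)).mkQ.baseChange ℂ y = 0 ↔
      (X.W w).subtype.baseChange ℂ y ∈ (X.W (w - 1)).baseChange ℂ := by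
  rw [baseChange_eq_zero_iff, Submodule.ker_mkQ, mem_comap_baseChange_iff]
  rfl

/-- The maps defining the graded piece are rational, so they commute with conjugation: the conjugate
of the induced filtration is induced by the conjugate of F. -/
theorem mem_conjSub_grF {w p : ℤ} {x : ℂ ⊗[ℚ] X.Gr w} : x ∈ conjSub (X.grF w p) ↔
    ∃ y, (X.W w).subtype.baseChange ℂ y ∈ conjSub (X.F p) ∧
      ((X.W (w - 1)).submoduleOf (X.W w)).mkQ.baseChange ℂ y = x := by
  constructor
  · rintro ⟨y, hy, hyx⟩
    refine ⟨conjMap _ y, ?_, ?_⟩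
    · change conjMap _ _ ∈ X.F p
      rw [conjMap_baseChange, conjMap_conjMap]
      exact hy
    · rw [← conjMap_baseChange, hyx, conjMap_conjMap]
  · rintro ⟨y, hy, rfl⟩
    refine ⟨conjMap _ y, ?_, (conjMap_baseChange _ y).symm⟩
    change _ ∈ X.F p
    rw [← conjMap_baseChange]
    exact hy

theorem isPure_of_opposed (H : X.IsOpposed) (w : ℤ) : IsPure (X.grF w) w := by
  intro p
  set ι := (X.W w).subtype.baseChange ℂ with hι
  set π := ((X.W (w - 1)).submoduleOf (X.W w)).mkQ.baseChange ℂ with hπ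
  have hπs : Function.Surjective π := baseChange_surjective_of_surjective (Submodule.mkQ_surjective _)
  have hιmem : ∀ y, ι y ∈ (X.W w).baseChange ℂ := fun y => mem_baseChange_iff.2 ⟨y, rfl⟩
  constructor
  · rw [Submodule.disjoint_def]
    rintro _ ⟨y, hy, rfl⟩ hx
    obtain ⟨y', hy', hyy'⟩ := mem_conjSub_grF.1 hx
    refine gr_eq_zero_iff.2 (H.inter w p ⟨⟨hy, hιmem y⟩, ?_⟩)
    have h1 : π (y - y') = 0 := by rw [map_sub, hπ, hyy', sub_self]
    have h2 := gr_eq_zero_iff.1 h1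
    have : ι y = ι y' + ι (y - y') := by rw [map_sub, add_sub_cancel]
    rw [← hι, this]
    exact Submodule.add_mem_sup ⟨hy', hιmem y'⟩ h2
  · rw [codisjoint_iff, eq_top_iff]
    rintro x -
    obtain ⟨y, rfl⟩ := hπs x
    obtain ⟨v, hv, c, hc, hvc⟩ := Submodule.mem_sup.1 (H.sum w p (hιmem y))
    obtain ⟨a, ha, b, hb, rfl⟩ := Submodule.mem_sup.1 hv
    obtain ⟨a', rfl⟩ := mem_baseChange_iff.1 ha.2
    obtain ⟨b', rfl⟩ := mem_baseChange_iff.1 hb.2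
    have h1 : π (y - (a' + b')) = 0 := by
      refine gr_eq_zero_iff.2 ?_
      rw [← hι, map_sub, map_add, ← hvc, add_sub_cancel_left]
      exact hc
    rw [map_sub, sub_eq_zero] at h1
    rw [h1, map_add]
    exact Submodule.add_mem_sup ⟨a', ha.1, rfl⟩ (mem_conjSub_grF.2 ⟨b', hb.1, rfl⟩)

theorem comap_conj_top : conjSub (⊤ : Submodule ℂ (ℂ ⊗[ℚ] X.V)) = ⊤ := by
  simp [conjSub]

theorem comap_conj_bot : conjSub (⊥ : Submodule ℂ (ℂ ⊗[ℚ] X.V)) = ⊥ := by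
  refine eq_bot_iff.2 fun x hx => ?_
  have : conjMap _ x = 0 := hx
  rw [Submodule.mem_bot, ← conjMap_conjMap x, this, map_zero]

theorem conjSub_mono {A B : Submodule ℂ (ℂ ⊗[ℚ] X.V)} (h : A ≤ B) : conjSub A ≤ conjSub B :=
  fun _ hx => h hx

theorem IsMHS.isOpposed (H : X.IsMHS) : X.IsOpposed where
  mono _ _ h := Submodule.baseChange_mono ℂ (H.monotone_W h)
  anti := H.antitone_F
  anti' _ _ h := conjSub_mono (H.antitone_F h)
  W_bot := by obtain ⟨n, hn⟩ := H.W_bot; exact ⟨n, by simp [hn]⟩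
  W_top := by obtain ⟨n, hn⟩ := H.W_top; exact ⟨n, by simp [hn]⟩
  F_bot := H.F_bot
  F_top := H.F_top
  F'_bot := by obtain ⟨n, hn⟩ := H.F_bot; exact ⟨n, by rw [hn, comap_conj_bot]⟩
  F'_top := by obtain ⟨n, hn⟩ := H.F_top; exact ⟨n, by rw [hn, comap_conj_top]⟩
  sum n p := by
    intro x hx
    obtain ⟨y, rfl⟩ := mem_baseChange_iff.1 hx
    set π := ((X.W (n - 1)).submoduleOf (X.W n)).mkQ.baseChange ℂ with hπ
    have h1 : π y ∈ X.grF n p ⊔ conjSub (X.grF n (n + 1 - p)) := by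
      rw [(H.pure_gr n p).sup_eq_top]; trivial
    obtain ⟨a, ⟨a', ha', rfl⟩, b, hb, hab⟩ := Submodule.mem_sup.1 h1
    obtain ⟨b', hb', rfl⟩ := mem_conjSub_grF.1 hb
    have h2 : π (y - (a' + b')) = 0 := by
      rw [map_sub, map_add, ← hab, sub_self]
    have h3 := gr_eq_zero_iff.1 h2
    rw [show y = (a' + b') + (y - (a' + b')) by abel, map_add, map_add]
    exact Submodule.add_mem_sup (Submodule.add_mem_sup ⟨ha', mem_baseChange_iff.2 ⟨_, rfl⟩⟩
      ⟨hb', mem_baseChange_iff.2 ⟨_, rfl⟩⟩) h3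
  inter n p := by
    rintro x ⟨⟨hxF, hxW⟩, hx'⟩
    obtain ⟨y, rfl⟩ := mem_baseChange_iff.1 hxW
    obtain ⟨f, ⟨hf, hfW⟩, w, hw, hfw⟩ := Submodule.mem_sup.1 hx'
    obtain ⟨y', rfl⟩ := mem_baseChange_iff.1 hfW
    have h1 : ((X.W (n - 1)).submoduleOf (X.W n)).mkQ.baseChange ℂ (y - y') = 0 := by
      refine gr_eq_zero_iff.2 ?_
      rw [map_sub, ← hfw, add_sub_cancel_left]
      exact hw
    rw [map_sub, sub_eq_zero] at h1
    refine gr_eq_zero_iff.1 ?_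
    refine (Submodule.disjoint_def.1 (H.pure_gr n p).disjoint) _ ⟨y, hxF, rfl⟩ ?_
    rw [h1]
    exact mem_conjSub_grF.2 ⟨y', hf, rfl⟩

/-- The conditions on W are stated over ℂ in `IsOpposed`; they descend because a rational subspace
is determined by its complexification. -/
theorem isMHS_of_opposed (H : X.IsOpposed) : X.IsMHS where
  monotone_W _ _ h := (Submodule.baseChange_le_iff (A := ℂ)).1 (H.mono h)
  antitone_F := H.anti
  W_bot := by
    obtain ⟨n, hn⟩ := H.W_bot
    exact ⟨n, Submodule.baseChange_injective (A := ℂ) (by simpa using hn)⟩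
  W_top := by
    obtain ⟨n, hn⟩ := H.W_top
    exact ⟨n, Submodule.baseChange_injective (A := ℂ) (by simpa using hn)⟩
  F_top := H.F_top
  F_bot := H.F_bot
  pure_gr := isPure_of_opposed H

/-! ### From a canonical pair to a mixed Hodge structure -/

section FromPair

variable {h : ℂˣ →* ((ℝ ⊗[ℚ] X.V) ≃ₗ[ℝ] (ℝ ⊗[ℚ] X.V))} {δ : Module.End ℝ (ℝ ⊗[ℚ] X.V)}

theorem exists_bound {E : Type*} [AddCommGroup E] [Module ℂ E] [FiniteDimensional ℂ E]
    {A : ℤ × ℤ → Submodule ℂ E} (hA : DirectSum.IsInternal A) (f : ℤ × ℤ → ℤ) :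
    ∃ B : ℤ, ∀ i, A i ≠ ⊥ → |f i| ≤ B := by
  obtain ⟨B, hB⟩ := ((finite_ne_bot hA).image fun i : ℤ × ℤ => |f i|).bddAbove
  exact ⟨B, fun i hi => hB ⟨i, hi, rfl⟩⟩

theorem gspan_eq_bot {E : Type*} [AddCommGroup E] [Module ℂ E]
    {A : ℤ × ℤ → Submodule ℂ E} {S : Set (ℤ × ℤ)} (h : ∀ i ∈ S, A i = ⊥) : gspan A S = ⊥ :=
  eq_bot_iff.2 (gspan_le.2 fun i hi => (h i hi).le)

theorem gspan_eq_top {E : Type*} [AddCommGroup E] [Module ℂ E]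
    {A : ℤ × ℤ → Submodule ℂ E} (hA : DirectSum.IsInternal A) {S : Set (ℤ × ℤ)}
    (h : ∀ i ∉ S, A i = ⊥) : gspan A S = ⊤ := by
  rw [eq_top_iff, ← hA.submodule_iSup_eq_top]
  refine iSup_le fun i => ?_
  by_cases hi : i ∈ S
  · exact le_gspan A hi
  · rw [h i hi]; exact bot_le

theorem conj_mem_gspan_snd {V : Type} [AddCommGroup V] [Module ℚ V]
    {h : ℂˣ →* ((ℝ ⊗[ℚ] V) ≃ₗ[ℝ] (ℝ ⊗[ℚ] V))} {p : ℤ}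
    {x : ℂ ⊗[ℚ] V} (hx : x ∈ gspan (hodgeFam h) {i | p ≤ i.1}) :
    conjMap V x ∈ gspan (hodgeFam h) {i | p ≤ i.2} :=
  gspan_mono _ (show Prod.swap ⁻¹' {i : ℤ × ℤ | p ≤ i.1} ⊆ {i | p ≤ i.2} from fun _ hi => hi)
    (conj_mem_gspan hx)

theorem conj_mem_gspan_fst {V : Type} [AddCommGroup V] [Module ℚ V]
    {h : ℂˣ →* ((ℝ ⊗[ℚ] V) ≃ₗ[ℝ] (ℝ ⊗[ℚ] V))} {p : ℤ}
    {x : ℂ ⊗[ℚ] V} (hx : x ∈ gspan (hodgeFam h) {i | p ≤ i.2}) :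
    conjMap V x ∈ gspan (hodgeFam h) {i | p ≤ i.1} :=
  gspan_mono _ (show Prod.swap ⁻¹' {i : ℤ × ℤ | p ≤ i.2} ⊆ {i | p ≤ i.1} from fun _ hi => hi)
    (conj_mem_gspan hx)

/-- Since δ lowers weights, exp(±iδ) is the identity on each graded piece of W. Thus F and its
conjugate induce there the filtrations by the first and the second Hodge index, which are opposed
because the indices add up to the weight. -/
theorem IsCanonicalPair.isOpposed (hX : X.IsCanonicalPair h δ) : X.IsOpposed := by
  set A := hodgeFam h with hAdef
  have hA : DirectSum.IsInternal A := hX.internal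
  set N := Complex.I • extendEnd realToComplex δ with hNdef
  have hN : IsNilpotent N := hX.isNilpotent
  have dN : HasDeg A A negDeg N := hX.hasDeg.smul _
  obtain ⟨B, hB⟩ := exists_bound hA fun i => i.1 + i.2
  obtain ⟨B', hB'⟩ := exists_bound hA fun i => i.1
  have hanti : Antitone X.F := fun p q hpq => by
    rw [hX.F_eq, hX.F_eq]
    exact Submodule.map_mono (gspan_mono _ fun i (hi : q ≤ i.1) => show p ≤ i.1 from hpq.trans hi)
  have hbot : ∃ p, X.F p = ⊥ := ⟨B' + 1, by
    rw [hX.F_eq, gspan_eq_bot, Submodule.map_bot]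
    intro i (hi : B' + 1 ≤ i.1)
    by_contra hne
    have := abs_le.1 (hB' i hne)
    omega⟩
  have htop : ∃ p, X.F p = ⊤ := ⟨-B', by
    rw [hX.F_eq, gspan_eq_top hA, Submodule.map_top, LinearMap.range_eq_top]
    · exact (exp_bijective hN).2
    intro i (hi : ¬ -B' ≤ i.1)
    by_contra hne
    have := abs_le.1 (hB' i hne)
    omega⟩
  have hmono : Monotone fun n => (X.W n).baseChange ℂ := fun m n hmn => by
    simp only [hX.W_eq]
    exact gspan_mono _ fun i (hi : i.1 + i.2 ≤ m) => show i.1 + i.2 ≤ n from hi.trans hmn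
  have hsub : ∀ {M : Module.End ℂ (ℂ ⊗[ℚ] X.V)}, IsNilpotent M → HasDeg A A negDeg M →
      ∀ {n : ℤ} {x}, x ∈ (X.W n).baseChange ℂ →
      IsNilpotent.exp M x - x ∈ (X.W (n - 1)).baseChange ℂ := by
    intro M hM dM n x hx
    rw [hX.W_eq] at hx ⊢
    refine (hasDeg_exp_sub_one dM hM).apply_mem ?_ hx
    rintro i (hi : i.1 + i.2 ≤ n) d ⟨h1, h2⟩
    simp only [Set.mem_ofPred_eq, Prod.fst_add, Prod.snd_add]
    omega
  have hexp : ∀ {M : Module.End ℂ (ℂ ⊗[ℚ] X.V)}, IsNilpotent M → HasDeg A A negDeg M →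
      ∀ {n : ℤ} {x}, x ∈ (X.W n).baseChange ℂ → IsNilpotent.exp M x ∈ (X.W n).baseChange ℂ := by
    intro M hM dM n x hx
    have := Submodule.add_mem _ (hmono (show n - 1 ≤ n by omega) (hsub hM dM hx)) hx
    rwa [sub_add_cancel] at this
  have hFmem : ∀ {p : ℤ} {x}, x ∈ gspan A {i | p ≤ i.1} → IsNilpotent.exp N x ∈ X.F p :=
    fun {p x} hx => by rw [hX.F_eq]; exact ⟨x, hx, rfl⟩
  have hconj : ∀ x, conjMap X.V (IsNilpotent.exp N x) = IsNilpotent.exp (-N) (conjMap X.V x) :=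
    conj_exp_smul hN
  have hFmem' : ∀ {p : ℤ} {x}, x ∈ gspan A {i | p ≤ i.2} →
      IsNilpotent.exp (-N) x ∈ conjSub (X.F p) := fun {p x} hx => by
    have h1 := hFmem (p := p) (conj_mem_gspan_fst hx)
    change conjMap X.V _ ∈ X.F p
    rw [← conjMap_conjMap x, ← hconj, conjMap_conjMap]
    exact h1
  have hFconj : ∀ {p : ℤ} {x}, x ∈ conjSub (X.F p) → ∃ u ∈ gspan A {i | p ≤ i.2},
      IsNilpotent.exp (-N) u = x := fun {p x} hx => by
    have h1 : conjMap _ x ∈ X.F p := hx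
    rw [hX.F_eq] at h1
    obtain ⟨v, hv, hvx⟩ := h1
    refine ⟨conjMap _ v, conj_mem_gspan_snd hv, ?_⟩
    rw [← hconj, hvx, conjMap_conjMap]
  refine ⟨hmono, hanti, fun _ _ hpq => conjSub_mono (hanti hpq), ⟨-B - 1, ?_⟩, ⟨B, ?_⟩, hbot, htop,
    ?_, ?_, fun n p => ?_, fun n p => ?_⟩
  · rw [hX.W_eq, gspan_eq_bot]
    intro i (hi : i.1 + i.2 ≤ -B - 1)
    by_contra hne
    have := abs_le.1 (hB i hne)
    omega
  · rw [hX.W_eq, gspan_eq_top hA]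
    intro i (hi : ¬ i.1 + i.2 ≤ B)
    by_contra hne
    have := abs_le.1 (hB i hne)
    omega
  · obtain ⟨p, hp⟩ := hbot; exact ⟨p, by rw [hp, comap_conj_bot]⟩
  · obtain ⟨p, hp⟩ := htop; exact ⟨p, by rw [hp, comap_conj_top]⟩
  · refine le_trans (hX.W_eq n).le (gspan_le.2 fun i (hi : i.1 + i.2 ≤ n) x hx => ?_)
    have hxW : x ∈ (X.W n).baseChange ℂ := by rw [hX.W_eq]; exact le_gspan A hi hx
    rcases hi.lt_or_eq with hlt | heq
    · refine Submodule.mem_sup_right ?_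
      rw [hX.W_eq]
      exact le_gspan A (Int.le_sub_one_of_lt hlt) hx
    by_cases hp : p ≤ i.1
    · rw [show x = IsNilpotent.exp N x + -(IsNilpotent.exp N x - x) by abel]
      refine Submodule.add_mem_sup (Submodule.mem_sup_left ⟨?_, hexp hN dN hxW⟩)
        (Submodule.neg_mem _ (hsub hN dN hxW))
      exact hFmem (le_gspan A hp hx)
    · rw [show x = IsNilpotent.exp (-N) x + -(IsNilpotent.exp (-N) x - x) by abel]
      refine Submodule.add_mem_sup (Submodule.mem_sup_right ⟨?_, hexp hN.neg dN.neg hxW⟩)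
        (Submodule.neg_mem _ (hsub hN.neg dN.neg hxW))
      exact hFmem' (le_gspan A (show n + 1 - p ≤ i.2 by omega) hx)
  · rintro x ⟨⟨hxF, hxW⟩, hx'⟩
    obtain ⟨f, ⟨hf, hfW⟩, w, hw, hfw⟩ := Submodule.mem_sup.1 hx'
    rw [hX.F_eq] at hxF
    obtain ⟨v, hv, hvx⟩ := hxF
    obtain ⟨u, hu, huf⟩ := hFconj hf
    have hvW : v ∈ (X.W n).baseChange ℂ := by
      rw [← exp_neg_exp hN v, hvx]
      exact hexp hN.neg dN.neg hxW
    have huW : u ∈ (X.W n).baseChange ℂ := by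
      rw [← exp_exp_neg hN u, huf]
      exact hexp hN dN hfW
    have hvx' : x - v ∈ (X.W (n - 1)).baseChange ℂ := by
      rw [← hvx]; exact hsub hN dN hvW
    have huf' : f - u ∈ (X.W (n - 1)).baseChange ℂ := by
      rw [← huf]; exact hsub hN.neg dN.neg huW
    have hvu : v - u ∈ (X.W (n - 1)).baseChange ℂ := by
      rw [show v - u = -(x - v) + (f - u) + w by rw [← hfw]; abel]
      exact Submodule.add_mem _ (Submodule.add_mem _ (Submodule.neg_mem _ hvx') huf') hw
    -- Modulo W_(n-1), x agrees with v, of first index at least p, and with u, of second index at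
    -- least n + 1 - p. These bounds are incompatible in weight n, so v has only lower weights.
    suffices hv' : v ∈ (X.W (n - 1)).baseChange ℂ by
      have := Submodule.add_mem _ hvx' hv'
      rwa [sub_add_cancel] at this
    rw [hX.W_eq] at hvW huW hvu ⊢
    have h1 := Submodule.mem_inf.2 ⟨hv, hvW⟩
    have h2 := Submodule.mem_inf.2 ⟨hu, huW⟩
    rw [gspan_inf hA] at h1 h2
    have h3 : v ∈ gspan A (({i | n + 1 - p ≤ i.2} ∩ {i | i.1 + i.2 ≤ n}) ∪
        {i | i.1 + i.2 ≤ n - 1}) := by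
      rw [gspan_union, show v = u + (v - u) by abel]
      exact Submodule.add_mem_sup h2 hvu
    have h4 := Submodule.mem_inf.2 ⟨h1, h3⟩
    rw [gspan_inf hA] at h4
    refine gspan_mono A ?_ h4
    rintro i ⟨⟨h5, h6⟩, ⟨h7, h8⟩ | h7⟩
    · simp only [Set.mem_ofPred_eq] at h5 h6 h7 ⊢; omega
    · exact h7

theorem IsCanonicalPair.isMHS (hX : X.IsCanonicalPair h δ) : X.IsMHS :=
  isMHS_of_opposed hX.isOpposed

end FromPair

/-- Every mixed Hodge structure has a canonical pair. -/
theorem IsMHS.exists_canonicalPair (H : X.IsMHS) :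
    ∃ (h : ℂˣ →* ((ℝ ⊗[ℚ] X.V) ≃ₗ[ℝ] (ℝ ⊗[ℚ] X.V))) (δ : Module.End ℝ (ℝ ⊗[ℚ] X.V)),
      X.IsCanonicalPair h δ := by
  obtain ⟨A, D, hA, hD, hσ, hW, dD, hF⟩ := exists_real_splitting (conjMap X.V) conjMap_conjMap
    (fun n => conjSub_baseChange (X.W n)) H.isOpposed
  have hT : ∀ z : ℂˣ, ∃ T : Module.End ℂ (ℂ ⊗[ℚ] X.V), ∀ i, ∀ x ∈ A i,
      T x = hodgeChar i z • x := fun z => by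
    obtain ⟨T, hT⟩ := exists_linearMap_of_isInternal hA
      (fun i => hodgeChar i z • (LinearMap.id : (ℂ ⊗[ℚ] X.V) →ₗ[ℂ] (ℂ ⊗[ℚ] X.V)))
    exact ⟨T, fun i x hx => hT i x hx⟩
  choose T hT using hT
  -- Conjugation swaps the two indices of the bigrading and of the characters alike, so the action
  -- is real.
  have hTconj : ∀ z x, conjMap X.V (T z x) = T z (conjMap X.V x) := by
    intro z x
    let T' : Module.End ℂ (ℂ ⊗[ℚ] X.V) := (conjMap X.V).comp ((T z).comp (conjMap X.V))
    have h1 : T' = T z := eq_of_forall_mem hA fun i y hy => by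
      change conjMap X.V (T z (conjMap X.V y)) = _
      rw [hT z _ _ (hσ i y hy), map_smulₛₗ, conjMap_conjMap, hodgeChar_swap, Prod.swap_swap,
        hT z i y hy]
    have h2 := LinearMap.congr_fun h1 (conjMap X.V x)
    change conjMap X.V (T z (conjMap X.V (conjMap X.V x))) = _ at h2
    rwa [conjMap_conjMap] at h2
  choose T₀ hT₀ using fun z => exists_extendEnd_eq (hTconj z)
  obtain ⟨δ, hδ⟩ := exists_extendEnd_eq hD
  let ρ : ℂˣ →* Module.End ℝ (ℝ ⊗[ℚ] X.V) :=
    { toFun := T₀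
      map_one' := extendEnd_injective realToComplex_injective <| by
        rw [hT₀, extendEnd_one]
        refine eq_of_forall_mem hA fun i x hx => ?_
        rw [hT 1 i x hx, hodgeChar_one, one_smul]; rfl
      map_mul' := fun z w => extendEnd_injective realToComplex_injective <| by
        rw [extendEnd_mul, hT₀, hT₀, hT₀]
        refine eq_of_forall_mem hA fun i x hx => ?_
        rw [Module.End.mul_apply, hT w i x hx, map_smul, hT z i x hx, hT (z * w) i x hx,
          smul_smul, hodgeChar_mul, mul_comm] }
  refine ⟨toAut ρ, δ, (isCanonicalPair_of (A := A) hA.submodule_iSup_eq_top ?_ hW ?_ ?_).1⟩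
  · intro i x hx z
    have : actC (toAut ρ) z = T z := hT₀ z
    rw [this, hT z i x hx]
  · rw [hδ]; exact dD
  · rw [hδ]; exact fun _ => hF

end HodgeTriple

/-! ### Operations on endomorphisms after extension of scalars -/

section Operations

variable {R S : Type} [CommRing R] [Algebra ℚ R] [CommRing S] [Algebra ℚ S]
  {V V' : Type} [AddCommGroup V] [Module ℚ V] [AddCommGroup V'] [Module ℚ V']

/-- The endomorphism of the extension of scalars of a product which is given by endomorphisms
of the extensions of scalars of the factors. -/
def prodAct (A : Module.End R (R ⊗[ℚ] V)) (B : Module.End R (R ⊗[ℚ] V')) :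
    Module.End R (R ⊗[ℚ] (V × V')) :=
  (LinearMap.inl ℚ V V').baseChange R ∘ₗ A ∘ₗ (LinearMap.fst ℚ V V').baseChange R +
    (LinearMap.inr ℚ V V').baseChange R ∘ₗ B ∘ₗ (LinearMap.snd ℚ V V').baseChange R

theorem fst_inl_baseChange (x : R ⊗[ℚ] V) : (LinearMap.fst ℚ V V').baseChange R
    ((LinearMap.inl ℚ V V').baseChange R x) = x := by
  rw [← LinearMap.comp_apply, ← LinearMap.baseChange_comp]; simp

theorem snd_inr_baseChange (x : R ⊗[ℚ] V') : (LinearMap.snd ℚ V V').baseChange R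
    ((LinearMap.inr ℚ V V').baseChange R x) = x := by
  rw [← LinearMap.comp_apply, ← LinearMap.baseChange_comp]; simp

theorem fst_inr_baseChange (x : R ⊗[ℚ] V') : (LinearMap.fst ℚ V V').baseChange R
    ((LinearMap.inr ℚ V V').baseChange R x) = 0 := by
  rw [← LinearMap.comp_apply, ← LinearMap.baseChange_comp]; simp

theorem snd_inl_baseChange (x : R ⊗[ℚ] V) : (LinearMap.snd ℚ V V').baseChange R
    ((LinearMap.inl ℚ V V').baseChange R x) = 0 := by
  rw [← LinearMap.comp_apply, ← LinearMap.baseChange_comp]; simp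

theorem inl_fst_add_inr_snd (x : R ⊗[ℚ] (V × V')) :
    (LinearMap.inl ℚ V V').baseChange R ((LinearMap.fst ℚ V V').baseChange R x) +
      (LinearMap.inr ℚ V V').baseChange R ((LinearMap.snd ℚ V V').baseChange R x) = x := by
  simp only [← LinearMap.comp_apply, ← LinearMap.baseChange_comp, ← LinearMap.add_apply,
    ← LinearMap.baseChange_add]
  have : LinearMap.inl ℚ V V' ∘ₗ LinearMap.fst ℚ V V' + LinearMap.inr ℚ V V' ∘ₗ
      LinearMap.snd ℚ V V' = LinearMap.id := by ext <;> simp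
  rw [this]
  simp

theorem prod_ext {x y : R ⊗[ℚ] (V × V')}
    (h₁ : (LinearMap.fst ℚ V V').baseChange R x = (LinearMap.fst ℚ V V').baseChange R y)
    (h₂ : (LinearMap.snd ℚ V V').baseChange R x = (LinearMap.snd ℚ V V').baseChange R y) :
    x = y := by
  rw [← inl_fst_add_inr_snd x, h₁, h₂, inl_fst_add_inr_snd]

theorem fst_prodAct (A : Module.End R (R ⊗[ℚ] V)) (B : Module.End R (R ⊗[ℚ] V'))
    (x : R ⊗[ℚ] (V × V')) : (LinearMap.fst ℚ V V').baseChange R (prodAct A B x) =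
      A ((LinearMap.fst ℚ V V').baseChange R x) := by
  simp only [prodAct, LinearMap.add_apply, LinearMap.comp_apply, map_add, fst_inl_baseChange,
    fst_inr_baseChange, add_zero]

theorem snd_prodAct (A : Module.End R (R ⊗[ℚ] V)) (B : Module.End R (R ⊗[ℚ] V'))
    (x : R ⊗[ℚ] (V × V')) : (LinearMap.snd ℚ V V').baseChange R (prodAct A B x) =
      B ((LinearMap.snd ℚ V V').baseChange R x) := by
  simp only [prodAct, LinearMap.add_apply, LinearMap.comp_apply, map_add, snd_inl_baseChange,
    snd_inr_baseChange, zero_add]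

theorem prodAct_one : prodAct (1 : Module.End R (R ⊗[ℚ] V)) (1 : Module.End R (R ⊗[ℚ] V')) = 1 :=
  LinearMap.ext fun x => prod_ext (by rw [fst_prodAct]; rfl) (by rw [snd_prodAct]; rfl)

theorem prodAct_mul (A A' : Module.End R (R ⊗[ℚ] V)) (B B' : Module.End R (R ⊗[ℚ] V')) :
    prodAct (A * A') (B * B') = prodAct A B * prodAct A' B' :=
  LinearMap.ext fun x => prod_ext
    (by simp only [Module.End.mul_apply, fst_prodAct])
    (by simp only [Module.End.mul_apply, snd_prodAct])

theorem extendEnd_prodAct (f : R →ₐ[ℚ] S) (A : Module.End R (R ⊗[ℚ] V))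
    (B : Module.End R (R ⊗[ℚ] V')) :
    extendEnd f (prodAct A B) = prodAct (extendEnd f A) (extendEnd f B) :=
  extendEnd_eq f fun x => prod_ext
    (by simp only [fst_prodAct, baseChange_scalarMap, extendEnd_scalarMap])
    (by simp only [snd_prodAct, baseChange_scalarMap, extendEnd_scalarMap])

variable (R V V') in
/-- The product `(R ⊗ V) × (R ⊗ V') → R ⊗ (V ⊗ V')`. -/
def tmulR : (R ⊗[ℚ] V) →ₗ[R] (R ⊗[ℚ] V') →ₗ[R] (R ⊗[ℚ] (V ⊗[ℚ] V')) :=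
  (TensorProduct.mk R (R ⊗[ℚ] V) (R ⊗[ℚ] V')).compr₂
    (TensorProduct.AlgebraTensorModule.distribBaseChange ℚ R V V').symm.toLinearMap

theorem tmulR_tmul (r s : R) (v : V) (w : V') :
    tmulR R V V' (r ⊗ₜ v) (s ⊗ₜ w) = (r * s) ⊗ₜ (v ⊗ₜ w) := by
  simp [tmulR]

theorem distrib_tmulR (x : R ⊗[ℚ] V) (y : R ⊗[ℚ] V') :
    TensorProduct.AlgebraTensorModule.distribBaseChange ℚ R V V' (tmulR R V V' x y) = x ⊗ₜ y := by
  simp [tmulR]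

theorem tmulR_ext {M : Type*} [AddCommGroup M] [Module R M]
    {T T' : (R ⊗[ℚ] (V ⊗[ℚ] V')) →ₗ[R] M}
    (h : ∀ x y, T (tmulR R V V' x y) = T' (tmulR R V V' x y)) : T = T' := by
  have : T ∘ₗ (TensorProduct.AlgebraTensorModule.distribBaseChange ℚ R V V').symm.toLinearMap =
      T' ∘ₗ (TensorProduct.AlgebraTensorModule.distribBaseChange ℚ R V V').symm.toLinearMap :=
    TensorProduct.ext' fun x y => h x y
  refine LinearMap.ext fun x => ?_
  have h2 := LinearMap.congr_fun this
    (TensorProduct.AlgebraTensorModule.distribBaseChange ℚ R V V' x)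
  simpa only [LinearMap.comp_apply, LinearEquiv.coe_coe, LinearEquiv.symm_apply_apply] using h2

theorem map₂_tmulR_top : Submodule.map₂ (tmulR R V V') ⊤ ⊤ = ⊤ := by
  rw [tmulR, ← Submodule.map_map₂, TensorProduct.map₂_mk_top_top_eq_top, Submodule.map_top]
  exact LinearEquiv.range _

/-- The tensor product of two endomorphisms. -/
def tensorAct (A : Module.End R (R ⊗[ℚ] V)) (B : Module.End R (R ⊗[ℚ] V')) :
    Module.End R (R ⊗[ℚ] (V ⊗[ℚ] V')) :=
  (TensorProduct.AlgebraTensorModule.distribBaseChange ℚ R V V').symm.toLinearMap ∘ₗ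
    TensorProduct.map A B ∘ₗ
      (TensorProduct.AlgebraTensorModule.distribBaseChange ℚ R V V').toLinearMap

theorem distrib_tensorAct (A : Module.End R (R ⊗[ℚ] V)) (B : Module.End R (R ⊗[ℚ] V'))
    (x : R ⊗[ℚ] (V ⊗[ℚ] V')) :
    TensorProduct.AlgebraTensorModule.distribBaseChange ℚ R V V' (tensorAct A B x) =
      TensorProduct.map A B (TensorProduct.AlgebraTensorModule.distribBaseChange ℚ R V V' x) := by
  simp [tensorAct]

theorem tensorAct_tmulR (A : Module.End R (R ⊗[ℚ] V)) (B : Module.End R (R ⊗[ℚ] V'))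
    (x : R ⊗[ℚ] V) (y : R ⊗[ℚ] V') :
    tensorAct A B (tmulR R V V' x y) = tmulR R V V' (A x) (B y) := by
  apply (TensorProduct.AlgebraTensorModule.distribBaseChange ℚ R V V').injective
  rw [distrib_tensorAct, distrib_tmulR, distrib_tmulR, TensorProduct.map_tmul]

theorem tensorAct_one :
    tensorAct (1 : Module.End R (R ⊗[ℚ] V)) (1 : Module.End R (R ⊗[ℚ] V')) = 1 :=
  tmulR_ext fun x y => tensorAct_tmulR _ _ x y

theorem tensorAct_mul (A A' : Module.End R (R ⊗[ℚ] V)) (B B' : Module.End R (R ⊗[ℚ] V')) :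
    tensorAct (A * A') (B * B') = tensorAct A B * tensorAct A' B' :=
  tmulR_ext fun x y => by simp only [Module.End.mul_apply, tensorAct_tmulR]

theorem scalarMap_tmulR (f : R →ₐ[ℚ] S) (x : R ⊗[ℚ] V) (y : R ⊗[ℚ] V') :
    scalarMap f (V ⊗[ℚ] V') (tmulR R V V' x y) =
      tmulR S V V' (scalarMap f V x) (scalarMap f V' y) := by
  induction x with
  | zero => simp
  | add x x' hx hx' => simp only [map_add, LinearMap.add_apply, hx, hx']
  | tmul r v =>
    induction y with
    | zero => simp
    | add x x' hx hx' => simp only [map_add, hx, hx']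
    | tmul s w => simp only [tmulR_tmul, scalarMap_tmul, map_mul]

theorem extendEnd_tensorAct (f : R →ₐ[ℚ] S) (A : Module.End R (R ⊗[ℚ] V))
    (B : Module.End R (R ⊗[ℚ] V')) :
    extendEnd f (tensorAct A B) = tensorAct (extendEnd f A) (extendEnd f B) := by
  refine tensor_ext fun t => ?_
  induction t with
  | zero => simp
  | add x y hx hy => simp only [TensorProduct.tmul_add, map_add, hx, hy]
  | tmul v w =>
    have h1 : (1 : S) ⊗ₜ[ℚ] (v ⊗ₜ[ℚ] w) = scalarMap f (V ⊗[ℚ] V') (tmulR R V V' (1 ⊗ₜ v) (1 ⊗ₜ w)) := by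
      rw [tmulR_tmul, scalarMap_tmul, mul_one, map_one]
    rw [h1, extendEnd_scalarMap, tensorAct_tmulR, scalarMap_tmulR, scalarMap_tmulR,
      tensorAct_tmulR, extendEnd_scalarMap, extendEnd_scalarMap]

variable (R V) in
/-- The pairing between `R ⊗ V^∨` and `R ⊗ V`. -/
def pairingR : (R ⊗[ℚ] Module.Dual ℚ V) →ₗ[R] Module.Dual R (R ⊗[ℚ] V) :=
  LinearMap.liftBaseChange R (Module.Dual.baseChange R)

theorem pairingR_tmul (r s : R) (φ : Module.Dual ℚ V) (v : V) :
    pairingR R V (r ⊗ₜ φ) (s ⊗ₜ v) = r * s * algebraMap ℚ R (φ v) := by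
  simp [pairingR, Algebra.smul_def]
  ring

theorem pairingR_one_tmul (φ : Module.Dual ℚ V) (x : R ⊗[ℚ] V) :
    pairingR R V (1 ⊗ₜ φ) x = Module.Dual.baseChange R φ x := by
  simp [pairingR]

theorem scalarMap_pairingR (f : R →ₐ[ℚ] S) (ξ : R ⊗[ℚ] Module.Dual ℚ V) (x : R ⊗[ℚ] V) :
    pairingR S V (scalarMap f _ ξ) (scalarMap f V x) = f (pairingR R V ξ x) := by
  induction ξ with
  | zero => simp
  | add x x' hx hx' => simp only [map_add, LinearMap.add_apply, hx, hx']
  | tmul r φ =>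
    induction x with
    | zero => simp
    | add x x' hx hx' => simp only [map_add, hx, hx']
    | tmul s w =>
      simp only [pairingR_tmul, scalarMap_tmul, map_mul, AlgHom.commutes]

/-- Finite dimension makes dualization commute with extension of scalars; this defines transposes on
the extension of the dual. -/
theorem pairingR_bijective [FiniteDimensional ℚ V] : Function.Bijective (pairingR R V) := by
  have ibc := TensorProduct.isBaseChange ℚ V R
  have : pairingR R V = ibc.toDualBaseChange.toLinearMap := by
    refine tensor_ext fun φ => tensor_ext fun v => ?_
    have := IsBaseChange.toDualBaseChange_tmul ibc 1 φ v
    rw [pairingR_tmul, mul_one]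
    exact this.symm
  rw [this]
  exact ibc.toDualBaseChange.bijective

variable [FiniteDimensional ℚ V]

variable (R V) in
/-- The extension of scalars of the dual is the dual of the extension of scalars. -/
def dualEquiv : (R ⊗[ℚ] Module.Dual ℚ V) ≃ₗ[R] Module.Dual R (R ⊗[ℚ] V) :=
  LinearEquiv.ofBijective (pairingR R V) pairingR_bijective

/-- The transpose of an endomorphism. -/
def dualAct (A : Module.End R (R ⊗[ℚ] V)) : Module.End R (R ⊗[ℚ] Module.Dual ℚ V) :=
  (dualEquiv R V).symm.toLinearMap ∘ₗ LinearMap.dualMap A ∘ₗ (dualEquiv R V).toLinearMap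

theorem pairingR_dualAct (A : Module.End R (R ⊗[ℚ] V)) (ξ : R ⊗[ℚ] Module.Dual ℚ V)
    (x : R ⊗[ℚ] V) : pairingR R V (dualAct A ξ) x = pairingR R V ξ (A x) := by
  have : pairingR R V (dualAct A ξ) = LinearMap.dualMap A (pairingR R V ξ) :=
    (dualEquiv R V).apply_symm_apply _
  rw [this]
  rfl

theorem dual_ext {ξ η : R ⊗[ℚ] Module.Dual ℚ V} (h : ∀ x, pairingR R V ξ x = pairingR R V η x) :
    ξ = η := pairingR_bijective.1 (LinearMap.ext h)

theorem dualAct_one : dualAct (1 : Module.End R (R ⊗[ℚ] V)) = 1 :=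
  LinearMap.ext fun ξ => dual_ext fun x => by rw [pairingR_dualAct]; rfl

theorem dualAct_mul (A B : Module.End R (R ⊗[ℚ] V)) :
    dualAct (A * B) = dualAct B * dualAct A :=
  LinearMap.ext fun ξ => dual_ext fun x => by
    rw [pairingR_dualAct, Module.End.mul_apply, Module.End.mul_apply, pairingR_dualAct,
      pairingR_dualAct]

theorem dualAct_add (A B : Module.End R (R ⊗[ℚ] V)) :
    dualAct (A + B) = dualAct A + dualAct B :=
  LinearMap.ext fun ξ => dual_ext fun x => by
    rw [pairingR_dualAct, LinearMap.add_apply, LinearMap.add_apply, map_add, map_add,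
      LinearMap.add_apply, pairingR_dualAct, pairingR_dualAct]

theorem dualAct_smul (c : R) (A : Module.End R (R ⊗[ℚ] V)) :
    dualAct (c • A) = c • dualAct A :=
  LinearMap.ext fun ξ => dual_ext fun x => by
    rw [pairingR_dualAct, LinearMap.smul_apply, LinearMap.smul_apply, map_smul, map_smul,
      LinearMap.smul_apply, pairingR_dualAct]

theorem extendEnd_dualAct (f : R →ₐ[ℚ] S) (A : Module.End R (R ⊗[ℚ] V)) :
    extendEnd f (dualAct A) = dualAct (extendEnd f A) := by
  refine extendEnd_eq f fun ξ => ?_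
  apply pairingR_bijective.1
  refine tensor_ext fun v => ?_
  have h1 : (1 : S) ⊗ₜ[ℚ] v = scalarMap f V (1 ⊗ₜ v) := by rw [scalarMap_tmul, map_one]
  rw [h1, pairingR_dualAct, extendEnd_scalarMap, scalarMap_pairingR, scalarMap_pairingR,
    pairingR_dualAct]

end Operations

/-! ### Representations on sums, tensor products and duals -/

section Representations

variable {G R : Type*} [Group G]

/-- Automorphisms, as endomorphisms. -/
def endHom (R M : Type*) [CommRing R] [AddCommGroup M] [Module R M] :
    (M ≃ₗ[R] M) →* Module.End R M where
  toFun g := g.toLinearMap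
  map_one' := rfl
  map_mul' _ _ := rfl

variable {R : Type} [CommRing R] [Algebra ℚ R]
  {V V' : Type} [AddCommGroup V] [Module ℚ V] [AddCommGroup V'] [Module ℚ V']

/-- The direct sum of two representations. -/
def prodRep (ρ : G →* Module.End R (R ⊗[ℚ] V)) (ρ' : G →* Module.End R (R ⊗[ℚ] V')) :
    G →* Module.End R (R ⊗[ℚ] (V × V')) where
  toFun g := prodAct (ρ g) (ρ' g)
  map_one' := by rw [map_one, map_one, prodAct_one]
  map_mul' g g' := by rw [map_mul, map_mul, prodAct_mul]

/-- The tensor product of two representations. -/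
def tensorRep (ρ : G →* Module.End R (R ⊗[ℚ] V)) (ρ' : G →* Module.End R (R ⊗[ℚ] V')) :
    G →* Module.End R (R ⊗[ℚ] (V ⊗[ℚ] V')) where
  toFun g := tensorAct (ρ g) (ρ' g)
  map_one' := by rw [map_one, map_one, tensorAct_one]
  map_mul' g g' := by rw [map_mul, map_mul, tensorAct_mul]

/-- The dual of a representation. -/
def dualRep [FiniteDimensional ℚ V] (ρ : G →* Module.End R (R ⊗[ℚ] V)) :
    G →* Module.End R (R ⊗[ℚ] Module.Dual ℚ V) where
  toFun g := dualAct (ρ g⁻¹)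
  map_one' := by rw [inv_one, map_one, dualAct_one]
  map_mul' g g' := by rw [mul_inv_rev, map_mul, dualAct_mul]

/-- The action of the sum of two infinitesimal actions on a tensor product. -/
def tensorNil (D : Module.End R (R ⊗[ℚ] V)) (D' : Module.End R (R ⊗[ℚ] V')) :
    Module.End R (R ⊗[ℚ] (V ⊗[ℚ] V')) :=
  tensorAct D 1 + tensorAct 1 D'

end Representations

/-! ### Gradings of sums, tensor products and duals -/

section GradedOperations

variable {V V' : Type} [AddCommGroup V] [Module ℚ V] [AddCommGroup V'] [Module ℚ V']
  {A : ℤ × ℤ → Submodule ℂ (ℂ ⊗[ℚ] V)} {A' : ℤ × ℤ → Submodule ℂ (ℂ ⊗[ℚ] V')}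

theorem mem_map_exp_iff {E : Type*} [AddCommGroup E] [Module ℂ E] [Module ℚ (Module.End ℂ E)]
    {N : Module.End ℂ E} (hN : IsNilpotent N) {B : Submodule ℂ E} {x : E} :
    x ∈ B.map (IsNilpotent.exp N) ↔ IsNilpotent.exp (-N) x ∈ B := by
  constructor
  · rintro ⟨y, hy, rfl⟩
    rwa [exp_neg_exp hN]
  · exact fun h => ⟨_, h, exp_exp_neg hN x⟩

theorem exp_apply_comm {E E' : Type*} [AddCommGroup E] [Module ℂ E] [Module ℚ (Module.End ℂ E)]
    [AddCommGroup E'] [Module ℂ E'] [Module ℚ (Module.End ℂ E')]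
    {N : Module.End ℂ E} {N' : Module.End ℂ E'} (g : E →ₗ[ℂ] E') (hN : IsNilpotent N)
    (hN' : IsNilpotent N') (h : ∀ x, N' (g x) = g (N x)) (x : E) :
    IsNilpotent.exp N' (g x) = g (IsNilpotent.exp N x) :=
  LinearMap.congr_fun (exp_comp_eq hN hN' (LinearMap.ext h)) x

/-- The grading of a direct sum. -/
def prodFam (A : ℤ × ℤ → Submodule ℂ (ℂ ⊗[ℚ] V)) (A' : ℤ × ℤ → Submodule ℂ (ℂ ⊗[ℚ] V'))
    (i : ℤ × ℤ) : Submodule ℂ (ℂ ⊗[ℚ] (V × V')) :=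
  (A i).map ((LinearMap.inl ℚ V V').baseChange ℂ) ⊔
    (A' i).map ((LinearMap.inr ℚ V V').baseChange ℂ)

theorem mem_gspan_prodFam {S : Set (ℤ × ℤ)} {x : ℂ ⊗[ℚ] (V × V')} :
    x ∈ gspan (prodFam A A') S ↔ (LinearMap.fst ℚ V V').baseChange ℂ x ∈ gspan A S ∧
      (LinearMap.snd ℚ V V').baseChange ℂ x ∈ gspan A' S := by
  constructor
  · have : gspan (prodFam A A') S ≤ (gspan A S).comap ((LinearMap.fst ℚ V V').baseChange ℂ) ⊓
        (gspan A' S).comap ((LinearMap.snd ℚ V V').baseChange ℂ) := by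
      refine gspan_le.2 fun i hi => sup_le ?_ ?_
      · rintro _ ⟨y, hy, rfl⟩
        refine Submodule.mem_inf.2 ⟨?_, ?_⟩
        · rw [Submodule.mem_comap, fst_inl_baseChange]; exact le_gspan A hi hy
        · rw [Submodule.mem_comap, snd_inl_baseChange]; exact Submodule.zero_mem _
      · rintro _ ⟨y, hy, rfl⟩
        refine Submodule.mem_inf.2 ⟨?_, ?_⟩
        · rw [Submodule.mem_comap, fst_inr_baseChange]; exact Submodule.zero_mem _
        · rw [Submodule.mem_comap, snd_inr_baseChange]; exact le_gspan A' hi hy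
    exact fun hx => this hx
  · rintro ⟨h1, h2⟩
    rw [← inl_fst_add_inr_snd x]
    have h3 : gspan A S ≤ (gspan (prodFam A A') S).comap ((LinearMap.inl ℚ V V').baseChange ℂ) :=
      gspan_le.2 fun i hi y hy =>
        le_gspan (prodFam A A') hi (Submodule.mem_sup_left ⟨y, hy, rfl⟩)
    have h4 : gspan A' S ≤ (gspan (prodFam A A') S).comap ((LinearMap.inr ℚ V V').baseChange ℂ) :=
      gspan_le.2 fun i hi y hy =>
        le_gspan (prodFam A A') hi (Submodule.mem_sup_right ⟨y, hy, rfl⟩)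
    exact Submodule.add_mem _ (h3 h1) (h4 h2)

theorem mem_prodFam {i : ℤ × ℤ} {x : ℂ ⊗[ℚ] (V × V')} :
    x ∈ prodFam A A' i ↔ (LinearMap.fst ℚ V V').baseChange ℂ x ∈ A i ∧
      (LinearMap.snd ℚ V V').baseChange ℂ x ∈ A' i := by
  rw [← gspan_singleton (prodFam A A') i, mem_gspan_prodFam, gspan_singleton, gspan_singleton]

theorem iSup_prodFam (hA : ⨆ i, A i = ⊤) (hA' : ⨆ i, A' i = ⊤) : ⨆ i, prodFam A A' i = ⊤ := by
  rw [← gspan_univ, eq_top_iff]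
  intro x _
  rw [mem_gspan_prodFam, gspan_univ, gspan_univ, hA, hA']
  exact ⟨trivial, trivial⟩

theorem mem_baseChange_prod {R : Type} [CommRing R] [Algebra ℚ R] {W : Submodule ℚ V}
    {W' : Submodule ℚ V'} {x : R ⊗[ℚ] (V × V')} :
    x ∈ (W.prod W').baseChange R ↔ (LinearMap.fst ℚ V V').baseChange R x ∈ W.baseChange R ∧
      (LinearMap.snd ℚ V V').baseChange R x ∈ W'.baseChange R := by
  constructor
  · exact fun h => ⟨map_baseChange_le (by rintro _ ⟨y, hy, rfl⟩; exact hy.1) h,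
      map_baseChange_le (by rintro _ ⟨y, hy, rfl⟩; exact hy.2) h⟩
  · rintro ⟨h1, h2⟩
    rw [← inl_fst_add_inr_snd x]
    exact Submodule.add_mem _
      (map_baseChange_le (by rintro _ ⟨y, hy, rfl⟩; exact ⟨hy, W'.zero_mem⟩) h1)
      (map_baseChange_le (by rintro _ ⟨y, hy, rfl⟩; exact ⟨W.zero_mem, hy⟩) h2)

/-- The grading of a tensor product. -/
def tensorFam (A : ℤ × ℤ → Submodule ℂ (ℂ ⊗[ℚ] V)) (A' : ℤ × ℤ → Submodule ℂ (ℂ ⊗[ℚ] V'))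
    (k : ℤ × ℤ) : Submodule ℂ (ℂ ⊗[ℚ] (V ⊗[ℚ] V')) :=
  ⨆ i : ℤ × ℤ, Submodule.map₂ (tmulR ℂ V V') (A i) (A' (k - i))

theorem tmulR_mem_tensorFam {i j : ℤ × ℤ} {x : ℂ ⊗[ℚ] V} {y : ℂ ⊗[ℚ] V'} (hx : x ∈ A i)
    (hy : y ∈ A' j) : tmulR ℂ V V' x y ∈ tensorFam A A' (i + j) :=
  Submodule.mem_iSup_of_mem i (Submodule.apply_mem_map₂ _ hx (by rwa [add_sub_cancel_left]))

theorem tmulR_mem_gspan {S S' T : Set (ℤ × ℤ)} (h : ∀ i ∈ S, ∀ j ∈ S', i + j ∈ T)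
    {x : ℂ ⊗[ℚ] V} {y : ℂ ⊗[ℚ] V'} (hx : x ∈ gspan A S) (hy : y ∈ gspan A' S') :
    tmulR ℂ V V' x y ∈ gspan (tensorFam A A') T := by
  have h1 : ∀ i ∈ S, ∀ x ∈ A i, ∀ y ∈ gspan A' S',
      tmulR ℂ V V' x y ∈ gspan (tensorFam A A') T := by
    intro i hi x hx y hy
    have : gspan A' S' ≤ (gspan (tensorFam A A') T).comap (tmulR ℂ V V' x) :=
      gspan_le.2 fun j hj y hy => le_gspan (tensorFam A A') (h i hi j hj) (tmulR_mem_tensorFam hx hy)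
    exact this hy
  have : gspan A S ≤ (gspan (tensorFam A A') T).comap ((tmulR ℂ V V').flip y) :=
    gspan_le.2 fun i hi x hx => h1 i hi x hx y hy
  exact this hx

/-- The index r is a cutoff distributed between the two factors: a weight for W, a Hodge index for
F. The two hypotheses say that the rectangles S r × S' r lie in, and cover, the pairs with sum in T.
-/
theorem gspan_tensorFam {S S' : ℤ → Set (ℤ × ℤ)} {T : Set (ℤ × ℤ)}
    (h₁ : ∀ r, ∀ i ∈ S r, ∀ j ∈ S' r, i + j ∈ T)
    (h₂ : ∀ i j, i + j ∈ T → ∃ r, i ∈ S r ∧ j ∈ S' r) :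
    gspan (tensorFam A A') T =
      ⨆ r, Submodule.map₂ (tmulR ℂ V V') (gspan A (S r)) (gspan A' (S' r)) := by
  apply le_antisymm
  · refine gspan_le.2 fun k hk => iSup_le fun i => ?_
    obtain ⟨r, hr, hr'⟩ := h₂ i (k - i) (by rwa [add_sub_cancel])
    exact (Submodule.map₂_le_map₂ (le_gspan A hr) (le_gspan A' hr')).trans (le_iSup (fun r =>
      Submodule.map₂ (tmulR ℂ V V') (gspan A (S r)) (gspan A' (S' r))) r)
  · exact iSup_le fun r => Submodule.map₂_le.2 fun x hx y hy => tmulR_mem_gspan (h₁ r) hx hy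

theorem iSup_tensorFam (hA : ⨆ i, A i = ⊤) (hA' : ⨆ i, A' i = ⊤) :
    ⨆ i, tensorFam A A' i = ⊤ := by
  have := gspan_tensorFam (A := A) (A' := A') (S := fun _ => Set.univ) (S' := fun _ => Set.univ)
    (T := Set.univ) (fun _ _ _ _ _ => trivial) (fun _ _ _ => ⟨0, trivial, trivial⟩)
  rw [← gspan_univ, this, gspan_univ, gspan_univ, hA, hA', map₂_tmulR_top, iSup_const]

theorem tensorFam_le {k : ℤ × ℤ} {B : Submodule ℂ (ℂ ⊗[ℚ] (V ⊗[ℚ] V'))}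
    (h : ∀ i j, i + j = k → ∀ x ∈ A i, ∀ y ∈ A' j, tmulR ℂ V V' x y ∈ B) :
    tensorFam A A' k ≤ B :=
  iSup_le fun i => Submodule.map₂_le.2 fun x hx y hy => h i (k - i) (add_sub_cancel _ _) x hx y hy

theorem baseChange_tensor {ι : Type*} {W : ι → Submodule ℚ V} {W' : ι → Submodule ℚ V'} :
    (⨆ i, Submodule.map₂ (TensorProduct.mk ℚ V V') (W i) (W' i)).baseChange ℂ =
      ⨆ i, Submodule.map₂ (tmulR ℂ V V') ((W i).baseChange ℂ) ((W' i).baseChange ℂ) := by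
  apply le_antisymm
  · rw [Submodule.baseChange_eq_span, Submodule.span_le]
    rintro _ ⟨t, ht, rfl⟩
    set B := ⨆ i, Submodule.map₂ (tmulR ℂ V V') ((W i).baseChange ℂ) ((W' i).baseChange ℂ)
    have : (⨆ i, Submodule.map₂ (TensorProduct.mk ℚ V V') (W i) (W' i)) ≤
        (B.restrictScalars ℚ).comap (TensorProduct.mk ℚ ℂ (V ⊗[ℚ] V') 1) := by
      refine iSup_le fun i => Submodule.map₂_le.2 fun v hv w hw => ?_
      have h1 : (1 : ℂ) ⊗ₜ[ℚ] (v ⊗ₜ[ℚ] w) = tmulR ℂ V V' (1 ⊗ₜ v) (1 ⊗ₜ w) := by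
        rw [tmulR_tmul, mul_one]
      change (1 : ℂ) ⊗ₜ[ℚ] (v ⊗ₜ[ℚ] w) ∈ B
      rw [h1]
      exact Submodule.mem_iSup_of_mem i (Submodule.apply_mem_map₂ _
        (Submodule.tmul_mem_baseChange_of_mem 1 hv) (Submodule.tmul_mem_baseChange_of_mem 1 hw))
    exact this ht
  · refine iSup_le fun i => ?_
    rw [Submodule.baseChange_eq_span, Submodule.baseChange_eq_span, Submodule.map₂_span_span,
      Submodule.span_le]
    rintro _ ⟨_, ⟨v, hv, rfl⟩, _, ⟨w, hw, rfl⟩, rfl⟩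
    have h1 : (1 : ℂ) ⊗ₜ[ℚ] (v ⊗ₜ[ℚ] w) = tmulR ℂ V V' (1 ⊗ₜ v) (1 ⊗ₜ w) := by
      rw [tmulR_tmul, mul_one]
    change tmulR ℂ V V' (1 ⊗ₜ v) (1 ⊗ₜ w) ∈ _
    rw [← h1]
    exact Submodule.tmul_mem_baseChange_of_mem 1
      (Submodule.mem_iSup_of_mem i (Submodule.apply_mem_map₂ _ hv hw))

theorem tensorAct_pow {R : Type} [CommRing R] [Algebra ℚ R] (A : Module.End R (R ⊗[ℚ] V))
    (B : Module.End R (R ⊗[ℚ] V')) (n : ℕ) : tensorAct A B ^ n = tensorAct (A ^ n) (B ^ n) := by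
  induction n with
  | zero => rw [pow_zero, pow_zero, pow_zero, tensorAct_one]
  | succ n ih => rw [pow_succ, ih, pow_succ, pow_succ, tensorAct_mul]

/-- The summands commute, so the exponential is a product. Each factor is computed by fixing the
other tensor factor, along which the map to the tensor product intertwines the nilpotents. -/
theorem exp_tensor {N : Module.End ℂ (ℂ ⊗[ℚ] V)} {N' : Module.End ℂ (ℂ ⊗[ℚ] V')}
    (hN : IsNilpotent N) (hN' : IsNilpotent N') :
    IsNilpotent.exp (tensorAct N 1 + tensorAct 1 N') =
      tensorAct (IsNilpotent.exp N) (IsNilpotent.exp N') := by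
  have zl : ∀ B : Module.End ℂ (ℂ ⊗[ℚ] V'), tensorAct (0 : Module.End ℂ (ℂ ⊗[ℚ] V)) B = 0 :=
    fun B => tmulR_ext fun x y => by
      rw [tensorAct_tmulR, LinearMap.zero_apply, map_zero, LinearMap.zero_apply,
        LinearMap.zero_apply]
  have zr : ∀ B : Module.End ℂ (ℂ ⊗[ℚ] V), tensorAct B (0 : Module.End ℂ (ℂ ⊗[ℚ] V')) = 0 :=
    fun B => tmulR_ext fun x y => by
      rw [tensorAct_tmulR, LinearMap.zero_apply, map_zero, LinearMap.zero_apply]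
  have h1 : IsNilpotent (tensorAct N (1 : Module.End ℂ (ℂ ⊗[ℚ] V'))) := by
    obtain ⟨n, hn⟩ := hN
    exact ⟨n, by rw [tensorAct_pow, hn, zl]⟩
  have h2 : IsNilpotent (tensorAct (1 : Module.End ℂ (ℂ ⊗[ℚ] V)) N') := by
    obtain ⟨n, hn⟩ := hN'
    exact ⟨n, by rw [tensorAct_pow, hn, zr]⟩
  have hc : Commute (tensorAct N (1 : Module.End ℂ (ℂ ⊗[ℚ] V')))
      (tensorAct (1 : Module.End ℂ (ℂ ⊗[ℚ] V)) N') := by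
    rw [Commute, SemiconjBy, ← tensorAct_mul, ← tensorAct_mul, mul_one, one_mul, one_mul, mul_one]
  rw [IsNilpotent.exp_add_of_commute hc h1 h2]
  refine tmulR_ext fun x y => ?_
  rw [Module.End.mul_apply, tensorAct_tmulR,
    exp_apply_comm (tmulR ℂ V V' x) hN' h2 (fun y => by rw [tensorAct_tmulR]; rfl)]
  exact exp_apply_comm ((tmulR ℂ V V').flip (IsNilpotent.exp N' y)) hN h1
    (fun x => by rw [LinearMap.flip_apply, tensorAct_tmulR]; rfl) x

end GradedOperations

/-! ### Canonical pairs of the unit, sums and tensor products -/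

namespace HodgeTriple

theorem isCanonicalPair_mk {V : Type} [AddCommGroup V] [Module ℚ V] [FiniteDimensional ℚ V]
    {W : ℤ → Submodule ℚ V} {F : ℤ → Submodule ℂ (ℂ ⊗[ℚ] V)}
    {h : ℂˣ →* ((ℝ ⊗[ℚ] V) ≃ₗ[ℝ] (ℝ ⊗[ℚ] V))} {δ : Module.End ℝ (ℝ ⊗[ℚ] V)}
    (A : ℤ × ℤ → Submodule ℂ (ℂ ⊗[ℚ] V)) (hA : ⨆ i, A i = ⊤)
    (hact : ∀ i, ∀ x ∈ A i, ∀ z, actC h z x = hodgeChar i z • x)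
    (hW : ∀ k, (W k).baseChange ℂ = gspan A {i | i.1 + i.2 ≤ k})
    (hδ : HasDeg A A negDeg (extendEnd realToComplex δ))
    (hF : IsNilpotent (Complex.I • extendEnd realToComplex δ) → ∀ p,
      F p = (gspan A {i | p ≤ i.1}).map
        (IsNilpotent.exp (Complex.I • extendEnd realToComplex δ))) :
    (HodgeTriple.mk V W F).IsCanonicalPair h δ :=
  (isCanonicalPair_of (X := HodgeTriple.mk V W F) hA hact hW hδ hF).1

/-- The canonical pair of the unit object. -/
theorem isCanonicalPair_unit : unit.IsCanonicalPair 1 0 := by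
  set A : ℤ × ℤ → Submodule ℂ (ℂ ⊗[ℚ] ℚ) := fun i => if i = 0 then ⊤ else ⊥ with hAdef
  have hA0 : A 0 = ⊤ := if_pos rfl
  have hA1 : ∀ i, i ≠ 0 → A i = ⊥ := fun i hi => if_neg hi
  have htop : ∀ S : Set (ℤ × ℤ), 0 ∈ S → gspan A S = ⊤ := fun S hS =>
    eq_top_iff.2 (hA0 ▸ le_gspan A hS)
  have hbot : ∀ S : Set (ℤ × ℤ), 0 ∉ S → gspan A S = ⊥ := fun S hS =>
    gspan_eq_bot fun i hi => hA1 i fun h => hS (h ▸ hi)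
  have hext : extendEnd realToComplex (0 : Module.End ℝ (ℝ ⊗[ℚ] ℚ)) = 0 :=
    extendEnd_eq _ fun x => by simp
  refine isCanonicalPair_mk (V := ℚ) (h := 1) (δ := 0) A ?_ ?_ ?_ ?_ ?_
  · rw [← gspan_univ]; exact htop _ trivial
  · intro i x hx z
    by_cases hi : i = 0
    · have : actC (1 : ℂˣ →* ((ℝ ⊗[ℚ] ℚ) ≃ₗ[ℝ] (ℝ ⊗[ℚ] ℚ))) z x = x := by
        rw [actC]
        exact LinearMap.congr_fun (extendEnd_one realToComplex) x
      rw [hi, hodgeChar_zero]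
      rw [this, one_smul]
    · rw [hA1 i hi] at hx
      rw [(Submodule.mem_bot ℂ).1 hx, map_zero, smul_zero]
  · intro k
    change Submodule.baseChange ℂ (if 0 ≤ k then (⊤ : Submodule ℚ ℚ) else ⊥) = _
    split_ifs with hk
    · rw [Submodule.baseChange_top, htop]; simpa using hk
    · rw [Submodule.baseChange_bot, hbot]; simpa using hk
  · intro i x _
    rw [hext]
    exact Submodule.zero_mem _
  · intro _ p
    rw [hext, smul_zero, IsNilpotent.exp_zero]
    change (if p ≤ 0 then (⊤ : Submodule ℂ (ℂ ⊗[ℚ] ℚ)) else ⊥) =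
      (gspan A {i | p ≤ i.1}).map LinearMap.id
    rw [Submodule.map_id]
    split_ifs with hk
    · rw [htop]; simpa using hk
    · rw [hbot]; simpa using hk

variable {X Y : HodgeTriple} {h : ℂˣ →* ((ℝ ⊗[ℚ] X.V) ≃ₗ[ℝ] (ℝ ⊗[ℚ] X.V))}
  {δ : Module.End ℝ (ℝ ⊗[ℚ] X.V)}
  {h' : ℂˣ →* ((ℝ ⊗[ℚ] Y.V) ≃ₗ[ℝ] (ℝ ⊗[ℚ] Y.V))} {δ' : Module.End ℝ (ℝ ⊗[ℚ] Y.V)}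

/-- The canonical pair of a direct sum. -/
theorem IsCanonicalPair.prod (hX : X.IsCanonicalPair h δ) (hY : Y.IsCanonicalPair h' δ') :
    (X.prod Y).IsCanonicalPair (toAut (prodRep ((endHom _ _).comp h) ((endHom _ _).comp h')))
      (prodAct δ δ') := by
  refine isCanonicalPair_mk (V := X.V × Y.V) (prodFam (hodgeFam h) (hodgeFam h'))
    (h := toAut (prodRep ((endHom _ _).comp h) ((endHom _ _).comp h'))) (δ := prodAct δ δ')
    (iSup_prodFam hX.internal.submodule_iSup_eq_top hY.internal.submodule_iSup_eq_top)
    ?_ ?_ ?_ ?_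
  · intro i x hx z
    have hx' := mem_prodFam.1 hx
    have h1 : actC (toAut (prodRep ((endHom _ _).comp h) ((endHom _ _).comp h'))) z =
        prodAct (actC h z) (actC h' z) := extendEnd_prodAct realToComplex _ _
    refine (LinearMap.congr_fun h1 x).trans (prod_ext ?_ ?_)
    · rw [fst_prodAct, mem_hodgeFam.1 hx'.1, map_smul]
    · rw [snd_prodAct, mem_hodgeFam.1 hx'.2, map_smul]
  · intro k
    refine Submodule.ext fun x => mem_baseChange_prod.trans ?_
    rw [hX.W_eq, hY.W_eq]
    exact mem_gspan_prodFam.symm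
  · intro i x hx
    have hx' := mem_prodFam.1 hx
    refine mem_gspan_prodFam.2 ?_
    change (LinearMap.fst ℚ X.V Y.V).baseChange ℂ (extendEnd realToComplex (prodAct δ δ') x) ∈ _ ∧
      (LinearMap.snd ℚ X.V Y.V).baseChange ℂ (extendEnd realToComplex (prodAct δ δ') x) ∈ _
    rw [extendEnd_prodAct, fst_prodAct, snd_prodAct]
    exact ⟨hX.hasDeg i _ hx'.1, hY.hasDeg i _ hx'.2⟩
  · intro hN p
    change IsNilpotent (Complex.I • extendEnd realToComplex (prodAct δ δ')) at hN
    change (X.F p).comap ((LinearMap.fst ℚ X.V Y.V).baseChange ℂ) ⊓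
      (Y.F p).comap ((LinearMap.snd ℚ X.V Y.V).baseChange ℂ) =
      (gspan (prodFam (hodgeFam h) (hodgeFam h')) {i | p ≤ i.1}).map
        (IsNilpotent.exp (Complex.I • extendEnd realToComplex (prodAct δ δ')))
    refine Submodule.ext fun x => ?_
    rw [mem_map_exp_iff hN, mem_gspan_prodFam, Submodule.mem_inf, Submodule.mem_comap,
      Submodule.mem_comap, hX.F_eq, hY.F_eq, mem_map_exp_iff hX.isNilpotent,
      mem_map_exp_iff hY.isNilpotent]
    rw [exp_apply_comm ((LinearMap.fst ℚ X.V Y.V).baseChange ℂ) hN.neg hX.isNilpotent.neg,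
      exp_apply_comm ((LinearMap.snd ℚ X.V Y.V).baseChange ℂ) hN.neg hY.isNilpotent.neg]
    · intro x
      simp only [LinearMap.neg_apply, LinearMap.smul_apply, map_neg, map_smul, extendEnd_prodAct,
        snd_prodAct]
    · intro x
      simp only [LinearMap.neg_apply, LinearMap.smul_apply, map_neg, map_smul, extendEnd_prodAct,
        fst_prodAct]

/-- The canonical pair of a tensor product. -/
theorem IsCanonicalPair.tensor (hX : X.IsCanonicalPair h δ) (hY : Y.IsCanonicalPair h' δ') :
    (X.tensor Y).IsCanonicalPair
      (toAut (tensorRep ((endHom _ _).comp h) ((endHom _ _).comp h'))) (tensorNil δ δ') := by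
  have hext : extendEnd realToComplex (tensorNil δ δ') =
      tensorAct (extendEnd realToComplex δ) 1 + tensorAct 1 (extendEnd realToComplex δ') := by
    rw [tensorNil, extendEnd_add, extendEnd_tensorAct, extendEnd_tensorAct, extendEnd_one,
      extendEnd_one]
  refine isCanonicalPair_mk (V := X.V ⊗[ℚ] Y.V) (tensorFam (hodgeFam h) (hodgeFam h'))
    (h := toAut (tensorRep ((endHom _ _).comp h) ((endHom _ _).comp h')))
    (δ := tensorNil δ δ')
    (iSup_tensorFam hX.internal.submodule_iSup_eq_top hY.internal.submodule_iSup_eq_top)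
    ?_ ?_ ?_ ?_
  · intro i x hx z
    have h1 : actC (toAut (tensorRep ((endHom _ _).comp h) ((endHom _ _).comp h'))) z =
        tensorAct (actC h z) (actC h' z) := extendEnd_tensorAct realToComplex _ _
    refine (LinearMap.congr_fun h1 x).trans ?_
    have h2 : tensorFam (hodgeFam h) (hodgeFam h') i ≤
        charSpace (fun z => tensorAct (actC h z) (actC h' z)) i :=
      tensorFam_le fun a b hab x hx y hy => mem_charSpace.2 fun z => by
        rw [tensorAct_tmulR, mem_hodgeFam.1 hx, mem_hodgeFam.1 hy, ← hab, hodgeChar_add, map_smul,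
          map_smul, LinearMap.smul_apply, smul_smul, mul_comm]
    exact mem_charSpace.1 (h2 hx) z
  · intro k
    refine (baseChange_tensor (W := X.W) (W' := fun i => Y.W (k - i))).trans ?_
    simp only [hX.W_eq, hY.W_eq]
    -- Each pair of indices is covered by taking r to be the weight of the first factor; for the
    -- Hodge filtration below it is the first Hodge index.
    refine (gspan_tensorFam (fun r i hi j hj => ?_) fun i j hij => ⟨i.1 + i.2,
      show i.1 + i.2 ≤ i.1 + i.2 from le_rfl, ?_⟩).symm
    · simp only [Set.mem_ofPred_eq, Prod.fst_add, Prod.snd_add] at *; omega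
    · simp only [Set.mem_ofPred_eq, Prod.fst_add, Prod.snd_add] at *; omega
  · intro k x hx
    have h2 : tensorFam (hodgeFam h) (hodgeFam h') k ≤
        (gspan (tensorFam (hodgeFam h) (hodgeFam h')) {j | j - k ∈ negDeg}).comap
          (tensorAct (extendEnd realToComplex δ) 1 + tensorAct 1 (extendEnd realToComplex δ')) := by
      refine tensorFam_le fun a b hab x hx y hy => ?_
      rw [Submodule.mem_comap, LinearMap.add_apply, tensorAct_tmulR, tensorAct_tmulR]
      refine Submodule.add_mem _ ?_ ?_
      · refine tmulR_mem_gspan (S' := {b}) ?_ (hX.hasDeg a x hx) (by rwa [gspan_singleton])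
        rintro i hi j rfl
        rwa [Set.mem_ofPred_eq, ← hab, add_sub_add_right_eq_sub]
      · refine tmulR_mem_gspan (S := {a}) ?_ (by rwa [gspan_singleton]) (hY.hasDeg b y hy)
        rintro i rfl j hj
        rwa [Set.mem_ofPred_eq, ← hab, add_sub_add_left_eq_sub]
    have h3 := h2 hx
    rw [← hext] at h3
    exact h3
  · intro _ p
    have h1 : IsNilpotent.exp (Complex.I • extendEnd realToComplex (tensorNil δ δ')) =
        tensorAct (IsNilpotent.exp (Complex.I • extendEnd realToComplex δ))
          (IsNilpotent.exp (Complex.I • extendEnd realToComplex δ')) := by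
      rw [← exp_tensor hX.isNilpotent hY.isNilpotent, hext, smul_add]
      congr 2
      · exact tmulR_ext fun x y => by
          simp only [LinearMap.smul_apply, tensorAct_tmulR, map_smul]
      · exact tmulR_ext fun x y => by
          simp only [LinearMap.smul_apply, tensorAct_tmulR, map_smul]
    change (⨆ r : ℤ, Submodule.map₂ (TensorProduct.mk ℂ (ℂ ⊗[ℚ] X.V) (ℂ ⊗[ℚ] Y.V))
      (X.F r) (Y.F (p - r))).map
        (TensorProduct.AlgebraTensorModule.distribBaseChange ℚ ℂ X.V Y.V).symm.toLinearMap =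
      (gspan (tensorFam (hodgeFam h) (hodgeFam h')) {i | p ≤ i.1}).map
        (IsNilpotent.exp (Complex.I • extendEnd realToComplex (tensorNil δ δ')))
    rw [h1, gspan_tensorFam (S := fun r => {i | r ≤ i.1}) (S' := fun r => {i | p - r ≤ i.1})
      (fun r i hi j hj => ?_) fun i j hij => ⟨i.1, show i.1 ≤ i.1 from le_rfl, ?_⟩, Submodule.map_iSup,
      Submodule.map_iSup]
    · refine iSup_congr fun r => ?_
      rw [Submodule.map_map₂, Submodule.map_map₂, hX.F_eq, hY.F_eq, Submodule.map₂_map_map]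
      congr 1
      refine LinearMap.ext fun x => LinearMap.ext fun y => ?_
      exact (tensorAct_tmulR _ _ x y).symm
    · simp only [Set.mem_ofPred_eq, Prod.fst_add] at *; omega
    · simp only [Set.mem_ofPred_eq, Prod.fst_add] at *; omega

end HodgeTriple

/-! ### The canonical pair of the dual -/

section DualGrading

variable {V V' : Type} [AddCommGroup V] [Module ℚ V] [AddCommGroup V'] [Module ℚ V']

theorem pairingR_dualMap {R : Type} [CommRing R] [Algebra ℚ R] (f : V →ₗ[ℚ] V')
    (ξ : R ⊗[ℚ] Module.Dual ℚ V') (x : R ⊗[ℚ] V) :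
    pairingR R V (f.dualMap.baseChange R ξ) x = pairingR R V' ξ (f.baseChange R x) := by
  induction ξ with
  | zero => simp
  | add x x' hx hx' => simp only [map_add, LinearMap.add_apply, hx, hx']
  | tmul r φ =>
    induction x with
    | zero => simp
    | add x x' hx hx' => simp only [map_add, hx, hx']
    | tmul s w =>
      rw [LinearMap.baseChange_tmul, LinearMap.baseChange_tmul, pairingR_tmul, pairingR_tmul]
      rfl

/-- The annihilator is the kernel of restriction to U, and forming kernels commutes with flat
extension of scalars. -/
theorem mem_baseChange_dualAnnihilator {R : Type} [CommRing R] [Algebra ℚ R]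
    [FiniteDimensional ℚ V] {U : Submodule ℚ V}
    {ξ : R ⊗[ℚ] Module.Dual ℚ V} : ξ ∈ U.dualAnnihilator.baseChange R ↔
      ∀ x ∈ U.baseChange R, pairingR R V ξ x = 0 := by
  rw [show U.dualAnnihilator = LinearMap.ker U.subtype.dualMap from rfl, ← baseChange_eq_zero_iff]
  constructor
  · intro h x hx
    obtain ⟨y, rfl⟩ := mem_baseChange_iff.1 hx
    rw [← pairingR_dualMap, h, map_zero, LinearMap.zero_apply]
  · intro h
    refine dual_ext fun y => ?_
    rw [pairingR_dualMap, map_zero, LinearMap.zero_apply]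
    exact h _ (mem_baseChange_iff.2 ⟨y, rfl⟩)

variable {A : ℤ × ℤ → Submodule ℂ (ℂ ⊗[ℚ] V)}

theorem pairingR_exp [FiniteDimensional ℚ V] {N : Module.End ℂ (ℂ ⊗[ℚ] V)} (hN : IsNilpotent N)
    (hN' : IsNilpotent (dualAct N)) (ξ : ℂ ⊗[ℚ] Module.Dual ℚ V) (x : ℂ ⊗[ℚ] V) :
    pairingR ℂ V (IsNilpotent.exp (dualAct N) ξ) x = pairingR ℂ V ξ (IsNilpotent.exp N x) := by
  obtain ⟨n₁, hn₁⟩ := hN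
  obtain ⟨n₂, hn₂⟩ := hN'
  have hpow : ∀ m : ℕ, dualAct N ^ m = dualAct (N ^ m) := fun m => by
    induction m with
    | zero => rw [pow_zero, pow_zero, dualAct_one]
    | succ m ih => rw [pow_succ', pow_succ, dualAct_mul, ih]
  rw [IsNilpotent.exp_eq_sum (pow_eq_zero_of_le (le_max_left n₁ n₂) hn₁),
    IsNilpotent.exp_eq_sum (pow_eq_zero_of_le (le_max_right n₁ n₂) hn₂),
    LinearMap.sum_apply, LinearMap.sum_apply, map_sum, map_sum, LinearMap.sum_apply]
  refine Finset.sum_congr rfl fun m _ => ?_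
  rw [rat_smul_end, rat_smul_end, LinearMap.smul_apply, LinearMap.smul_apply, map_smul, map_smul,
    LinearMap.smul_apply, hpow, pairingR_dualAct]

/-- The grading of the dual. -/
def dualFam (A : ℤ × ℤ → Submodule ℂ (ℂ ⊗[ℚ] V)) (k : ℤ × ℤ) :
    Submodule ℂ (ℂ ⊗[ℚ] Module.Dual ℚ V) :=
  (gspan A {-k}ᶜ).dualAnnihilator.comap (pairingR ℂ V)

theorem mem_dualFam {k : ℤ × ℤ} {ξ : ℂ ⊗[ℚ] Module.Dual ℚ V} :
    ξ ∈ dualFam A k ↔ ∀ x ∈ gspan A {-k}ᶜ, pairingR ℂ V ξ x = 0 := by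
  rw [dualFam, Submodule.mem_comap, Submodule.mem_dualAnnihilator]

variable [FiniteDimensional ℚ V]

theorem sum_gproj (hA : DirectSum.IsInternal A) :
    ∑ i ∈ (finite_ne_bot hA).toFinset, gproj hA i = LinearMap.id := by
  refine eq_of_forall_mem hA fun j x hx => ?_
  rw [LinearMap.sum_apply, LinearMap.id_apply]
  by_cases hj : A j = ⊥
  · rw [hj, Submodule.mem_bot] at hx
    simp [hx]
  · rw [Finset.sum_eq_single j, gproj_of_mem hA hx]
    · exact fun i _ hi => gproj_of_mem_ne hA hi.symm hx
    · exact fun h => absurd (by simpa using hj) h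

/-- A functional is the sum of its composites with the graded projections, and the composite with
the projection of index i has degree -i. Both filtrations of the dual are annihilators, so they can
be compared through this criterion. -/
theorem mem_gspan_dualFam (hA : DirectSum.IsInternal A) {T : Set (ℤ × ℤ)}
    {ξ : ℂ ⊗[ℚ] Module.Dual ℚ V} :
    ξ ∈ gspan (dualFam A) T ↔ ∀ x ∈ gspan A {i | -i ∉ T}, pairingR ℂ V ξ x = 0 := by
  constructor
  · have : gspan (dualFam A) T ≤
        (gspan A {i | -i ∉ T}).dualAnnihilator.comap (pairingR ℂ V) := by
      refine gspan_le.2 fun k hk ξ hξ => ?_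
      rw [Submodule.mem_comap, Submodule.mem_dualAnnihilator]
      intro x hx
      refine mem_dualFam.1 hξ x (gspan_mono A ?_ hx)
      rintro i (hi : -i ∉ T) (rfl : i = -k)
      exact hi (by rwa [neg_neg])
    intro hξ x hx
    have h1 := this hξ
    rw [Submodule.mem_comap, Submodule.mem_dualAnnihilator] at h1
    exact h1 x hx
  · intro h
    have h1 : ξ = ∑ i ∈ (finite_ne_bot hA).toFinset, dualAct (gproj hA i) ξ := by
      refine dual_ext fun x => ?_
      rw [map_sum, LinearMap.sum_apply]
      simp only [pairingR_dualAct]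
      rw [← map_sum, ← LinearMap.sum_apply, sum_gproj, LinearMap.id_apply]
    rw [h1]
    refine Submodule.sum_mem _ fun i _ => ?_
    by_cases hi : -i ∈ T
    · refine le_gspan (dualFam A) hi (mem_dualFam.2 fun x hx => ?_)
      rw [pairingR_dualAct, (mem_gspan_iff hA).1 hx i (by simp), map_zero]
    · have : dualAct (gproj hA i) ξ = 0 := dual_ext fun x => by
        rw [pairingR_dualAct, map_zero, LinearMap.zero_apply]
        exact h _ (le_gspan A (show i ∈ {i | -i ∉ T} from hi) (gproj_mem hA i x))
      rw [this]
      exact Submodule.zero_mem _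

theorem iSup_dualFam (hA : DirectSum.IsInternal A) : ⨆ i, dualFam A i = ⊤ := by
  rw [← gspan_univ, eq_top_iff]
  intro ξ _
  rw [mem_gspan_dualFam hA]
  intro x hx
  have : {i : ℤ × ℤ | -i ∉ Set.univ} = ∅ := by ext; simp
  rw [this, gspan_empty, Submodule.mem_bot] at hx
  rw [hx, map_zero]

end DualGrading

namespace HodgeTriple

variable {X : HodgeTriple} {h : ℂˣ →* ((ℝ ⊗[ℚ] X.V) ≃ₗ[ℝ] (ℝ ⊗[ℚ] X.V))}
  {δ : Module.End ℝ (ℝ ⊗[ℚ] X.V)}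

/-- The canonical pair of the dual. -/
theorem IsCanonicalPair.dual (hX : X.IsCanonicalPair h δ) :
    X.dual.IsCanonicalPair (toAut (dualRep ((endHom _ _).comp h))) (-dualAct δ) := by
  have hA := hX.internal
  have hext : Complex.I • extendEnd realToComplex (-dualAct δ) =
      -dualAct (Complex.I • extendEnd realToComplex δ) := by
    rw [extendEnd_neg, extendEnd_dualAct, smul_neg, dualAct_smul]
  refine isCanonicalPair_mk (V := Module.Dual ℚ X.V) (dualFam (hodgeFam h))
    (h := toAut (dualRep ((endHom _ _).comp h))) (δ := -dualAct δ) (iSup_dualFam hA) ?_ ?_ ?_ ?_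
  · intro k ξ hξ z
    have h1 : actC (toAut (dualRep ((endHom _ _).comp h))) z = dualAct (actC h z⁻¹) :=
      extendEnd_dualAct realToComplex _
    rw [h1]
    apply pairingR_bijective.1
    refine eq_of_forall_mem hA fun i x hx => ?_
    rw [pairingR_dualAct, mem_hodgeFam.1 hx, map_smul, map_smul, LinearMap.smul_apply]
    by_cases hi : i = -k
    · congr 1
      rw [hi]
      simp [hodgeChar]
    · rw [mem_dualFam.1 hξ x (le_gspan _ hi hx), smul_zero, smul_zero]
  · intro k
    refine Submodule.ext fun ξ => ?_
    rw [mem_baseChange_dualAnnihilator, mem_gspan_dualFam hA, hX.W_eq]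
    -- The shift by one is the integer form of the strict inequality: the negative of the weight
    -- must exceed k. The same happens for F with 1 - p.
    have : {i : ℤ × ℤ | i.1 + i.2 ≤ -k - 1} = {i | -i ∉ {i : ℤ × ℤ | i.1 + i.2 ≤ k}} := by
      ext i
      simp only [Set.mem_ofPred_eq, Prod.fst_neg, Prod.snd_neg]
      omega
    rw [this]
  · intro k ξ hξ
    rw [mem_gspan_dualFam hA]
    intro x hx
    rw [extendEnd_neg, extendEnd_dualAct, LinearMap.neg_apply, map_neg, LinearMap.neg_apply,
      pairingR_dualAct, neg_eq_zero]
    refine mem_dualFam.1 hξ _ (hX.hasDeg.apply_mem ?_ hx)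
    rintro i (hi : ¬ (-i - k ∈ negDeg)) d hd (heq : i + d = -k)
    refine hi ?_
    rwa [show -i - k = d by rw [sub_eq_add_neg, ← heq]; abel]
  · intro hN p
    have hN' : IsNilpotent (dualAct (Complex.I • extendEnd realToComplex δ)) := by
      rw [hext] at hN
      simpa using hN.neg
    refine Submodule.ext fun ξ => ?_
    rw [mem_map_exp_iff hN, hext, neg_neg, mem_gspan_dualFam hA]
    simp only [pairingR_exp hX.isNilpotent hN']
    rw [Submodule.mem_comap, Submodule.mem_dualAnnihilator, hX.F_eq]
    have : {i : ℤ × ℤ | 1 - p ≤ i.1} = {i | -i ∉ {i : ℤ × ℤ | p ≤ i.1}} := by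
      ext i
      simp only [Set.mem_ofPred_eq, Prod.fst_neg]
      omega
    rw [this]
    constructor
    · exact fun h x hx => h _ ⟨x, hx, rfl⟩
    · rintro h _ ⟨x, hx, rfl⟩
      exact h x hx

end HodgeTriple

/-! ### Subspaces which are stable under the canonical pair -/

section Restriction

variable {R : Type} [CommRing R] [Algebra ℚ R] {V : Type} [AddCommGroup V] [Module ℚ V]

theorem subtype_baseChange_injective (Y : Submodule ℚ V) :
    Function.Injective (Y.subtype.baseChange R) :=
  baseChange_injective_of_injective Y.injective_subtype

theorem exists_restrict_end {Y : Submodule ℚ V} {T : Module.End R (R ⊗[ℚ] V)}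
    (hT : ∀ y ∈ Y.baseChange R, T y ∈ Y.baseChange R) :
    ∃ T' : Module.End R (R ⊗[ℚ] Y), ∀ y,
      Y.subtype.baseChange R (T' y) = T (Y.subtype.baseChange R y) := by
  let ι := LinearEquiv.ofInjective (Y.subtype.baseChange R) (subtype_baseChange_injective Y)
  have h : ∀ y, T (Y.subtype.baseChange R y) ∈ LinearMap.range (Y.subtype.baseChange R) :=
    fun y => mem_baseChange_iff.1 (hT _ (mem_baseChange_iff.2 ⟨y, rfl⟩))
  refine ⟨ι.symm.toLinearMap ∘ₗ (T ∘ₗ Y.subtype.baseChange R).codRestrict _ h, fun y => ?_⟩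
  exact congrArg Subtype.val (ι.apply_symm_apply ⟨T (Y.subtype.baseChange R y), h y⟩)

end Restriction

namespace HodgeTriple

/-- A subspace with the induced filtrations. -/
def restrict (X : HodgeTriple) (Y : Submodule ℚ X.V) : HodgeTriple :=
  HodgeTriple.mk Y (fun k => (X.W k).comap Y.subtype)
    (fun p => (X.F p).comap (Y.subtype.baseChange ℂ))

variable {X : HodgeTriple} {h : ℂˣ →* ((ℝ ⊗[ℚ] X.V) ≃ₗ[ℝ] (ℝ ⊗[ℚ] X.V))}
  {δ : Module.End ℝ (ℝ ⊗[ℚ] X.V)}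

/-- A subspace which is stable under the canonical pair is a mixed Hodge structure. -/
theorem IsCanonicalPair.isMHS_restrict (hX : X.IsCanonicalPair h δ) {Y : Submodule ℚ X.V}
    (hh : ∀ z, ∀ y ∈ Y.baseChange ℝ, h z y ∈ Y.baseChange ℝ)
    (hδ : ∀ y ∈ Y.baseChange ℝ, δ y ∈ Y.baseChange ℝ) : (X.restrict Y).IsMHS := by
  have hA := hX.internal
  have inj : Function.Injective (Y.subtype.baseChange ℂ) := subtype_baseChange_injective Y
  have injR : Function.Injective (Y.subtype.baseChange ℝ) := subtype_baseChange_injective Y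
  choose T hT using fun z => exists_restrict_end (T := (h z).toLinearMap) (hh z)
  obtain ⟨D, hD⟩ := exists_restrict_end hδ
  let ρ : ℂˣ →* Module.End ℝ (ℝ ⊗[ℚ] Y) :=
    { toFun := T
      map_one' := LinearMap.ext fun y => injR (by rw [hT, map_one]; rfl)
      map_mul' := fun z w => LinearMap.ext fun y => injR (by
        rw [hT, map_mul, Module.End.mul_apply, hT, hT]; rfl) }
  have hact : ∀ z y, Y.subtype.baseChange ℂ (actC (toAut ρ) z y) =
      actC h z (Y.subtype.baseChange ℂ y) := fun z => extendEnd_baseChange (hT z)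
  have hDC : ∀ y, Y.subtype.baseChange ℂ (extendEnd realToComplex D y) =
      extendEnd realToComplex δ (Y.subtype.baseChange ℂ y) := extendEnd_baseChange hD
  -- The induced bigrading still spans, because a subspace stable under h contains the Hodge
  -- components of its elements.
  set B : ℤ × ℤ → Submodule ℂ (ℂ ⊗[ℚ] Y) := fun i =>
    (hodgeFam h i).comap (Y.subtype.baseChange ℂ) with hB
  have hBact : ∀ i, ∀ x ∈ B i, ∀ z, actC (toAut ρ) z x = hodgeChar i z • x := fun i x hx z =>
    inj (by rw [hact, map_smul]; exact mem_hodgeFam.1 hx z)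
  have hBtop : ⨆ i, B i = ⊤ := by
    rw [eq_top_iff]
    intro y _
    obtain ⟨s, -, hs⟩ := exists_eq_sum_gproj hA (Y.subtype.baseChange ℂ y)
    have h1 : ∀ i, ∃ y', Y.subtype.baseChange ℂ y' =
        gproj hA i (Y.subtype.baseChange ℂ y) := fun i => by
      refine LinearMap.mem_range.1 (gproj_mem_of_stable (actC_commute h) hA
        (fun i x hx => mem_hodgeFam.1 hx) (Y := LinearMap.range (Y.subtype.baseChange ℂ)) ?_
        ⟨y, rfl⟩ i)
      rintro z _ ⟨y, rfl⟩
      exact ⟨_, hact z y⟩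
    choose y' hy' using h1
    have h2 : y = ∑ i ∈ s, y' i := inj (by rw [map_sum, hs]; simp only [hy'])
    rw [h2]
    refine Submodule.sum_mem _ fun i _ => Submodule.mem_iSup_of_mem i ?_
    change Y.subtype.baseChange ℂ (y' i) ∈ hodgeFam h i
    rw [hy']
    exact gproj_mem hA i _
  have hBint : DirectSum.IsInternal B := (charSpace_eq (actC_commute _) hBtop hBact).2
  have hmem : ∀ {S : Set (ℤ × ℤ)} {x}, Y.subtype.baseChange ℂ x ∈ gspan (hodgeFam h) S ↔
      x ∈ gspan B S := mem_gspan_map_iff hBint hA (fun _ => Submodule.map_comap_le _ _) inj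
  refine (isCanonicalPair_mk (V := Y) (h := toAut ρ) (δ := D) B hBtop hBact ?_ ?_ ?_).isMHS
  · intro k
    refine Submodule.ext fun x => ?_
    rw [← hmem, ← hX.W_eq, ← mem_comap_baseChange_iff]
  · intro i x hx
    rw [← hmem, hDC]
    exact hX.hasDeg i _ hx
  · intro hN p
    refine Submodule.ext fun x => ?_
    rw [mem_map_exp_iff hN, ← hmem, Submodule.mem_comap, hX.F_eq, mem_map_exp_iff hX.isNilpotent,
      exp_apply_comm (Y.subtype.baseChange ℂ) hN.neg hX.isNilpotent.neg]
    intro x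
    simp only [LinearMap.neg_apply, LinearMap.smul_apply, map_neg, map_smul, hDC]

theorem isMorphism_restrict (X : HodgeTriple) (Y : Submodule ℚ X.V) :
    IsMorphism (X.restrict Y) X Y.subtype :=
  ⟨fun _ => Submodule.map_comap_le _ _, fun _ => Submodule.map_comap_le _ _⟩

end HodgeTriple

/-! ### Linear forms after extension of scalars -/

section Forms

variable {R S : Type} [CommRing R] [Algebra ℚ R] [CommRing S] [Algebra ℚ S]
  {V V' : Type} [AddCommGroup V] [Module ℚ V] [AddCommGroup V'] [Module ℚ V']

theorem dual_baseChange_tmul (φ : Module.Dual ℚ V) (r : R) (v : V) :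
    Module.Dual.baseChange R φ (r ⊗ₜ v) = r * algebraMap ℚ R (φ v) := by
  rw [← pairingR_one_tmul, pairingR_tmul, one_mul]

theorem dual_baseChange_scalarMap (f : R →ₐ[ℚ] S) (φ : Module.Dual ℚ V) (x : R ⊗[ℚ] V) :
    Module.Dual.baseChange S φ (scalarMap f V x) = f (Module.Dual.baseChange R φ x) := by
  rw [← pairingR_one_tmul, ← pairingR_one_tmul, ← scalarMap_pairingR, scalarMap_tmul, map_one]

theorem dual_baseChange_baseChange (φ : Module.Dual ℚ V') (f : V →ₗ[ℚ] V') (x : R ⊗[ℚ] V) :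
    Module.Dual.baseChange R φ (f.baseChange R x) =
      Module.Dual.baseChange R (φ ∘ₗ f) x := by
  rw [← pairingR_one_tmul, ← pairingR_one_tmul, ← pairingR_dualMap, LinearMap.baseChange_tmul]
  rfl

theorem coord_baseChange {ι : Type*} (b : Module.Basis ι ℚ V) (i : ι) :
    (b.baseChange R).coord i = Module.Dual.baseChange R (b.coord i) := by
  refine tensor_ext fun v => ?_
  rw [dual_baseChange_tmul, Module.Basis.coord_apply, Module.Basis.baseChange_repr_tmul]
  simp [Algebra.smul_def]

theorem eq_zero_of_dual {x : R ⊗[ℚ] V} (h : ∀ φ, Module.Dual.baseChange R φ x = 0) : x = 0 := by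
  let b := Module.Basis.ofVectorSpace ℚ V
  apply (b.baseChange R).ext_elem
  intro i
  rw [← Module.Basis.coord_apply, coord_baseChange, h]
  simp

/-- Rational linear forms on the quotient by U separate the points of its extension of scalars.
Membership becomes a set of equations with coefficients independent of R, as needed for closed
subgroups. -/
theorem mem_baseChange_iff_dual {U : Submodule ℚ V} {x : R ⊗[ℚ] V} :
    x ∈ U.baseChange R ↔
      ∀ φ : Module.Dual ℚ V, (∀ u ∈ U, φ u = 0) → Module.Dual.baseChange R φ x = 0 := by
  constructor
  · intro hx φ hφ
    obtain ⟨y, rfl⟩ := mem_baseChange_iff.1 hx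
    rw [dual_baseChange_baseChange, show φ ∘ₗ U.subtype = 0 from LinearMap.ext fun u => hφ u u.2]
    simp
  · intro h
    have h1 : U = LinearMap.ker U.mkQ := U.ker_mkQ.symm
    rw [h1, ← baseChange_eq_zero_iff]
    refine eq_zero_of_dual fun ψ => ?_
    rw [dual_baseChange_baseChange]
    refine h _ fun u hu => ?_
    rw [LinearMap.comp_apply, (Submodule.Quotient.mk_eq_zero U).2 hu |> fun h => show U.mkQ u = 0 from h,
      map_zero]

theorem scalarMap_mem (f : R →ₐ[ℚ] S) {U : Submodule ℚ V} {x : R ⊗[ℚ] V}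
    (hx : x ∈ U.baseChange R) : scalarMap f V x ∈ U.baseChange S := by
  rw [mem_baseChange_iff_dual] at hx ⊢
  intro φ hφ
  rw [dual_baseChange_scalarMap, hx φ hφ, map_zero]

theorem stable_of_forall {U : Submodule ℚ V} {T : Module.End R (R ⊗[ℚ] V)}
    (h : ∀ v ∈ U, T (1 ⊗ₜ v) ∈ U.baseChange R) {x : R ⊗[ℚ] V} (hx : x ∈ U.baseChange R) :
    T x ∈ U.baseChange R := by
  have : U.baseChange R ≤ (U.baseChange R).comap T := by
    conv_lhs => rw [Submodule.baseChange_eq_span]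
    rw [Submodule.span_le]
    rintro _ ⟨v, hv, rfl⟩
    exact h v hv
  exact this hx

/-- The base change of an automorphism. -/
def extendAut (f : R →ₐ[ℚ] S) : ((R ⊗[ℚ] V) ≃ₗ[R] (R ⊗[ℚ] V)) →* ((S ⊗[ℚ] V) ≃ₗ[S] (S ⊗[ℚ] V)) :=
  toAut
    { toFun := fun g => extendEnd f g.toLinearMap
      map_one' := extendEnd_one f
      map_mul' := fun g g' => extendEnd_mul f g.toLinearMap g'.toLinearMap }

theorem extendAut_scalarMap (f : R →ₐ[ℚ] S) (g : (R ⊗[ℚ] V) ≃ₗ[R] (R ⊗[ℚ] V)) (x : R ⊗[ℚ] V) :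
    extendAut f g (scalarMap f V x) = scalarMap f V (g x) :=
  extendEnd_scalarMap f g.toLinearMap x

end Forms

/-! ### Regular functions on the general linear group -/

section Regular

variable {R S : Type} [CommRing R] [Algebra ℚ R] [CommRing S] [Algebra ℚ S]
  {V : Type} [AddCommGroup V] [Module ℚ V]

/-- The matrix coefficients of an automorphism. -/
def matCoef (g : (R ⊗[ℚ] V) ≃ₗ[R] (R ⊗[ℚ] V)) (x : V × Module.Dual ℚ V) : R :=
  Module.Dual.baseChange R x.2 (g (1 ⊗ₜ x.1))

variable (V) in
/-- Polynomials in the matrix coefficients of an automorphism and of its inverse. -/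
abbrev CoordRing : Type :=
  MvPolynomial ((V × Module.Dual ℚ V) ⊕ (V × Module.Dual ℚ V)) ℚ

/-- Evaluation of regular functions. -/
def evalPt (g : (R ⊗[ℚ] V) ≃ₗ[R] (R ⊗[ℚ] V)) : CoordRing V →ₐ[ℚ] R :=
  MvPolynomial.aeval (Sum.elim (matCoef g) (matCoef g⁻¹))

variable (V) in
/-- The effect of the inversion on regular functions. -/
def swapPt : CoordRing V →ₐ[ℚ] CoordRing V := MvPolynomial.rename Sum.swap

theorem evalPt_swapPt (g : (R ⊗[ℚ] V) ≃ₗ[R] (R ⊗[ℚ] V)) (p : CoordRing V) :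
    evalPt g (swapPt V p) = evalPt g⁻¹ p := by
  rw [evalPt, swapPt, MvPolynomial.aeval_rename, evalPt, inv_inv]
  congr 2
  funext x
  rcases x with x | x <;> rfl

theorem matCoef_extendAut (f : R →ₐ[ℚ] S) (g : (R ⊗[ℚ] V) ≃ₗ[R] (R ⊗[ℚ] V))
    (x : V × Module.Dual ℚ V) : matCoef (extendAut f g) x = f (matCoef g x) := by
  rw [matCoef, matCoef, ← dual_baseChange_scalarMap, ← extendAut_scalarMap, scalarMap_tmul, map_one]

theorem evalPt_extendAut (f : R →ₐ[ℚ] S) (g : (R ⊗[ℚ] V) ≃ₗ[R] (R ⊗[ℚ] V)) :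
    evalPt (extendAut f g) = f.comp (evalPt g) := by
  refine MvPolynomial.algHom_ext fun x => ?_
  rcases x with x | x
  · simp [evalPt, matCoef_extendAut]
  · simp [evalPt, ← map_inv, matCoef_extendAut]

theorem matCoef_eq_sum {ι : Type} [Fintype ι] (b : Module.Basis ι ℚ V)
    (g : (R ⊗[ℚ] V) ≃ₗ[R] (R ⊗[ℚ] V)) (x : V × Module.Dual ℚ V) :
    matCoef g x = ∑ i, ∑ j, algebraMap ℚ R (x.2 (b i) * b.repr x.1 j) *
      matCoef g (b j, b.coord i) := by
  obtain ⟨v, φ⟩ := x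
  simp only [matCoef]
  conv_lhs => rw [← b.sum_dual_apply_smul_coord φ, ← b.sum_repr v]
  simp only [map_sum, TensorProduct.tmul_sum, TensorProduct.tmul_smul, LinearMap.sum_apply]
  rw [Finset.sum_comm]
  refine Finset.sum_congr rfl fun i _ => Finset.sum_congr rfl fun j _ => ?_
  rw [map_smul, LinearMap.smul_apply]
  have : ∀ (c : ℚ) (y : R ⊗[ℚ] V), g (c • y) = c • g y := fun c y => by
    rw [← algebraMap_smul R c y, map_smul, algebraMap_smul]
  have h2 : ∀ (c : ℚ) (y : R ⊗[ℚ] V), Module.Dual.baseChange R (b.coord i) (c • y) =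
      c • Module.Dual.baseChange R (b.coord i) y := fun c y => by
    rw [← algebraMap_smul R c y, map_smul, algebraMap_smul]
  rw [this, h2, smul_smul, Algebra.smul_def, map_mul]

theorem toMatrix_eq_matCoef {ι : Type} [Fintype ι] [DecidableEq ι] (b : Module.Basis ι ℚ V)
    (g : (R ⊗[ℚ] V) ≃ₗ[R] (R ⊗[ℚ] V)) (i j : ι) :
    LinearMap.toMatrix (b.baseChange R) (b.baseChange R) g.toLinearMap i j =
      matCoef g (b j, b.coord i) := by
  rw [LinearMap.toMatrix_apply, ← Module.Basis.coord_apply, coord_baseChange,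
    Module.Basis.baseChange_apply]
  rfl

variable [FiniteDimensional ℚ V]

/-- Regular functions are polynomials in the matrix coefficients, up to a unit. -/
theorem exists_clear_denominators (p : CoordRing V) :
    ∃ q : MvPolynomial (V × Module.Dual ℚ V) ℚ,
      ∀ (R : Type) [CommRing R] [Algebra ℚ R] (g : (R ⊗[ℚ] V) ≃ₗ[R] (R ⊗[ℚ] V)),
        MvPolynomial.aeval (matCoef g) q = 0 ↔ evalPt g p = 0 := by
  let b := Module.finBasis ℚ V
  let M : Matrix (Fin _) (Fin _) (MvPolynomial (V × Module.Dual ℚ V) ℚ) :=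
    Matrix.of fun i j => MvPolynomial.X (b j, b.coord i)
  have hM : ∀ (R : Type) [CommRing R] [Algebra ℚ R] (g : (R ⊗[ℚ] V) ≃ₗ[R] (R ⊗[ℚ] V)),
      (MvPolynomial.aeval (matCoef g)).mapMatrix M =
        LinearMap.toMatrix (b.baseChange R) (b.baseChange R) g.toLinearMap := by
    intro R _ _ g
    ext i j
    rw [toMatrix_eq_matCoef]
    simp [M]
  have hinv : ∀ (R : Type) [CommRing R] [Algebra ℚ R] (g : (R ⊗[ℚ] V) ≃ₗ[R] (R ⊗[ℚ] V)),
      LinearMap.toMatrix (b.baseChange R) (b.baseChange R) g.toLinearMap *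
        LinearMap.toMatrix (b.baseChange R) (b.baseChange R) (g⁻¹).toLinearMap = 1 := by
    intro R _ _ g
    rw [← LinearMap.toMatrix_mul, ← LinearMap.toMatrix_one (b.baseChange R)]
    congr 1
    exact congrArg LinearEquiv.toLinearMap (mul_inv_cancel g)
  have hunit : ∀ (R : Type) [CommRing R] [Algebra ℚ R] (g : (R ⊗[ℚ] V) ≃ₗ[R] (R ⊗[ℚ] V)),
      IsUnit (MvPolynomial.aeval (matCoef g) M.det) := by
    intro R _ _ g
    rw [AlgHom.map_det, hM]
    exact (Matrix.isUnit_iff_isUnit_det _).1 (IsUnit.of_mul_eq_one _ (hinv R g))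
  -- By Cramer's rule the coefficients of the inverse are adjugate entries over the determinant.
  -- Multiplying by a power of the determinant, a unit, removes them without changing the zero
  -- locus.
  suffices h : ∃ (n : ℕ) (q : MvPolynomial (V × Module.Dual ℚ V) ℚ),
      ∀ (R : Type) [CommRing R] [Algebra ℚ R] (g : (R ⊗[ℚ] V) ≃ₗ[R] (R ⊗[ℚ] V)),
        MvPolynomial.aeval (matCoef g) q =
          MvPolynomial.aeval (matCoef g) M.det ^ n * evalPt g p by
    obtain ⟨n, q, hq⟩ := h
    refine ⟨q, fun R _ _ g => ?_⟩
    rw [hq]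
    exact ((hunit R g).pow n).mul_right_eq_zero
  induction p using MvPolynomial.induction_on with
  | C c => exact ⟨0, MvPolynomial.C c, fun R _ _ g => by simp [evalPt]⟩
  | add p p' hp hp' =>
    obtain ⟨n, q, hq⟩ := hp
    obtain ⟨n', q', hq'⟩ := hp'
    refine ⟨n + n', M.det ^ n' * q + M.det ^ n * q', fun R _ _ g => ?_⟩
    simp only [map_add, map_mul, map_pow, hq, hq']
    ring
  | mul_X p x hp =>
    obtain ⟨n, q, hq⟩ := hp
    rcases x with x | x
    · refine ⟨n, q * MvPolynomial.X x, fun R _ _ g => ?_⟩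
      simp only [map_mul, hq, evalPt, MvPolynomial.aeval_X, Sum.elim_inl]
      ring
    · refine ⟨n + 1, q * ∑ i, ∑ j, MvPolynomial.C (x.2 (b i) * b.repr x.1 j) * M.adjugate i j,
        fun R _ _ g => ?_⟩
      have h1 : ∀ i j, MvPolynomial.aeval (matCoef g) (M.adjugate i j) =
          MvPolynomial.aeval (matCoef g) M.det * matCoef g⁻¹ (b j, b.coord i) := by
        intro i j
        have h2 : (MvPolynomial.aeval (matCoef g)).mapMatrix M.adjugate =
            MvPolynomial.aeval (matCoef g) M.det •
              LinearMap.toMatrix (b.baseChange R) (b.baseChange R) (g⁻¹).toLinearMap := by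
          rw [AlgHom.map_adjugate, AlgHom.map_det, hM]
          rw [← mul_one (Matrix.adjugate _), ← hinv R g, ← mul_assoc, Matrix.adjugate_mul,
            smul_mul_assoc, one_mul]
        have h3 := congrFun (congrFun h2 i) j
        rw [Matrix.smul_apply, toMatrix_eq_matCoef, smul_eq_mul] at h3
        exact h3
      have h4 : evalPt g (MvPolynomial.X (Sum.inr x)) = matCoef g⁻¹ x := by simp [evalPt]
      simp only [map_mul, hq, h4, map_sum, h1, MvPolynomial.algHom_C]
      rw [matCoef_eq_sum b g⁻¹ x]
      simp only [Finset.mul_sum]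
      refine Finset.sum_congr rfl fun i _ => Finset.sum_congr rfl fun j _ => ?_
      rw [map_mul]
      ring

end Regular

/-! ### Representations of `ℚ`-groups -/

section Representation

variable {R S : Type} [CommRing R] [Algebra ℚ R] [CommRing S] [Algebra ℚ S]
  {V : Type} [AddCommGroup V] [Module ℚ V]

/-- The equations have rational coefficients and matrix coefficients are compatible with R → S, so
points go to points. -/
theorem QSubgroup.extendAut_mem (G : QSubgroup V) (f : R →ₐ[ℚ] S)
    {g : (R ⊗[ℚ] V) ≃ₗ[R] (R ⊗[ℚ] V)} (hg : g ∈ G.pts R) : extendAut f g ∈ G.pts S := by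
  obtain ⟨P, hP⟩ := G.closed
  rw [hP] at hg ⊢
  intro p hp
  have h1 : (MvPolynomial.aeval (matCoef (extendAut f g)) : _ →ₐ[ℚ] S) =
      f.comp (MvPolynomial.aeval (matCoef g)) :=
    MvPolynomial.algHom_ext fun x => by simp [matCoef_extendAut]
  refine (DFunLike.congr_fun h1 p).trans ?_
  rw [AlgHom.comp_apply]
  exact (congrArg f (hg p hp)).trans (map_zero f)

/-- An algebraic representation of a `ℚ`-group. -/
structure RegRep (G : QSubgroup V) (E : Type) [AddCommGroup E] [Module ℚ E] where
  act : ∀ (R : Type) [CommRing R] [Algebra ℚ R], G.pts R →* Module.End R (R ⊗[ℚ] E)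
  regular : ∀ v : E, ∃ P : CoordRing V ⊗[ℚ] E, ∀ (R : Type) [CommRing R] [Algebra ℚ R]
    (g : G.pts R), act R g (1 ⊗ₜ v) = scalarMap (evalPt g.1) E P

namespace RegRep

variable {G : QSubgroup V} {E E' : Type} [AddCommGroup E] [Module ℚ E] [AddCommGroup E']
  [Module ℚ E'] (ρ : RegRep G E) (ρ' : RegRep G E')

/-- Regularity only gives a formula for each vector; choosing it on a basis makes it linear in the
vector. -/
theorem exists_coaction : ∃ co : E →ₗ[ℚ] CoordRing V ⊗[ℚ] E,
    ∀ (R : Type) [CommRing R] [Algebra ℚ R] (g : G.pts R) (v : E),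
      ρ.act R g (1 ⊗ₜ v) = scalarMap (evalPt g.1) E (co v) := by
  choose P hP using ρ.regular
  let b := Module.Basis.ofVectorSpace ℚ E
  refine ⟨b.constr ℚ fun i => P (b i), fun R _ _ g v => ?_⟩
  have : (ρ.act R g).restrictScalars ℚ ∘ₗ TensorProduct.mk ℚ R E 1 =
      scalarMap (evalPt g.1) E ∘ₗ b.constr ℚ fun i => P (b i) := by
    refine b.ext fun i => ?_
    simp only [LinearMap.comp_apply, Module.Basis.constr_basis, TensorProduct.mk_apply,
      LinearMap.restrictScalars_apply, hP]
  exact LinearMap.congr_fun this v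

theorem scalarMap_comp {Q : Type} [CommRing Q] [Algebra ℚ Q] (f : R →ₐ[ℚ] S) (f' : Q →ₐ[ℚ] R)
    (x : Q ⊗[ℚ] E) : scalarMap (f.comp f') E x = scalarMap f E (scalarMap f' E x) := by
  induction x with
  | zero => simp
  | tmul r v => simp
  | add x y hx hy => simp only [map_add, hx, hy]

/-- Functoriality in R is not part of `RegRep`; it follows because one formula computes the action
over all R. -/
theorem act_extendAut (f : R →ₐ[ℚ] S) (g : G.pts R) :
    ρ.act S ⟨extendAut f g.1, G.extendAut_mem f g.2⟩ = extendEnd f (ρ.act R g) := by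
  refine tensor_ext fun v => ?_
  obtain ⟨P, hP⟩ := ρ.regular v
  have h1 : (1 : S) ⊗ₜ[ℚ] v = scalarMap f E (1 ⊗ₜ v) := by rw [scalarMap_tmul, map_one]
  rw [hP, evalPt_extendAut, scalarMap_comp, ← hP, h1, extendEnd_scalarMap]

/-- The direct sum of representations. -/
def prod : RegRep G (E × E') where
  act R := prodRep (ρ.act R) (ρ'.act R)
  regular v := by
    obtain ⟨P, hP⟩ := ρ.regular v.1
    obtain ⟨P', hP'⟩ := ρ'.regular v.2
    refine ⟨(LinearMap.inl ℚ E E').baseChange _ P + (LinearMap.inr ℚ E E').baseChange _ P',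
      fun R _ _ g => prod_ext ?_ ?_⟩
    · refine (fst_prodAct _ _ _).trans ?_
      rw [baseChange_scalarMap, map_add, fst_inl_baseChange, fst_inr_baseChange, add_zero, ← hP]
      rfl
    · refine (snd_prodAct _ _ _).trans ?_
      rw [baseChange_scalarMap, map_add, snd_inl_baseChange, snd_inr_baseChange, zero_add, ← hP']
      rfl

/-- The tensor product of representations. -/
def tensor : RegRep G (E ⊗[ℚ] E') where
  act R := tensorRep (ρ.act R) (ρ'.act R)
  regular v := by
    induction v with
    | zero => exact ⟨0, fun R _ _ g => by simp⟩
    | add v w hv hw =>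
      obtain ⟨P, hP⟩ := hv
      obtain ⟨P', hP'⟩ := hw
      exact ⟨P + P', fun R _ _ g => by rw [TensorProduct.tmul_add, map_add, hP, hP', map_add]⟩
    | tmul v w =>
      obtain ⟨P, hP⟩ := ρ.regular v
      obtain ⟨P', hP'⟩ := ρ'.regular w
      refine ⟨tmulR _ E E' P P', fun R _ _ g => ?_⟩
      have h1 : (1 : R) ⊗ₜ[ℚ] (v ⊗ₜ[ℚ] w) = tmulR R E E' (1 ⊗ₜ v) (1 ⊗ₜ w) := by
        rw [tmulR_tmul, mul_one]
      rw [scalarMap_tmulR, ← hP, ← hP', h1]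
      exact tensorAct_tmulR _ _ _ _

/-- The dual representation. -/
def dual [FiniteDimensional ℚ E] : RegRep G (Module.Dual ℚ E) where
  act R := dualRep (ρ.act R)
  regular φ := by
    obtain ⟨co, hco⟩ := ρ.exists_coaction
    -- The dual action goes through the inverse of g, hence `swapPt`.
    let L : E →ₗ[ℚ] CoordRing V := (Module.Dual.baseChange (CoordRing V) φ).restrictScalars ℚ ∘ₗ
      scalarMap (swapPt V) E ∘ₗ co
    refine ⟨(dualEquiv (CoordRing V) E).symm (LinearMap.liftBaseChange _ L), fun R _ _ g => ?_⟩
    apply pairingR_bijective.1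
    refine tensor_ext fun v => ?_
    have h1 : (1 : R) ⊗ₜ[ℚ] v = scalarMap (evalPt g.1) E (1 ⊗ₜ v) := by
      rw [scalarMap_tmul, map_one]
    have h2 : pairingR (CoordRing V) E
        ((dualEquiv (CoordRing V) E).symm (LinearMap.liftBaseChange _ L)) (1 ⊗ₜ v) = L v := by
      have : pairingR (CoordRing V) E
        ((dualEquiv (CoordRing V) E).symm (LinearMap.liftBaseChange _ L)) =
          LinearMap.liftBaseChange _ L := (dualEquiv (CoordRing V) E).apply_symm_apply _
      rw [this]
      simp
    have h3 : (evalPt g.1).comp (swapPt V) = evalPt g⁻¹.1 :=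
      AlgHom.ext fun p => evalPt_swapPt g.1 p
    refine (pairingR_dualAct _ _ _).trans ?_
    rw [h1, scalarMap_pairingR, h2, ← h1, pairingR_one_tmul, hco, ← h3, scalarMap_comp,
      dual_baseChange_scalarMap]
    rfl

/-- The representation on a stable subspace. -/
def sub (f : E' →ₗ[ℚ] E) (r : E →ₗ[ℚ] E') (hr : r ∘ₗ f = LinearMap.id)
    (hf : ∀ (R : Type) [CommRing R] [Algebra ℚ R] (g : G.pts R),
      ∀ x ∈ (LinearMap.range f).baseChange R, ρ.act R g x ∈ (LinearMap.range f).baseChange R) :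
    RegRep G E' where
  act R _ _ :=
    { toFun := fun g => r.baseChange R ∘ₗ ρ.act R g ∘ₗ f.baseChange R
      map_one' := by
        rw [map_one, Module.End.one_eq_id, LinearMap.id_comp, ← LinearMap.baseChange_comp, hr,
          LinearMap.baseChange_id]
        rfl
      map_mul' := fun g g' => LinearMap.ext fun y => by
        obtain ⟨y', hy'⟩ := mem_range_baseChange_iff.1
          (hf R g' _ (mem_range_baseChange_iff.2 ⟨y, rfl⟩))
        have h1 : ∀ y, r.baseChange R (f.baseChange R y) = y := fun y => by
          rw [← LinearMap.comp_apply, ← LinearMap.baseChange_comp, hr, LinearMap.baseChange_id]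
          rfl
        simp only [map_mul, Module.End.mul_apply, LinearMap.comp_apply, ← hy', h1] }
  regular v := by
    obtain ⟨P, hP⟩ := ρ.regular (f v)
    refine ⟨r.baseChange _ P, fun R _ _ g => ?_⟩
    rw [← baseChange_scalarMap, ← hP]
    simp

theorem sub_act {f : E' →ₗ[ℚ] E} {r : E →ₗ[ℚ] E'} (hr : r ∘ₗ f = LinearMap.id)
    (hf : ∀ (R : Type) [CommRing R] [Algebra ℚ R] (g : G.pts R),
      ∀ x ∈ (LinearMap.range f).baseChange R, ρ.act R g x ∈ (LinearMap.range f).baseChange R)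
    (g : G.pts R) (y : R ⊗[ℚ] E') :
    f.baseChange R ((ρ.sub f r hr hf).act R g y) = ρ.act R g (f.baseChange R y) := by
  obtain ⟨y', hy'⟩ := mem_range_baseChange_iff.1
    (hf R g _ (mem_range_baseChange_iff.2 ⟨y, rfl⟩))
  change f.baseChange R (r.baseChange R (ρ.act R g (f.baseChange R y))) = _
  rw [← hy', ← LinearMap.comp_apply (r.baseChange R), ← LinearMap.baseChange_comp, hr,
    LinearMap.baseChange_id]
  rfl

/-- Independence of the section: s(f x) and x differ by an element of the kernel, which g preserves.
-/
theorem quot_act_aux {f : E →ₗ[ℚ] E'} {s : E' →ₗ[ℚ] E} (hs : f ∘ₗ s = LinearMap.id)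
    (hf : ∀ (R : Type) [CommRing R] [Algebra ℚ R] (g : G.pts R),
      ∀ x ∈ (LinearMap.ker f).baseChange R, ρ.act R g x ∈ (LinearMap.ker f).baseChange R)
    (g : G.pts R) (x : R ⊗[ℚ] E) :
    f.baseChange R (ρ.act R g (s.baseChange R (f.baseChange R x))) =
      f.baseChange R (ρ.act R g x) := by
  rw [← sub_eq_zero, ← map_sub, ← map_sub, baseChange_eq_zero_iff]
  refine hf R g _ (baseChange_eq_zero_iff.1 ?_)
  rw [map_sub, ← LinearMap.comp_apply, ← LinearMap.baseChange_comp, hs, LinearMap.baseChange_id]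
  exact sub_self _

/-- The representation on a quotient by a stable subspace. -/
def quot (f : E →ₗ[ℚ] E') (s : E' →ₗ[ℚ] E) (hs : f ∘ₗ s = LinearMap.id)
    (hf : ∀ (R : Type) [CommRing R] [Algebra ℚ R] (g : G.pts R),
      ∀ x ∈ (LinearMap.ker f).baseChange R, ρ.act R g x ∈ (LinearMap.ker f).baseChange R) :
    RegRep G E' where
  act R _ _ :=
    { toFun := fun g => f.baseChange R ∘ₗ ρ.act R g ∘ₗ s.baseChange R
      map_one' := by
        rw [map_one, Module.End.one_eq_id, LinearMap.id_comp, ← LinearMap.baseChange_comp, hs,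
          LinearMap.baseChange_id]
        rfl
      map_mul' := fun g g' => LinearMap.ext fun y => by
        simp only [map_mul, Module.End.mul_apply, LinearMap.comp_apply,
          ρ.quot_act_aux hs hf] }
  regular v := by
    obtain ⟨P, hP⟩ := ρ.regular (s v)
    refine ⟨f.baseChange _ P, fun R _ _ g => ?_⟩
    rw [← baseChange_scalarMap, ← hP]
    simp

theorem quot_act {f : E →ₗ[ℚ] E'} {s : E' →ₗ[ℚ] E} (hs : f ∘ₗ s = LinearMap.id)
    (hf : ∀ (R : Type) [CommRing R] [Algebra ℚ R] (g : G.pts R),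
      ∀ x ∈ (LinearMap.ker f).baseChange R, ρ.act R g x ∈ (LinearMap.ker f).baseChange R)
    (g : G.pts R) (x : R ⊗[ℚ] E) :
    (ρ.quot f s hs hf).act R g (f.baseChange R x) = f.baseChange R (ρ.act R g x) :=
  ρ.quot_act_aux hs hf g x

variable (G E) in
/-- The trivial representation. -/
def trivial : RegRep G E where
  act _ := 1
  regular v := ⟨1 ⊗ₜ v, fun R _ _ g => by simp⟩

variable (G) in
/-- The standard representation. -/
def standard [FiniteDimensional ℚ V] : RegRep G V where
  act R := (endHom R (R ⊗[ℚ] V)).comp (G.pts R).subtype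
  regular v := by
    let b := Module.finBasis ℚ V
    refine ⟨∑ i, MvPolynomial.X (Sum.inl (v, b.coord i)) ⊗ₜ b i, fun R _ _ g => ?_⟩
    rw [map_sum]
    refine ((b.baseChange R).sum_repr _).symm.trans (Finset.sum_congr rfl fun i _ => ?_)
    rw [← Module.Basis.coord_apply, coord_baseChange, Module.Basis.baseChange_apply,
      TensorProduct.smul_tmul', smul_eq_mul, mul_one, scalarMap_tmul]
    congr 1
    simp [evalPt, matCoef]
    rfl

end RegRep

end Representation

/-! ### Representations of the smallest group containing a pair -/

section Infinitesimal

variable {V V' : Type} [AddCommGroup V] [Module ℚ V] [AddCommGroup V'] [Module ℚ V']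

theorem eps_smul_eps_smul {M : Type*} [AddCommGroup M] [Module ℝ[ε] M] (x : M) :
    (DualNumber.eps : ℝ[ε]) • (DualNumber.eps : ℝ[ε]) • x = 0 := by
  rw [smul_smul, DualNumber.eps_mul_eps, zero_smul]

theorem one_add_eps_mul {M : Type*} [AddCommGroup M] [Module ℝ[ε] M] (N N' : Module.End ℝ[ε] M) :
    (1 + (DualNumber.eps : ℝ[ε]) • N) * (1 + (DualNumber.eps : ℝ[ε]) • N') =
      1 + (DualNumber.eps : ℝ[ε]) • (N + N') :=
  LinearMap.ext fun x => by
    simp only [Module.End.mul_apply, LinearMap.add_apply, Module.End.one_apply,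
      LinearMap.smul_apply, map_add, map_smul, smul_add, eps_smul_eps_smul]
    abel

theorem one_add_eps_mul_neg {M : Type*} [AddCommGroup M] [Module ℝ[ε] M] (N : Module.End ℝ[ε] M) :
    (1 + (DualNumber.eps : ℝ[ε]) • N) * (1 + (DualNumber.eps : ℝ[ε]) • -N) = 1 := by
  rw [one_add_eps_mul, add_neg_cancel]
  exact LinearMap.ext fun x => by
    rw [LinearMap.add_apply, LinearMap.smul_apply, LinearMap.zero_apply, smul_zero, add_zero]

theorem one_add_eps_neg_mul {M : Type*} [AddCommGroup M] [Module ℝ[ε] M] (N : Module.End ℝ[ε] M) :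
    (1 + (DualNumber.eps : ℝ[ε]) • -N) * (1 + (DualNumber.eps : ℝ[ε]) • N) = 1 := by
  have := one_add_eps_mul_neg (-N)
  rwa [neg_neg] at this

theorem map_inv_eps {G M : Type*} [Group G] [AddCommGroup M] [Module ℝ[ε] M]
    (ρ : G →* Module.End ℝ[ε] M) {u : G} {N : Module.End ℝ[ε] M}
    (hu : ρ u = 1 + (DualNumber.eps : ℝ[ε]) • N) :
    ρ u⁻¹ = 1 + (DualNumber.eps : ℝ[ε]) • (-N) := by
  refine left_inv_eq_right_inv (a := ρ u) ?_ ?_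
  · rw [← map_mul, inv_mul_cancel, map_one]
  · rw [hu, one_add_eps_mul_neg]

theorem prodAct_one_add_eps (D : Module.End ℝ (ℝ ⊗[ℚ] V)) (D' : Module.End ℝ (ℝ ⊗[ℚ] V')) :
    prodAct (1 + (DualNumber.eps : ℝ[ε]) • extendEnd realToDual D)
      (1 + (DualNumber.eps : ℝ[ε]) • extendEnd realToDual D') =
      1 + (DualNumber.eps : ℝ[ε]) • extendEnd realToDual (prodAct D D') := by
  rw [extendEnd_prodAct]
  refine LinearMap.ext fun x => prod_ext ?_ ?_
  · simp only [fst_prodAct, LinearMap.add_apply, Module.End.one_apply, LinearMap.smul_apply,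
      map_add, map_smul]
  · simp only [snd_prodAct, LinearMap.add_apply, Module.End.one_apply, LinearMap.smul_apply,
      map_add, map_smul]

/-- The Leibniz rule: the cross term carries ε² = 0. -/
theorem tensorAct_one_add_eps (D : Module.End ℝ (ℝ ⊗[ℚ] V)) (D' : Module.End ℝ (ℝ ⊗[ℚ] V')) :
    tensorAct (1 + (DualNumber.eps : ℝ[ε]) • extendEnd realToDual D)
      (1 + (DualNumber.eps : ℝ[ε]) • extendEnd realToDual D') =
      1 + (DualNumber.eps : ℝ[ε]) • extendEnd realToDual (tensorNil D D') := by
  rw [tensorNil, extendEnd_add, extendEnd_tensorAct, extendEnd_tensorAct, extendEnd_one,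
    extendEnd_one]
  refine tmulR_ext fun x y => ?_
  simp only [tensorAct_tmulR, LinearMap.add_apply, Module.End.one_apply, LinearMap.smul_apply,
    map_add, map_smul, smul_add, eps_smul_eps_smul]
  abel

theorem dualAct_one_add_eps [FiniteDimensional ℚ V] (D : Module.End ℝ (ℝ ⊗[ℚ] V)) :
    dualAct (1 + (DualNumber.eps : ℝ[ε]) • -extendEnd realToDual D) =
      1 + (DualNumber.eps : ℝ[ε]) • extendEnd realToDual (-dualAct D) := by
  rw [dualAct_add, dualAct_one, dualAct_smul, extendEnd_neg, extendEnd_dualAct]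
  congr 2
  exact LinearMap.ext fun ξ => dual_ext fun x => by
    rw [pairingR_dualAct, LinearMap.neg_apply, LinearMap.neg_apply, map_neg, map_neg,
      LinearMap.neg_apply, pairingR_dualAct]

end Infinitesimal

/-! ### Stabilizers and stability by minimality -/

section Minimality

variable {V : Type} [AddCommGroup V] [Module ℚ V]

/-- The group `G` is the smallest `ℚ`-group which contains `a z`, for all `z`, and `u`. -/
def IsGeneratedBy (G : QSubgroup V) (a : ℂˣ →* G.pts ℝ) (u : G.pts ℝ[ε]) : Prop :=
  ∀ K : QSubgroup V, (∀ z, (a z).1 ∈ K.pts ℝ) → u.1 ∈ K.pts ℝ[ε] → G ≤ K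

variable [FiniteDimensional ℚ V] {G : QSubgroup V} {a : ℂˣ →* G.pts ℝ} {u : G.pts ℝ[ε]}

/-- The stabilizer of a subspace of a representation. -/
def RegRep.stabilizer {E : Type} [AddCommGroup E] [Module ℚ E] (ρ : RegRep G E)
    (U : Submodule ℚ E) : QSubgroup V where
  pts R _ _ :=
    -- Stability is imposed on g and on its inverse, so that inverses remain in the set over every
    -- R.
    { carrier := {g | ∃ hg : g ∈ G.pts R, (∀ v ∈ U, ρ.act R ⟨g, hg⟩ (1 ⊗ₜ v) ∈ U.baseChange R) ∧
        ∀ v ∈ U, ρ.act R ⟨g, hg⟩⁻¹ (1 ⊗ₜ v) ∈ U.baseChange R}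
      one_mem' := by
        refine ⟨one_mem _, fun v hv => ?_, fun v hv => ?_⟩
        · rw [show (⟨1, one_mem _⟩ : G.pts R) = 1 from rfl, map_one]
          exact Submodule.tmul_mem_baseChange_of_mem 1 hv
        · rw [show (⟨1, one_mem _⟩ : G.pts R) = 1 from rfl, inv_one, map_one]
          exact Submodule.tmul_mem_baseChange_of_mem 1 hv
      mul_mem' := by
        rintro g g' ⟨hg, h1, h2⟩ ⟨hg', h1', h2'⟩
        refine ⟨mul_mem hg hg', fun v hv => ?_, fun v hv => ?_⟩
        · rw [show (⟨g * g', mul_mem hg hg'⟩ : G.pts R) = ⟨g, hg⟩ * ⟨g', hg'⟩ from rfl, map_mul]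
          exact stable_of_forall h1 (h1' v hv)
        · rw [show (⟨g * g', mul_mem hg hg'⟩ : G.pts R) = ⟨g, hg⟩ * ⟨g', hg'⟩ from rfl,
            mul_inv_rev, map_mul]
          exact stable_of_forall h2' (h2 v hv)
      inv_mem' := by
        rintro g ⟨hg, h1, h2⟩
        refine ⟨inv_mem hg, h2, ?_⟩
        rw [show (⟨g⁻¹, inv_mem hg⟩ : G.pts R) = ⟨g, hg⟩⁻¹ from rfl, inv_inv]
        exact h1 }
  closed := by
    obtain ⟨P, hP⟩ := G.closed
    obtain ⟨co, hco⟩ := ρ.exists_coaction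
    choose q hq using exists_clear_denominators (V := V)
    -- The equations of stability are the coefficients φ(g v), with v in U and φ vanishing on U.
    -- Inversion gives those for the inverse, and clearing denominators makes both polynomial in g.
    let Q : Set (CoordRing V) := {p | ∃ v ∈ U, ∃ φ : Module.Dual ℚ E, (∀ x ∈ U, φ x = 0) ∧
      Module.Dual.baseChange (CoordRing V) φ (co v) = p}
    have hQ : ∀ (R : Type) [CommRing R] [Algebra ℚ R] (g : G.pts R),
        (∀ v ∈ U, ρ.act R g (1 ⊗ₜ v) ∈ U.baseChange R) ↔ ∀ p ∈ Q, evalPt g.1 p = 0 := by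
      intro R _ _ g
      simp only [hco, mem_baseChange_iff_dual, dual_baseChange_scalarMap]
      constructor
      · rintro h _ ⟨v, hv, φ, hφ, rfl⟩
        exact h v hv φ hφ
      · exact fun h v hv φ hφ => h _ ⟨v, hv, φ, hφ, rfl⟩
    refine ⟨P ∪ q '' (Q ∪ swapPt V '' Q), fun R _ _ g => ?_⟩
    have hQ' : (∀ p ∈ q '' (Q ∪ swapPt V '' Q), MvPolynomial.aeval (matCoef g) p = 0) ↔
        (∀ p ∈ Q, evalPt g p = 0) ∧ ∀ p ∈ Q, evalPt g⁻¹ p = 0 := by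
      simp only [Set.forall_mem_image, hq, Set.mem_union, or_imp, forall_and, evalPt_swapPt]
    constructor
    · rintro ⟨hg, h1, h2⟩
      rintro p (hp | hp)
      · exact (hP R g).1 hg p hp
      · exact hQ'.2 ⟨(hQ R ⟨g, hg⟩).1 h1, (hQ R ⟨g, hg⟩⁻¹).1 h2⟩ p hp
    · intro h
      have hg : g ∈ G.pts R := (hP R g).2 fun p hp => h p (Or.inl hp)
      have h3 := hQ'.1 fun p hp => h p (Or.inr hp)
      exact ⟨hg, (hQ R ⟨g, hg⟩).2 h3.1, (hQ R ⟨g, hg⟩⁻¹).2 h3.2⟩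

/-- A subspace of a representation is stable if it is stable under the generators. -/
theorem IsGeneratedBy.stable (hG : IsGeneratedBy G a u) {E : Type} [AddCommGroup E] [Module ℚ E]
    (ρ : RegRep G E) {U : Submodule ℚ E} {D : Module.End ℝ (ℝ ⊗[ℚ] E)}
    (hu : ρ.act ℝ[ε] u = 1 + (DualNumber.eps : ℝ[ε]) • extendEnd realToDual D)
    (hD : ∀ x ∈ U.baseChange ℝ, D x ∈ U.baseChange ℝ)
    (ha : ∀ z, ∀ x ∈ U.baseChange ℝ, ρ.act ℝ (a z) x ∈ U.baseChange ℝ)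
    (R : Type) [CommRing R] [Algebra ℚ R] (g : G.pts R) :
    ∀ x ∈ U.baseChange R, ρ.act R g x ∈ U.baseChange R := by
  have hmem : ∀ v ∈ U, ∀ (R : Type) [CommRing R] [Algebra ℚ R], (1 : R) ⊗ₜ v ∈ U.baseChange R :=
    fun v hv R _ _ => Submodule.tmul_mem_baseChange_of_mem 1 hv
  have hD' : ∀ v ∈ U, extendEnd realToDual D (1 ⊗ₜ v) ∈ U.baseChange ℝ[ε] := fun v hv => by
    rw [← map_one realToDual, ← scalarMap_tmul, extendEnd_scalarMap]
    exact scalarMap_mem _ (hD _ (hmem v hv ℝ))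
  -- The stabilizer contains the generators: for inverses, h(z)⁻¹ = h(z⁻¹) and (1 + εD)⁻¹ = 1 - εD.
  -- Minimality of G does the rest.
  have h : G ≤ ρ.stabilizer U := by
    refine hG _ (fun z => ⟨(a z).2, fun v hv => ha z _ (hmem v hv ℝ), fun v hv => ?_⟩)
      ⟨u.2, fun v hv => ?_, fun v hv => ?_⟩
    · change ρ.act ℝ (a z)⁻¹ (1 ⊗ₜ v) ∈ _
      rw [← map_inv]
      exact ha z⁻¹ _ (hmem v hv ℝ)
    · change ρ.act ℝ[ε] u (1 ⊗ₜ v) ∈ _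
      rw [hu]
      exact Submodule.add_mem _ (hmem v hv _) (Submodule.smul_mem _ _ (hD' v hv))
    · change ρ.act ℝ[ε] u⁻¹ (1 ⊗ₜ v) ∈ _
      rw [map_inv_eps _ hu]
      exact Submodule.add_mem _ (hmem v hv _)
        (Submodule.smul_mem _ _ (Submodule.neg_mem _ (hD' v hv)))
  obtain ⟨_, h1, -⟩ := h R g.2
  exact fun x hx => stable_of_forall h1 hx

end Minimality

/-! ### Representations compatible with canonical pairs -/

namespace HodgeTriple

variable {V : Type} [AddCommGroup V] [Module ℚ V]
  {G : QSubgroup V} {a : ℂˣ →* G.pts ℝ} {u : G.pts ℝ[ε]}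

/-- The representation `ρ` of `G` on `X` is compatible with the canonical pair of `X`. -/
def Adapted (a : ℂˣ →* G.pts ℝ) (u : G.pts ℝ[ε]) (X : HodgeTriple) (ρ : RegRep G X.V) : Prop :=
  ∃ (h : ℂˣ →* ((ℝ ⊗[ℚ] X.V) ≃ₗ[ℝ] (ℝ ⊗[ℚ] X.V))) (δ : Module.End ℝ (ℝ ⊗[ℚ] X.V)),
    X.IsCanonicalPair h δ ∧ (∀ z, ρ.act ℝ (a z) = (h z).toLinearMap) ∧
      ρ.act ℝ[ε] u = 1 + (DualNumber.eps : ℝ[ε]) • extendEnd realToDual δ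

variable {X Y : HodgeTriple} {ρ : RegRep G X.V} {ρ' : RegRep G Y.V}

theorem adapted_unit : Adapted a u unit (RegRep.trivial G ℚ) := by
  refine ⟨1, 0, isCanonicalPair_unit, fun z => rfl, ?_⟩
  have : extendEnd realToDual (0 : Module.End ℝ (ℝ ⊗[ℚ] ℚ)) = 0 :=
    extendEnd_eq _ fun x => by simp
  have h2 : (1 : Module.End ℝ[ε] (ℝ[ε] ⊗[ℚ] ℚ)) =
      1 + (DualNumber.eps : ℝ[ε]) • extendEnd realToDual (0 : Module.End ℝ (ℝ ⊗[ℚ] ℚ)) := by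
    rw [this, smul_zero, add_zero]
  exact h2

theorem Adapted.prod (hX : Adapted a u X ρ) (hY : Adapted a u Y ρ') :
    Adapted a u (X.prod Y) (ρ.prod ρ') := by
  obtain ⟨h, δ, hc, ha, hu⟩ := hX
  obtain ⟨h', δ', hc', ha', hu'⟩ := hY
  refine ⟨_, _, hc.prod hc', fun z => ?_, ?_⟩
  · have : prodAct (ρ.act ℝ (a z)) (ρ'.act ℝ (a z)) =
      prodAct (h z).toLinearMap (h' z).toLinearMap := by rw [ha, ha']
    exact this
  · have : prodAct (ρ.act ℝ[ε] u) (ρ'.act ℝ[ε] u) =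
        1 + (DualNumber.eps : ℝ[ε]) • extendEnd realToDual (prodAct δ δ') := by
      rw [hu, hu', prodAct_one_add_eps]
    exact this

theorem Adapted.tensor (hX : Adapted a u X ρ) (hY : Adapted a u Y ρ') :
    Adapted a u (X.tensor Y) (ρ.tensor ρ') := by
  obtain ⟨h, δ, hc, ha, hu⟩ := hX
  obtain ⟨h', δ', hc', ha', hu'⟩ := hY
  refine ⟨_, _, hc.tensor hc', fun z => ?_, ?_⟩
  · have : tensorAct (ρ.act ℝ (a z)) (ρ'.act ℝ (a z)) =
      tensorAct (h z).toLinearMap (h' z).toLinearMap := by rw [ha, ha']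
    exact this
  · have : tensorAct (ρ.act ℝ[ε] u) (ρ'.act ℝ[ε] u) =
        1 + (DualNumber.eps : ℝ[ε]) • extendEnd realToDual (tensorNil δ δ') := by
      rw [hu, hu', tensorAct_one_add_eps]
    exact this

theorem Adapted.dual (hX : Adapted a u X ρ) : Adapted a u X.dual ρ.dual := by
  obtain ⟨h, δ, hc, ha, hu⟩ := hX
  refine ⟨_, _, hc.dual, fun z => ?_, ?_⟩
  · have : dualAct (ρ.act ℝ (a z)⁻¹) = dualAct (h z⁻¹).toLinearMap := by rw [← map_inv, ha]
    exact this
  · have : dualAct (ρ.act ℝ[ε] u⁻¹) =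
        1 + (DualNumber.eps : ℝ[ε]) • extendEnd realToDual (-dualAct δ) := by
      rw [map_inv_eps _ hu, dualAct_one_add_eps]
    exact this

/-- Functoriality of canonical pairs makes the image of f stable under h and δ, hence under G. The
action induced on Y is adapted because extensions of f stay injective, so the required identities
can be tested in X. -/
theorem Adapted.exists_sub [FiniteDimensional ℚ V] (hG : IsGeneratedBy G a u)
    (hX : Adapted a u X ρ) (hY : Y.IsMHS) {f : Y.V →ₗ[ℚ] X.V} (hf : IsMorphism Y X f)
    (hinj : Function.Injective f) : ∃ ρ', Adapted a u Y ρ' := by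
  obtain ⟨h, δ, hc, ha, hu⟩ := hX
  obtain ⟨h', δ', hc'⟩ := hY.exists_canonicalPair
  obtain ⟨r, hr⟩ := f.exists_leftInverse_of_injective (LinearMap.ker_eq_bot.2 hinj)
  have inj : ∀ (R : Type) [CommRing R] [Algebra ℚ R], Function.Injective (f.baseChange R) :=
    fun R _ _ => baseChange_injective_of_injective hinj
  have hst := hG.stable ρ (U := LinearMap.range f) hu
    (fun x hx => by
      obtain ⟨y, rfl⟩ := mem_range_baseChange_iff.1 hx
      exact mem_range_baseChange_iff.2 ⟨_, hf.compat_nilp hc' hc y⟩)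
    (fun z x hx => by
      obtain ⟨y, rfl⟩ := mem_range_baseChange_iff.1 hx
      rw [ha]
      exact mem_range_baseChange_iff.2 ⟨_, hf.compat_act hc' hc z y⟩)
  refine ⟨ρ.sub f r hr hst, h', δ', hc', fun z => LinearMap.ext fun y => inj _ ?_,
    LinearMap.ext fun y => inj _ ?_⟩
  · rw [ρ.sub_act, ha]
    exact (hf.compat_act hc' hc z y).symm
  · rw [ρ.sub_act, hu, LinearMap.add_apply, LinearMap.smul_apply, LinearMap.add_apply,
      LinearMap.smul_apply, map_add, map_smul, extendEnd_baseChange (hf.compat_nilp hc' hc)]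
    rfl

/-- Dually, the kernel of f is stable under h and δ by functoriality, hence under G, and the
identities on Y are tested on images from X. -/
theorem Adapted.exists_quot [FiniteDimensional ℚ V] (hG : IsGeneratedBy G a u)
    (hX : Adapted a u X ρ) (hY : Y.IsMHS) {f : X.V →ₗ[ℚ] Y.V} (hf : IsMorphism X Y f)
    (hsurj : Function.Surjective f) : ∃ ρ', Adapted a u Y ρ' := by
  obtain ⟨h, δ, hc, ha, hu⟩ := hX
  obtain ⟨h', δ', hc'⟩ := hY.exists_canonicalPair
  obtain ⟨s, hs⟩ := f.exists_rightInverse_of_surjective (LinearMap.range_eq_top.2 hsurj)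
  have surj : ∀ (R : Type) [CommRing R] [Algebra ℚ R], Function.Surjective (f.baseChange R) :=
    fun R _ _ => baseChange_surjective_of_surjective hsurj
  have hst := hG.stable ρ (U := LinearMap.ker f) hu
    (fun x hx => by
      rw [← baseChange_eq_zero_iff] at hx ⊢
      rw [hf.compat_nilp hc hc', hx, map_zero])
    (fun z x hx => by
      rw [← baseChange_eq_zero_iff] at hx ⊢
      rw [ha]
      exact (hf.compat_act hc hc' z x).trans (by rw [hx, map_zero]))
  refine ⟨ρ.quot f s hs hst, h', δ', hc', fun z => LinearMap.ext fun y => ?_,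
    LinearMap.ext fun y => ?_⟩
  · obtain ⟨x, rfl⟩ := surj _ y
    rw [ρ.quot_act, ha]
    exact hf.compat_act hc hc' z x
  · obtain ⟨x, rfl⟩ := surj _ y
    rw [ρ.quot_act, hu, LinearMap.add_apply, LinearMap.smul_apply, LinearMap.add_apply,
      LinearMap.smul_apply, map_add, map_smul, extendEnd_baseChange (hf.compat_nilp hc hc')]
    rfl

/-- Morphisms are equivariant. -/
theorem Adapted.comm [FiniteDimensional ℚ V] (hG : IsGeneratedBy G a u)
    (hX : Adapted a u X ρ) (hY : Adapted a u Y ρ') {f : X.V →ₗ[ℚ] Y.V} (hf : IsMorphism X Y f)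
    {R : Type} [CommRing R] [Algebra ℚ R] (g : G.pts R) (x : R ⊗[ℚ] X.V) :
    f.baseChange R (ρ.act R g x) = ρ'.act R g (f.baseChange R x) := by
  obtain ⟨h, δ, hc, ha, hu⟩ := hX
  obtain ⟨h', δ', hc', ha', hu'⟩ := hY
  -- Equivariance of f is stability of its graph, a rational subspace of the sum of the two
  -- representations.
  let U : Submodule ℚ (X.V × Y.V) :=
    LinearMap.ker (f ∘ₗ LinearMap.fst ℚ X.V Y.V - LinearMap.snd ℚ X.V Y.V)
  have hU : ∀ {R : Type} [CommRing R] [Algebra ℚ R] {x : R ⊗[ℚ] (X.V × Y.V)},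
      x ∈ U.baseChange R ↔ f.baseChange R ((LinearMap.fst ℚ X.V Y.V).baseChange R x) =
        (LinearMap.snd ℚ X.V Y.V).baseChange R x := by
    intro R _ _ x
    rw [← baseChange_eq_zero_iff, LinearMap.baseChange_sub, LinearMap.baseChange_comp,
      LinearMap.sub_apply, sub_eq_zero, LinearMap.comp_apply]
  have hu2 : (ρ.prod ρ').act ℝ[ε] u =
      1 + (DualNumber.eps : ℝ[ε]) • extendEnd realToDual (prodAct δ δ') := by
    change prodAct (ρ.act ℝ[ε] u) (ρ'.act ℝ[ε] u) = _
    rw [hu, hu', prodAct_one_add_eps]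
  have key := hG.stable (ρ.prod ρ') (U := U) hu2
    (fun x hx => by
      rw [hU] at hx ⊢
      rw [fst_prodAct, snd_prodAct, hf.compat_nilp hc hc', hx])
    (fun z x hx => by
      rw [hU] at hx ⊢
      change f.baseChange ℝ ((LinearMap.fst ℚ X.V Y.V).baseChange ℝ
        (prodAct (ρ.act ℝ (a z)) (ρ'.act ℝ (a z)) x)) =
        (LinearMap.snd ℚ X.V Y.V).baseChange ℝ (prodAct (ρ.act ℝ (a z)) (ρ'.act ℝ (a z)) x)
      rw [fst_prodAct, snd_prodAct, ← hx, ha, ha']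
      exact hf.compat_act hc hc' z _)
    R g ((LinearMap.inl ℚ X.V Y.V).baseChange R x +
      (LinearMap.inr ℚ X.V Y.V).baseChange R (f.baseChange R x)) (by
      rw [hU]
      simp only [map_add, fst_inl_baseChange, fst_inr_baseChange, snd_inl_baseChange,
        snd_inr_baseChange, add_zero, zero_add])
  rw [hU] at key
  change f.baseChange R ((LinearMap.fst ℚ X.V Y.V).baseChange R
    (prodAct (ρ.act R g) (ρ'.act R g) _)) =
    (LinearMap.snd ℚ X.V Y.V).baseChange R (prodAct (ρ.act R g) (ρ'.act R g) _) at key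
  rw [fst_prodAct, snd_prodAct] at key
  simpa only [map_add, fst_inl_baseChange, fst_inr_baseChange, snd_inl_baseChange,
    snd_inr_baseChange, add_zero, zero_add] using key

/-- The identity morphism is equivariant. Hence actions chosen separately on the objects agree with
the tensor product, unit and standard ones. -/
theorem Adapted.unique [FiniteDimensional ℚ V] (hG : IsGeneratedBy G a u)
    {ρ₁ ρ₂ : RegRep G X.V} (h₁ : Adapted a u X ρ₁) (h₂ : Adapted a u X ρ₂)
    {R : Type} [CommRing R] [Algebra ℚ R] (g : G.pts R) : ρ₁.act R g = ρ₂.act R g := by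
  refine LinearMap.ext fun x => ?_
  have := h₁.comm hG h₂ (isMorphism_id X) g x
  simpa using this

/-- The group acts on all objects of the category generated by `H`. -/
theorem exists_adapted {H : HodgeTriple} {G : QSubgroup H.V} {a : ℂˣ →* G.pts ℝ}
    {u : G.pts ℝ[ε]} (hG : IsGeneratedBy G a u) (hH : Adapted a u H (RegRep.standard G))
    {X : HodgeTriple} (hX : Generated H X) : ∃ ρ, Adapted a u X ρ := by
  induction hX with
  | self => exact ⟨_, hH⟩
  | unit => exact ⟨_, adapted_unit⟩
  | prod _ _ hX hY =>
    obtain ⟨ρ, hρ⟩ := hX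
    obtain ⟨ρ', hρ'⟩ := hY
    exact ⟨_, hρ.prod hρ'⟩
  | tensor _ _ hX hY =>
    obtain ⟨ρ, hρ⟩ := hX
    obtain ⟨ρ', hρ'⟩ := hY
    exact ⟨_, hρ.tensor hρ'⟩
  | dual _ hX =>
    obtain ⟨ρ, hρ⟩ := hX
    exact ⟨_, hρ.dual⟩
  | sub f _ hY hf hinj hX =>
    obtain ⟨ρ, hρ⟩ := hX
    exact hρ.exists_sub hG hY hf hinj
  | quot f _ hY hf hsurj hX =>
    obtain ⟨ρ, hρ⟩ := hX
    exact hρ.exists_quot hG hY hf hsurj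

end HodgeTriple

/-! ### The smallest group containing a pair -/

section SmallestGroup

variable {V : Type} [AddCommGroup V] [Module ℚ V]

/-- The automorphism `1 + εδ`. -/
def unipAut (δ : Module.End ℝ (ℝ ⊗[ℚ] V)) : (ℝ[ε] ⊗[ℚ] V) ≃ₗ[ℝ[ε]] (ℝ[ε] ⊗[ℚ] V) :=
  LinearEquiv.ofLinearMap (1 + (DualNumber.eps : ℝ[ε]) • extendEnd realToDual δ)
    (1 + (DualNumber.eps : ℝ[ε]) • -extendEnd realToDual δ)
    (one_add_eps_mul_neg _) (one_add_eps_neg_mul _)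

theorem unipAut_toLinearMap (δ : Module.End ℝ (ℝ ⊗[ℚ] V)) : (unipAut δ).toLinearMap =
    1 + (DualNumber.eps : ℝ[ε]) • extendEnd realToDual δ := rfl

theorem QSubgroup.memLieReal_iff {K : QSubgroup V} {δ : Module.End ℝ (ℝ ⊗[ℚ] V)} :
    K.MemLieReal δ ↔ unipAut δ ∈ K.pts ℝ[ε] := by
  constructor
  · rintro ⟨u, hu, h⟩
    have : u = unipAut δ := LinearEquiv.toLinearMap_injective (h.trans (unipAut_toLinearMap δ).symm)
    rwa [← this]
  · exact fun h => ⟨_, h, unipAut_toLinearMap δ⟩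

/-- The intersection of all `ℚ`-groups which contain the pair `(h, δ)`. -/
def smallestGroup (h : ℂˣ →* ((ℝ ⊗[ℚ] V) ≃ₗ[ℝ] (ℝ ⊗[ℚ] V))) (δ : Module.End ℝ (ℝ ⊗[ℚ] V)) :
    QSubgroup V where
  pts R _ _ := ⨅ K : {K : QSubgroup V // K.ContainsPair h δ}, K.1.pts R
  closed := by
    choose P hP using fun K : QSubgroup V => K.closed
    refine ⟨{f | ∃ K : QSubgroup V, K.ContainsPair h δ ∧ f ∈ P K}, fun R _ _ g => ?_⟩
    rw [Subgroup.mem_iInf]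
    constructor
    · rintro hg f ⟨K, hK, hf⟩
      exact (hP K R g).1 (hg ⟨K, hK⟩) f hf
    · exact fun hg K => (hP K.1 R g).2 fun f hf => hg f ⟨K.1, K.2, hf⟩

variable {h : ℂˣ →* ((ℝ ⊗[ℚ] V) ≃ₗ[ℝ] (ℝ ⊗[ℚ] V))} {δ : Module.End ℝ (ℝ ⊗[ℚ] V)}

theorem smallestGroup_le {K : QSubgroup V} (hK : K.ContainsPair h δ) : smallestGroup h δ ≤ K :=
  fun _ _ _ _ hg => (Subgroup.mem_iInf.1 hg) ⟨K, hK⟩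

theorem apply_mem_smallestGroup (z : ℂˣ) : h z ∈ (smallestGroup h δ).pts ℝ :=
  Subgroup.mem_iInf.2 fun K => K.2.1 ⟨z, rfl⟩

theorem unipAut_mem_smallestGroup : unipAut δ ∈ (smallestGroup h δ).pts ℝ[ε] :=
  Subgroup.mem_iInf.2 fun K => QSubgroup.memLieReal_iff.1 K.2.2

theorem isLeast_smallestGroup :
    IsLeast {K : QSubgroup V | K.ContainsPair h δ} (smallestGroup h δ) := by
  refine ⟨⟨?_, QSubgroup.memLieReal_iff.2 unipAut_mem_smallestGroup⟩, fun K hK =>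
    smallestGroup_le hK⟩
  rintro _ ⟨z, rfl⟩
  exact apply_mem_smallestGroup z

/-- Minimality is restated with the generators viewed as points of the group, so that
representations can be evaluated on them. -/
theorem isGeneratedBy_smallestGroup : IsGeneratedBy (smallestGroup h δ)
    (h.codRestrict _ apply_mem_smallestGroup) ⟨unipAut δ, unipAut_mem_smallestGroup⟩ :=
  fun K hK hK' => smallestGroup_le ⟨by rintro _ ⟨z, rfl⟩; exact hK z,
    QSubgroup.memLieReal_iff.2 hK'⟩

end SmallestGroup

/-! ### Subspaces spanned by orbits -/

section Orbits

variable {V : Type} [AddCommGroup V] [Module ℚ V] {G : QSubgroup V}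
  {E : Type} [AddCommGroup E] [Module ℚ E]

/-- The linear forms which vanish on the orbit of `x`. -/
def RegRep.orbitPerp (ρ : RegRep G E) (x : E) : Submodule ℚ (Module.Dual ℚ E) where
  carrier := {ℓ | ∀ (R : Type) [CommRing R] [Algebra ℚ R] (g : G.pts R),
    Module.Dual.baseChange R ℓ (ρ.act R g (1 ⊗ₜ x)) = 0}
  zero_mem' R _ _ g := by simp
  add_mem' h h' R _ _ g := by rw [map_add, LinearMap.add_apply, h, h', add_zero]
  smul_mem' c ℓ h R _ _ g := by rw [map_smul, LinearMap.smul_apply, h, smul_zero]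

/-- The common kernel of the linear forms killing the orbit over all R plays the part of its
rational span. It is stable because translating such a form by g again gives forms that kill the
orbit. -/
theorem RegRep.act_mem_orbit [FiniteDimensional ℚ E] (ρ : RegRep G E) (x : E)
    {R : Type} [CommRing R] [Algebra ℚ R] (g : G.pts R) {y : E}
    (hy : y ∈ (ρ.orbitPerp x).dualCoannihilator) :
    ρ.act R g (1 ⊗ₜ y) ∈ ((ρ.orbitPerp x).dualCoannihilator).baseChange R := by
  rw [mem_baseChange_iff_dual]
  intro φ hφ
  have hφ' : φ ∈ ρ.orbitPerp x := by
    rw [← Subspace.dualCoannihilator_dualAnnihilator_eq (W := ρ.orbitPerp x),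
      Submodule.mem_dualAnnihilator]
    exact hφ
  rw [← Module.forall_dual_apply_eq_zero_iff ℚ]
  intro lam
  -- The value φ(g y) lies in R; it is tested by an arbitrary rational functional on R, which turns
  -- y ↦ φ(g y) into a rational linear form.
  let ℓ : Module.Dual ℚ E := lam ∘ₗ (Module.Dual.baseChange R φ).restrictScalars ℚ ∘ₗ
    (ρ.act R g).restrictScalars ℚ ∘ₗ TensorProduct.mk ℚ R E 1
  suffices hℓ : ℓ ∈ ρ.orbitPerp x from (Submodule.mem_dualCoannihilator _).1 hy ℓ hℓ
  intro R' _ _ g'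
  let i₁ : R →ₐ[ℚ] R ⊗[ℚ] R' := Algebra.TensorProduct.includeLeft
  let i₂ : R' →ₐ[ℚ] R ⊗[ℚ] R' := Algebra.TensorProduct.includeRight
  let Lam : R ⊗[ℚ] R' →ₗ[ℚ] R' := TensorProduct.lift
    (LinearMap.lsmul ℚ R' ∘ₗ lam)
  -- On an R'-vector, ℓ is computed over R ⊗ R': apply g, then φ, then the functional on the factor
  -- R. There g and g' can be multiplied, and φ kills the orbit over this ring too.
  have key : ∀ w : R' ⊗[ℚ] E, Module.Dual.baseChange R' ℓ w =
      Lam (Module.Dual.baseChange (R ⊗[ℚ] R') φ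
        (extendEnd i₁ (ρ.act R g) (scalarMap i₂ E w))) := by
    intro w
    induction w with
    | zero => simp
    | add w w' hw hw' => simp only [map_add, hw, hw']
    | tmul r e =>
      have h1 : scalarMap i₂ E (r ⊗ₜ e) = (i₂ r) • scalarMap i₁ E (1 ⊗ₜ e) := by
        rw [scalarMap_tmul, scalarMap_tmul, map_one, TensorProduct.smul_tmul', smul_eq_mul, mul_one]
      rw [h1, map_smul, map_smul, extendEnd_scalarMap, dual_baseChange_scalarMap,
        dual_baseChange_tmul]
      have h2 : i₂ r • i₁ (Module.Dual.baseChange R φ (ρ.act R g (1 ⊗ₜ e))) =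
          (Module.Dual.baseChange R φ (ρ.act R g (1 ⊗ₜ e))) ⊗ₜ r := by
        simp [i₁, i₂]
      rw [h2]
      simp only [Lam, TensorProduct.lift.tmul, LinearMap.comp_apply]
      rw [mul_comm, ← Algebra.smul_def]
      rfl
  have h2 := hφ' (R ⊗[ℚ] R')
    (⟨extendAut i₁ g.1, G.extendAut_mem i₁ g.2⟩ * ⟨extendAut i₂ g'.1, G.extendAut_mem i₂ g'.2⟩)
  have h3 : (1 : R ⊗[ℚ] R') ⊗ₜ[ℚ] x = scalarMap i₂ E (1 ⊗ₜ x) := by rw [scalarMap_tmul, map_one]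
  rw [map_mul, Module.End.mul_apply, ρ.act_extendAut, ρ.act_extendAut, h3, extendEnd_scalarMap] at h2
  rw [key, h2, map_zero]

end Orbits

/-! ### Projections and the evaluation pairing as morphisms -/

namespace HodgeTriple

theorem isMorphism_fst (X Y : HodgeTriple) :
    IsMorphism (X.prod Y) X (LinearMap.fst ℚ X.V Y.V) := by
  refine ⟨fun k => ?_, fun p => ?_⟩
  · rintro _ ⟨x, hx, rfl⟩
    exact hx.1
  · rintro _ ⟨x, hx, rfl⟩
    exact hx.1

theorem isMorphism_snd (X Y : HodgeTriple) :
    IsMorphism (X.prod Y) Y (LinearMap.snd ℚ X.V Y.V) := by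
  refine ⟨fun k => ?_, fun p => ?_⟩
  · rintro _ ⟨x, hx, rfl⟩
    exact hx.2
  · rintro _ ⟨x, hx, rfl⟩
    exact hx.2

theorem contractLeft_baseChange_tmulR {R : Type} [CommRing R] [Algebra ℚ R] {V : Type}
    [AddCommGroup V] [Module ℚ V] (ξ : R ⊗[ℚ] Module.Dual ℚ V) (x : R ⊗[ℚ] V) :
    (contractLeft ℚ V).baseChange R (tmulR R (Module.Dual ℚ V) V ξ x) =
      (pairingR R V ξ x) ⊗ₜ 1 := by
  induction ξ with
  | zero => simp
  | add x x' hx hx' => simp only [map_add, LinearMap.add_apply, hx, hx', TensorProduct.add_tmul]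
  | tmul r φ =>
    induction x with
    | zero => simp
    | add x x' hx hx' => simp only [map_add, hx, hx', TensorProduct.add_tmul]
    | tmul s w =>
      rw [tmulR_tmul, LinearMap.baseChange_tmul, pairingR_tmul, contractLeft_apply,
        Algebra.algebraMap_eq_smul_one, mul_smul_comm, mul_one, TensorProduct.smul_tmul,
        smul_eq_mul, mul_one]

/-- The filtrations of the dual are annihilators: in negative weight, or in positive Hodge index,
monotonicity puts the second factor inside the subspace annihilated by the first. -/
theorem isMorphism_contractLeft {X : HodgeTriple} (hX : X.IsMHS) :
    IsMorphism (X.dual.tensor X) unit (contractLeft ℚ X.V) := by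
  constructor
  · intro k
    change Submodule.map (contractLeft ℚ X.V) (⨆ i : ℤ, Submodule.map₂
      (TensorProduct.mk ℚ (Module.Dual ℚ X.V) X.V) (X.W (-i - 1)).dualAnnihilator (X.W (k - i))) ≤
      if 0 ≤ k then (⊤ : Submodule ℚ ℚ) else ⊥
    split_ifs with hk
    · exact le_top
    · rw [Submodule.map_le_iff_le_comap]
      refine iSup_le fun i => Submodule.map₂_le.2 fun φ hφ x hx => ?_
      rw [Submodule.mem_comap, TensorProduct.mk_apply, contractLeft_apply, Submodule.mem_bot]
      exact (Submodule.mem_dualAnnihilator φ).1 hφ x (hX.monotone_W (by omega) hx)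
  · intro p
    change Submodule.map ((contractLeft ℚ X.V).baseChange ℂ) (Submodule.map
      (TensorProduct.AlgebraTensorModule.distribBaseChange ℚ ℂ
        (Module.Dual ℚ X.V) X.V).symm.toLinearMap (⨆ r : ℤ, Submodule.map₂ (TensorProduct.mk ℂ (ℂ ⊗[ℚ] Module.Dual ℚ X.V) (ℂ ⊗[ℚ] X.V))
        (((X.F (1 - r)).dualAnnihilator).comap (pairing X.V)) (X.F (p - r)))) ≤
      if p ≤ 0 then (⊤ : Submodule ℂ (ℂ ⊗[ℚ] ℚ)) else ⊥
    split_ifs with hp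
    · exact le_top
    · rw [Submodule.map_le_iff_le_comap, Submodule.map_le_iff_le_comap]
      refine iSup_le fun r => Submodule.map₂_le.2 fun ξ hξ x hx => ?_
      rw [Submodule.mem_comap, Submodule.mem_comap, Submodule.mem_bot]
      refine (contractLeft_baseChange_tmulR ξ x).trans ?_
      have : pairingR ℂ X.V ξ x = 0 :=
        (Submodule.mem_dualAnnihilator _).1 hξ x (hX.antitone_F (by omega) hx)
      rw [this, TensorProduct.zero_tmul]

/-! ### The Tannaka group -/

section Tannaka

variable {H : HodgeTriple} {R : Type} [CommRing R] [Algebra ℚ R]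

theorem tannaka_tmulR (t : H.tannakaGroup R) {X Y : HodgeTriple} (hX : Generated H X)
    (hY : Generated H Y) (x : R ⊗[ℚ] X.V) (y : R ⊗[ℚ] Y.V) :
    t.1 ⟨X.tensor Y, hX.tensor hY⟩ (tmulR R X.V Y.V x y) =
      tmulR R X.V Y.V (t.1 ⟨X, hX⟩ x) (t.1 ⟨Y, hY⟩ y) := by
  have h1 := t.2.2.1 ⟨X, hX⟩ ⟨Y, hY⟩ (tmulR R X.V Y.V x y)
  apply (tensorIso X Y R).injective
  refine h1.trans ?_
  have h2 : tensorIso X Y R (tmulR R X.V Y.V x y) = x ⊗ₜ y := distrib_tmulR x y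
  have h3 : tensorIso X Y R (tmulR R X.V Y.V (t.1 ⟨X, hX⟩ x) (t.1 ⟨Y, hY⟩ y)) =
    t.1 ⟨X, hX⟩ x ⊗ₜ t.1 ⟨Y, hY⟩ y := distrib_tmulR _ _
  rw [h2, h3]
  rfl

theorem dual_tmulR {V V' : Type} [AddCommGroup V] [Module ℚ V] [AddCommGroup V'] [Module ℚ V']
    (φ : Module.Dual ℚ V) (ψ : Module.Dual ℚ V') (x : R ⊗[ℚ] V) (y : R ⊗[ℚ] V') :
    Module.Dual.baseChange R (LinearMap.mul' ℚ ℚ ∘ₗ TensorProduct.map φ ψ) (tmulR R V V' x y) =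
      Module.Dual.baseChange R φ x * Module.Dual.baseChange R ψ y := by
  induction x with
  | zero => simp
  | add x x' hx hx' => simp only [map_add, LinearMap.add_apply, hx, hx', add_mul]
  | tmul r v =>
    induction y with
    | zero => simp
    | add x x' hx hx' => simp only [map_add, hx, hx', mul_add]
    | tmul s w =>
      simp only [tmulR_tmul, dual_baseChange_tmul, LinearMap.comp_apply, TensorProduct.map_tmul,
        LinearMap.mul'_apply, map_mul]
      ring

/-- Polynomials in the matrix coefficients are matrix coefficients of objects of the category
generated by `H`. -/
theorem exists_matrix_coefficient (f : MvPolynomial (H.V × Module.Dual ℚ H.V) ℚ) :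
    ∃ (X : HodgeTriple) (hX : Generated H X) (x : X.V) (ℓ : Module.Dual ℚ X.V),
      ∀ (R : Type) [CommRing R] [Algebra ℚ R] (t : H.tannakaGroup R),
        MvPolynomial.aeval (matCoef (t.1 ⟨H, Generated.self⟩)) f =
          Module.Dual.baseChange R ℓ (t.1 ⟨X, hX⟩ (1 ⊗ₜ x)) := by
  -- Constants come from the unit object, sums from direct sums, and multiplication by a matrix
  -- coefficient of H from tensoring with H.
  induction f using MvPolynomial.induction_on with
  | C c =>
    refine ⟨unit, Generated.unit, (1 : ℚ), (c • LinearMap.id : Module.Dual ℚ ℚ),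
      fun R _ _ t => ?_⟩
    rw [t.2.2.2, MvPolynomial.aeval_C]
    have := dual_baseChange_tmul (c • LinearMap.id : Module.Dual ℚ ℚ) (1 : R) (1 : ℚ)
    refine Eq.trans ?_ this.symm
    simp
  | add p q hp hq =>
    obtain ⟨X, hX, x, ℓ, h⟩ := hp
    obtain ⟨Y, hY, y, ℓ', h'⟩ := hq
    refine ⟨X.prod Y, hX.prod hY, ((x, y) : X.V × Y.V),
      (ℓ ∘ₗ LinearMap.fst ℚ X.V Y.V + ℓ' ∘ₗ LinearMap.snd ℚ X.V Y.V : Module.Dual ℚ (X.V × Y.V)),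
      fun R _ _ t => ?_⟩
    have h1 := t.2.1 ⟨X.prod Y, hX.prod hY⟩ ⟨X, hX⟩ _ (isMorphism_fst X Y)
      ((1 : R) ⊗ₜ[ℚ] ((x, y) : X.V × Y.V))
    have h2 := t.2.1 ⟨X.prod Y, hX.prod hY⟩ ⟨Y, hY⟩ _ (isMorphism_snd X Y)
      ((1 : R) ⊗ₜ[ℚ] ((x, y) : X.V × Y.V))
    have h3 : ∀ w : R ⊗[ℚ] (X.V × Y.V), Module.Dual.baseChange R
        (ℓ ∘ₗ LinearMap.fst ℚ X.V Y.V + ℓ' ∘ₗ LinearMap.snd ℚ X.V Y.V) w =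
        Module.Dual.baseChange R ℓ ((LinearMap.fst ℚ X.V Y.V).baseChange R w) +
        Module.Dual.baseChange R ℓ' ((LinearMap.snd ℚ X.V Y.V).baseChange R w) := fun w => by
      rw [map_add, LinearMap.add_apply, dual_baseChange_baseChange, dual_baseChange_baseChange]
    rw [map_add, h, h']
    refine Eq.trans ?_ (h3 _).symm
    refine congrArg₂ (· + ·) (congrArg _ ?_) (congrArg _ ?_)
    · exact h1.symm
    · exact h2.symm
  | mul_X p vφ hp =>
    obtain ⟨X, hX, x, ℓ, h⟩ := hp
    refine ⟨X.tensor H, hX.tensor Generated.self, (x ⊗ₜ[ℚ] vφ.1 : X.V ⊗[ℚ] H.V),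
      (LinearMap.mul' ℚ ℚ ∘ₗ TensorProduct.map ℓ vφ.2 : Module.Dual ℚ (X.V ⊗[ℚ] H.V)),
      fun R _ _ t => ?_⟩
    have h1 : (1 : R) ⊗ₜ[ℚ] (x ⊗ₜ[ℚ] vφ.1) = tmulR R X.V H.V (1 ⊗ₜ x) (1 ⊗ₜ vφ.1) := by
      rw [tmulR_tmul, mul_one]
    have h2 := tannaka_tmulR t hX Generated.self (1 ⊗ₜ x) (1 ⊗ₜ vφ.1)
    rw [← h1] at h2
    rw [map_mul, h, MvPolynomial.aeval_X]
    refine Eq.trans ?_ (congrArg _ h2).symm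
    exact (dual_tmulR ℓ vφ.2 _ _).symm

/-- Naturality under projections, inclusions and quotient maps propagates triviality. For a dual,
naturality of the evaluation pairing says that t preserves the pairing, and t is trivial on X and on
the unit; the pairing is perfect. -/
theorem tannaka_eq_one_of_eval {t : H.tannakaGroup R}
    (hH : ∀ {X : HodgeTriple}, Generated H X → X.IsMHS)
    (ht : ∀ x, t.1 ⟨H, Generated.self⟩ x = x) {X : HodgeTriple} (hX : Generated H X) :
    ∀ x, t.1 ⟨X, hX⟩ x = x := by
  induction hX with
  | self => exact ht
  | unit => exact t.2.2.2
  | @prod X Y hX hY hX' hY' =>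
    intro x
    refine prod_ext (V := X.V) (V' := Y.V) ?_ ?_
    · exact (t.2.1 ⟨X.prod Y, hX.prod hY⟩ ⟨X, hX⟩ _ (isMorphism_fst X Y) x).trans (hX' _)
    · exact (t.2.1 ⟨X.prod Y, hX.prod hY⟩ ⟨Y, hY⟩ _ (isMorphism_snd X Y) x).trans (hY' _)
  | @tensor X Y hX hY hX' hY' =>
    have : (t.1 ⟨X.tensor Y, hX.tensor hY⟩).toLinearMap = LinearMap.id :=
      tmulR_ext (V := X.V) (V' := Y.V) fun x y => by
        refine (tannaka_tmulR t hX hY x y).trans ?_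
        rw [hX', hY']
        rfl
    exact fun x => LinearMap.congr_fun this x
  | @dual X hX hX' =>
    intro ξ
    refine dual_ext (V := X.V) fun x => ?_
    have h1 := t.2.1 ⟨X.dual.tensor X, hX.dual.tensor hX⟩ ⟨unit, Generated.unit⟩ _
      (isMorphism_contractLeft (hH hX)) (tmulR R (Module.Dual ℚ X.V) X.V ξ x)
    have h2 := tannaka_tmulR t hX.dual hX ξ x
    rw [hX'] at h2
    have h3 := (congrArg ((contractLeft ℚ X.V).baseChange R) h2).symm.trans
      (h1.trans (t.2.2.2 _))
    have h4 := ((contractLeft_baseChange_tmulR _ x).symm.trans h3).trans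
      (contractLeft_baseChange_tmulR ξ x)
    have h5 := congrArg (TensorProduct.rid ℚ R) h4
    simpa using h5
  | @sub X Y f hX hY hf hinj hX' =>
    intro y
    have hY' : Generated H Y := Generated.sub f hX hY hf hinj
    apply baseChange_injective_of_injective (R := R) hinj
    exact (t.2.1 ⟨Y, hY'⟩ ⟨X, hX⟩ f hf y).trans (hX' _)
  | @quot X Y f hX hY hf hsurj hX' =>
    intro y
    have hY' : Generated H Y := Generated.quot f hX hY hf hsurj
    obtain ⟨x, rfl⟩ := baseChange_surjective_of_surjective (R := R) hsurj y
    exact (t.2.1 ⟨X, hX⟩ ⟨Y, hY'⟩ f hf x).symm.trans (by rw [hX'])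

variable {G : QSubgroup H.V} {a : ℂˣ →* G.pts ℝ} {u : G.pts ℝ[ε]}

/-- Points of the group give tensor automorphisms of the fibre functor. -/
theorem exists_tannaka (hG : IsGeneratedBy G a u) (hH : Adapted a u H (RegRep.standard G)) :
    ∃ ρ : ∀ X : {X : HodgeTriple // Generated H X}, RegRep G X.1.V,
      (∀ X, Adapted a u X.1 (ρ X)) ∧
      ∀ (R : Type) [CommRing R] [Algebra ℚ R] (g : G.pts R), ∃ t : H.tannakaGroup R,
        (∀ X, (t.1 X).toLinearMap = (ρ X).act R g) ∧ t.1 ⟨H, Generated.self⟩ = g.1 := by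
  -- The actions are chosen object by object; `Adapted.unique` removes the ambiguity.
  choose ρ hρ using fun X : {X : HodgeTriple // Generated H X} => exists_adapted hG hH X.2
  refine ⟨ρ, hρ, fun R _ _ g => ⟨⟨fun X => toAut ((ρ X).act R) g, ?_, ?_, ?_⟩, fun X => rfl, ?_⟩⟩
  · exact fun X Y f hf x => (hρ X).comm hG (hρ Y) hf g x
  · intro X Y x
    have h1 := (hρ ⟨_, X.2.tensor Y.2⟩).unique hG ((hρ X).tensor (hρ Y)) g
    have h2 : (ρ ⟨_, X.2.tensor Y.2⟩).act R g x =
        tensorAct ((ρ X).act R g) ((ρ Y).act R g) x := LinearMap.congr_fun h1 x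
    refine (congrArg (tensorIso X.1 Y.1 R) h2).trans ?_
    exact distrib_tensorAct _ _ _
  · intro x
    have h1 := (hρ ⟨_, Generated.unit⟩).unique hG adapted_unit g
    exact LinearMap.congr_fun h1 x
  · have h1 := (hρ ⟨_, Generated.self⟩).unique hG hH g
    exact LinearEquiv.toLinearMap_injective h1

/-- Tensor automorphisms of the fibre functor come from points of the group. -/
theorem tannaka_mem (hG : IsGeneratedBy G a u) (hH : Adapted a u H (RegRep.standard G))
    (t : H.tannakaGroup R) : t.1 ⟨H, Generated.self⟩ ∈ G.pts R := by
  obtain ⟨P, hP⟩ := G.closed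
  refine (hP R _).2 fun f hf => ?_
  obtain ⟨ρ, hρ, htan⟩ := exists_tannaka hG hH
  obtain ⟨X, hX, x, ℓ, hcoef⟩ := exists_matrix_coefficient f
  refine (hcoef R t).trans ?_
  let σ := ρ ⟨X, hX⟩
  let Y : Submodule ℚ X.V := (σ.orbitPerp x).dualCoannihilator
  -- Points of G are themselves tensor automorphisms, so the same formula computes f on G, where f
  -- vanishes.
  have hℓ : ℓ ∈ σ.orbitPerp x := fun R' _ _ g => by
    obtain ⟨t', ht', htH⟩ := htan R' g
    have h1 := hcoef R' t'
    rw [htH] at h1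
    have h2 := LinearMap.congr_fun (ht' ⟨X, hX⟩) (1 ⊗ₜ x)
    refine (congrArg _ h2.symm).trans (h1.symm.trans ?_)
    exact (hP R' g.1).1 g.2 f hf
  -- The orbit over ℚ contains x, through the neutral element.
  have hxY : x ∈ Y := (Submodule.mem_dualCoannihilator _).2 fun φ hφ => by
    have := hφ ℚ 1
    rw [map_one, Module.End.one_apply, dual_baseChange_tmul, one_mul] at this
    exact this
  have hYst : ∀ {R' : Type} [CommRing R'] [Algebra ℚ R'] (g : G.pts R'), ∀ y ∈ Y,
      σ.act R' g (1 ⊗ₜ y) ∈ Y.baseChange R' := fun g y hy => σ.act_mem_orbit x g hy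
  obtain ⟨h, δ, hc, ha, hu⟩ := hρ ⟨X, hX⟩
  have hMHS : (X.restrict Y).IsMHS := by
    refine hc.isMHS_restrict (fun z y hy => ?_) fun y hy => stable_of_forall (fun y hy => ?_) hy
    · have := stable_of_forall (hYst (a z)) hy
      rwa [show σ.act ℝ (a z) = (h z).toLinearMap from ha z] at this
    -- Stability under 1 + εδ puts εδy in Y over the dual numbers. Applying a form that vanishes on
    -- Y and reading the coefficient of ε gives δy in Y over ℝ.
    · have h1 := hYst u y hy
      rw [show σ.act ℝ[ε] u = 1 + (DualNumber.eps : ℝ[ε]) • extendEnd realToDual δ from hu,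
        LinearMap.add_apply, LinearMap.smul_apply, Module.End.one_apply,
        Submodule.add_mem_iff_right _ (Submodule.tmul_mem_baseChange_of_mem 1 hy),
        ← map_one realToDual, ← scalarMap_tmul, extendEnd_scalarMap] at h1
      rw [mem_baseChange_iff_dual] at h1 ⊢
      intro φ hφ
      have h2 := h1 φ hφ
      rw [map_smul, dual_baseChange_scalarMap] at h2
      have h3 := congrArg TrivSqZeroExt.snd h2
      simpa using h3
  have hY' : Generated H (X.restrict Y) := Generated.sub Y.subtype hX hMHS
    (isMorphism_restrict X Y) Y.injective_subtype
  have h1 := t.2.1 ⟨X.restrict Y, hY'⟩ ⟨X, hX⟩ Y.subtype (isMorphism_restrict X Y)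
    ((1 : R) ⊗ₜ[ℚ] (⟨x, hxY⟩ : Y))
  -- Naturality for the inclusion of the substructure Y keeps t x in Y, where ℓ is zero.
  have h2 : t.1 ⟨X, hX⟩ (1 ⊗ₜ x) ∈ Y.baseChange R := mem_baseChange_iff.2 ⟨_, h1⟩
  exact mem_baseChange_iff_dual.1 h2 ℓ fun y hy => (Submodule.mem_dualCoannihilator _).1 hy ℓ hℓ

end Tannaka

end HodgeTriple

end MumfordTate

end

theorem proposition4p2p2 (H : MumfordTate.HodgeTriple) (hH : H.IsMHS)
    (hpol : ∀ w : ℤ, MumfordTate.IsRPolarizable (H.grF w) w) :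
    ∃ (h : ℂˣ →* (TensorProduct ℚ ℝ H.V ≃ₗ[ℝ] TensorProduct ℚ ℝ H.V))
      (δ : Module.End ℝ (TensorProduct ℚ ℝ H.V)),
      H.IsCanonicalPair h δ ∧
      (∀ h' δ', H.IsCanonicalPair h' δ' → h' = h ∧ δ' = δ) ∧
      ∃ G : MumfordTate.QSubgroup H.V,
        IsLeast {K : MumfordTate.QSubgroup H.V | K.ContainsPair h δ} G ∧
        ∀ (R : Type) [CommRing R] [Algebra ℚ R],
          Function.Injective (H.tannakaEval R) ∧ (H.tannakaEval R).range = G.pts R := by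
  obtain ⟨h, δ, hc⟩ := hH.exists_canonicalPair
  have hG := MumfordTate.isGeneratedBy_smallestGroup (h := h) (δ := δ)
  have hA : MumfordTate.HodgeTriple.Adapted (h.codRestrict _ MumfordTate.apply_mem_smallestGroup)
      ⟨MumfordTate.unipAut δ, MumfordTate.unipAut_mem_smallestGroup⟩ H
      (MumfordTate.RegRep.standard (MumfordTate.smallestGroup h δ)) :=
    ⟨h, δ, hc, fun _ => rfl, rfl⟩
  refine ⟨h, δ, hc, fun h' δ' hc' => hc.unique hc', MumfordTate.smallestGroup h δ,
    MumfordTate.isLeast_smallestGroup, fun R _ _ => ⟨?_, le_antisymm ?_ fun g hg => ?_⟩⟩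
  · refine (injective_iff_map_eq_one _).2 fun t ht => Subtype.ext (funext fun X =>
      LinearEquiv.ext fun x => ?_)
    refine MumfordTate.HodgeTriple.tannaka_eq_one_of_eval (fun hX => ?_)
      (fun y => LinearEquiv.congr_fun ht y) X.2 x
    -- Each generated object carries a canonical pair, since G acts on it compatibly; this makes it
    -- a mixed Hodge structure.
    obtain ⟨_, _, _, hX, _⟩ := MumfordTate.HodgeTriple.exists_adapted hG hA hX
    exact hX.isMHS
  · rintro _ ⟨t, rfl⟩
    exact MumfordTate.HodgeTriple.tannaka_mem hG hA t
  · obtain ⟨_, _, ht⟩ := MumfordTate.HodgeTriple.exists_tannaka hG hA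
    obtain ⟨t, _, ht⟩ := ht R ⟨g, hg⟩
    exact ⟨t, ht⟩
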